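/- **Setting.** Let $H$ be a real Hilbert space with inner product $(\cdot,\cdot)_H$ and norm $\|\cdot\|$, and let $X$ be a Banach space with norm $\|\cdot\|_X$ such that (S) $X\subset H$ is dense and $\|x\|\le\|x\|_X$ for all $x\in X$. Let $V_\infty\subset H$ be open and contain $\{u\in H:\|u\|>R_0\}$ for some $R_0$; write $V^X_\infty=V_\infty\cap X$ with the topology of $X$. For a subspace $E$ put $B_E(\infty,R)=\{u\in E:\|u\|>R\}$, $B_E(\theta,\delta)=\{u\in E:\|u\|<\delta\}$, and let $\bar B$ denote the corresponding closed sets; for subspaces of $X$ the norm $\|\cdot\|_X$ is used. A map $f$ on an open set $U$ of a normed space is *continuously directional differentiable* if $Df(x)(u)=\lim_{t\to0}(f(x+tu)-f(x))/t$ exists for all $x\in U$ and all $u$, and $x\mapsto Df(x)(u)$ is continuous on $U$ for each $u$. A map $f$ defined on $S$ has the *strict Fréchet derivative $T$ at $\infty$* if $\|f(x)-f(y)-T(x-y)\|/\|x-y\|\to0$ as $x\ne y$ in $S$ and $(\|x\|,\|y\|)\to(\infty,\infty)$. Assume that $\mathcal L:V_\infty\to\mathbb R$ satisfies: * (F1)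 $\mathcal L$ is continuous and continuously directional differentiable. * (F2) There is a continuous and continuously directional differentiable map $A:V^X_\infty\to X$ with $D\mathcal L(x)(u)=(A(x),u)_H$ for $x\in V_\infty\cap X$, $u\in X$. * (F3) There is a map $B$ from $(V_\infty\cap X)\cup\{\infty\}$ to the bounded self-adjoint operators on $H$ with $B(\infty)(X)\subset X$ and $(DA(x)(u),v)_H=(B(x)u,v)_H$ for $x\in V_\infty\cap X$, $u,v\in X$. * (C1) $0\notin\sigma(B(\infty))$, or $0$ is an isolated point of $\sigma(B(\infty))$. * (C2) If $u\in H$ and $B(\infty)u\in X$, then $u\in X$. * (D) $B(x)=P(x)+Q(x)$ on $(V_\infty\cap X)\cup\{\infty\}$ with $P(x)$ bounded and positive definite and $Q(x)$ compact, such that: eigenvectors of $B(\infty)$ to negative eigenvalues lie in $X$; if $x_k\in V_\infty\cap X$ and $\|x_k\|\to\infty$, then $P(x_k)u\to P(\infty)u$ for all $u\in H$; $\|Q(x)-Q(\infty)\|_{L(H)}\to0$ as $x\in V_\infty\cap X$, $\|x\|\to\infty$; and for every sequence $x_n\in V_\infty\cap X$ with $\|x_n\|\to\infty$ there are $C_0>0$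 and $n_0$ with $(P(x_n)u,u)_H\ge C_0\|u\|^2$ for all $u\in H$, $n\ge n_0$. Let $H^0=\operatorname{Ker}B(\infty)$, $H^\pm=(H^0)^\perp=H^+\oplus H^-$, where $H^+$ and $H^-$ are the positive and negative spectral subspaces of $B(\infty)$, let $P^0$ be the orthogonal projection onto $H^0$, and $X^\pm=H^\pm\cap X$ with the norm $\|\cdot\|_X$. By (C2), $H^0\subset X$. Put $C_1=\|(B(\infty)|_{X^\pm})^{-1}\|_{L(X^\pm)}$ and $M(A)=\lim_{R\to\infty}\sup\{\|(I-P^0)A(z)\|_X: z\in H^0,\ \|z\|_X\ge R\}\in[0,\infty]$, and for $z\in H^0$, $x\in X^\pm$ put $G(z,x)=(I-P^0)A(z+x)-B(\infty)x$. For $\rho\in(0,\infty]$ consider the conditions * $(\mathrm E')_\rho$: there are $R_1>0$ and $\kappa>1$ such that either $\rho=\infty$, or $M(A)<\infty$ and $\rho>\frac{\kappa}{\kappa-1}C_1M(A)$; and $\kappa C_1\|G(z,x_1)-G(z,x_2)\|_X\le\|x_1-x_2\|_X$ for all $z\in H^0$ with $\|z\|\ge R_1$ and $x_1,x_2\in X^\pm$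 with $\|x_i\|_X<\rho$ and $z+x_i\in V_\infty$; * $(\mathrm E)_\rho$: the same with $\kappa C_1\|G(z_1,x_1)-G(z_2,x_2)\|_X\le\|z_1+x_1-z_2-x_2\|_X$ for all $z_1,z_2\in H^0$ with $\|z_i\|\ge R_1$ and $x_1,x_2\in X^\pm$ with $\|x_i\|_X<\rho$ and $z_i+x_i\in V_\infty$; * $(\mathrm{SE})_\rho$: either $\rho=\infty$, or $M(A)<\infty$ and $\rho>C_1M(A)$; and for every $\varepsilon>0$ there is $R'$ with $\|G(z_1,x_1)-G(z_2,x_2)\|_X\le\varepsilon\|z_1+x_1-z_2-x_2\|_X$ for all $z_i\in H^0$ with $\|z_i\|>R'$ and $x_i\in X^\pm$ with $\|x_i\|_X<\rho$ and $z_i+x_i\in V_\infty$. For $R>0$ and $\delta\in(0,\infty]$ let $C_{R,\delta}=B_{H^0}(\infty,R)\oplus B_{H^+}(\theta,\delta)\oplus B_{H^-}(\theta,\delta)\subset H$. **Theorem.** Suppose in addition that $H^0\ne\{0\}$ and that $(\mathrm E')_\rho$ holds for some $\rho\in(0,\infty]$. Then for every $r\in(0,\infty)$ there are $R>0$ with $B_H(\infty,R)\subset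 V_\infty$, $\delta_r>0$, a continuous map $h^\infty:B_{H^0}(\infty,R)\to X^\pm$ with $\|h^\infty(z)\|_X\le\rho$ and $$(I-P^0)A(z+h^\infty(z))=0\qquad\forall z\in B_{H^0}(\infty,R),$$ where $x=h^\infty(z)$ is the only solution $x\in X^\pm$ with $\|x\|_X\le\rho$ of $(I-P^0)A(z+x)=0$, an open set $V(R,r)\subset\overline{C_{R,r+\rho}}$ of $H$, and a homeomorphism $\Phi:C_{R,\delta_r}\to V(R,r)$ of the form $$\Phi(z+u^++u^-)=z+h^\infty(z)+\phi_z(u^++u^-),\qquad \phi_z(u^++u^-)\in H^\pm,$$ with $\Phi(C_{R,\delta_r}\cap X)\subset X$, such that on $C_{R,\delta_r}$ $$\mathcal L(\Phi(z+u^++u^-))=\|u^+\|^2-\|u^-\|^2+\mathcal L(z+h^\infty(z)).$$ Moreover: * (a) $\Phi(z)=z+h^\infty(z)$ for $z\in B_{H^0}(\infty,R)$, and $\phi_z(u^++u^-)\in H^-$ if and only if $u^+=0$ (for $z+u^++u^-\in C_{R,\delta_r}$). * (b) $B_{H^0}(\infty,R)\oplus B_{H^-}(\theta,\delta_r)\subset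 X$, and the restriction of $\Phi$ to this set is a homeomorphism onto its image, both for the topologies induced by $H$ and for those induced by $X$. With $\mathcal L^\infty(z)=\mathcal L(z+h^\infty(z))$ on $B_{H^0}(\infty,R)$: * (i) If $M(A)=0$, then $\|h^\infty(z)\|_X\to0$ as $\|z\|_X\to\infty$. * (ii) If $A$ is $C^1$ on $V_\infty^X$, then $h^\infty$ is $C^1$ (into $X^\pm$), $(I-P^0)A'(z+h^\infty(z))|_{X^\pm}$ is an isomorphism of $X^\pm$, $$dh^\infty(z)=-\bigl[(I-P^0)A'(z+h^\infty(z))|_{X^\pm}\bigr]^{-1}(I-P^0)A'(z+h^\infty(z))|_{H^0},$$ $\mathcal L^\infty$ is $C^2$, and $$d\mathcal L^\infty(z_0)(z)=(A(z_0+h^\infty(z_0)),z)_H\qquad\forall z_0\in B_{H^0}(\infty,R),\ z\in H^0.\tag{$*$}$$ * (iii) If $\mathcal L$ is $C^2$ on $V_\infty$, then $h^\infty$ is $C^1$ as a map to $H^\pm$ and as a map to $X^\pm$. If moreover $(\mathrm E)_\rho$ holds, then $R$, $\delta_r$, $h^\infty$, $V(R,r)$, $\Phi$ can be chosen so that also: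 * (iv) $h^\infty$ is Lipschitz as a map to $X^\pm$, and as a map to $H^\pm$ (with $\|\cdot\|$) it has the strict Fréchet derivative $0$ at $\infty$; if $(\mathrm{SE})_\rho$ holds, it has the strict Fréchet derivative $0$ at $\infty$ also as a map to $X^\pm$ (with $\|\cdot\|_X$). * (v) $\mathcal L^\infty$ is $C^1$ and $(*)$ holds. * (vi) If $B(\infty)|_X\in L(X)$ and $A$ has the strict Fréchet derivative $B(\infty)|_X$ at $\infty$ (as a map from $V_\infty\cap X\subset X$ to $X$), then $\mathcal L^\infty$ is $C^{2-0}$, that is, $C^1$ with locally Lipschitz derivative, and $d\mathcal L^\infty$ has the strict Fréchet derivative $0$ at $\infty$. In this case $(\mathrm{SE})_{\rho'}$ and $(\mathrm E)_{\rho'}$ hold for $\rho'=\infty$, and, if $M(A)<\infty$, for every $\rho'>C_1M(A)$. -/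

import Mathlib

open Set Filter Topology
open scoped ENNReal InnerProductSpace

noncomputable section

namespace SplitInfty

variable {H X : Type*} [NormedAddCommGroup H] [InnerProductSpace ℝ H] [CompleteSpace H]
  [NormedAddCommGroup X] [NormedSpace ℝ X]

/-! The Banach space `X ⊂ H` is modelled by a Banach space `X` with a continuous linear
injection `ι : X →L[ℝ] H`; the norm of `X` is `‖·‖_X` and the norm of `H` is `‖·‖`.
`V` is the neighbourhood of infinity `V_∞` in `H`, and `ι ⁻¹' V` is `V_∞ ∩ X` with the topology
of `X`. The operator `B(∞)` is `Binf`. Functions that the paper defines on a subset only are total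
functions here, and nothing is assumed about their values off that subset. -/

/-- The inverse of the inclusion `X ⊂ H`: the element of `X` that equals `u`, for `u ∈ X`. -/
def lift (ι : X →L[ℝ] H) (u : H) : X := Function.invFun ι u

/-! ### Differentiability notions -/

/-- `f` is continuously directional differentiable on `U`: all directional derivatives
`Df(x)(u) = lim_{t → 0} (f(x + tu) - f(x)) / t` exist for `x ∈ U`, and `x ↦ Df(x)(u)` is continuous
on `U` for every `u`. -/
def ContDirDiffOn {E F : Type*} [NormedAddCommGroup E] [NormedSpace ℝ E]
    [NormedAddCommGroup F] [NormedSpace ℝ F] (f : E → F) (U : Set E) : Prop :=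
  ∀ u : E, (∀ x ∈ U, LineDifferentiableAt ℝ f x u) ∧
    ContinuousOn (fun x => lineDeriv ℝ f x u) U

/-- `f`, defined on `S`, is strictly Fréchet differentiable at infinity with derivative `f'`:
`‖f x - f y - f' (x - y)‖ / ‖x - y‖ → 0` as `x ≠ y` in `S` and `(‖x‖, ‖y‖) → (∞, ∞)`. -/
def HasStrictFDerivAtInfty {E F : Type*} [NormedAddCommGroup E] [NormedSpace ℝ E]
    [NormedAddCommGroup F] [NormedSpace ℝ F] (f : E → F) (f' : E →L[ℝ] F) (S : Set E) : Prop :=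
  ∀ ε > 0, ∃ R : ℝ, ∀ x ∈ S, ∀ y ∈ S, R < ‖x‖ → R < ‖y‖ →
    ‖f x - f y - f' (x - y)‖ ≤ ε * ‖x - y‖

/-- `f` is of class `C^{2-0}` on the open set `S`: it is `C^1` with locally Lipschitz
derivative. -/
def IsC2minus0On {E : Type*} [NormedAddCommGroup E] [NormedSpace ℝ E] (f : E → ℝ)
    (S : Set E) : Prop :=
  ContDiffOn ℝ 1 f S ∧ LocallyLipschitzOn S (fderiv ℝ f)

/-! ### The decomposition `H = H⁰ ⊕ H⁺ ⊕ H⁻` -/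

/-- `H⁰ = Ker B(∞)`. -/
abbrev H0 (Binf : H →L[ℝ] H) : Submodule ℝ H := LinearMap.ker (Binf : H →ₗ[ℝ] H)

/-- `H^± = (H⁰)^⊥`. -/
abbrev Hpm (Binf : H →L[ℝ] H) : Submodule ℝ H := (H0 Binf)ᗮ

/-- `H⁻`, the negative subspace of `B(∞)`. Under condition (D) the negative part of the spectrum of
`B(∞)` consists of finitely many eigenvalues of finite multiplicity, so the negative spectral
subspace is the sum of the eigenspaces to negative eigenvalues. -/
def Hminus (Binf : H →L[ℝ] H) : Submodule ℝ H :=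
  ⨆ μ : {μ : ℝ // μ < 0}, Module.End.eigenspace (Binf : H →ₗ[ℝ] H) μ.1

/-- `H⁺`, the positive subspace of `B(∞)`: the orthogonal complement of `H⁰ ⊕ H⁻`. -/
def Hplus (Binf : H →L[ℝ] H) : Submodule ℝ H := (H0 Binf ⊔ Hminus Binf)ᗮ

/-- The orthogonal projection `P⁰` of `H` onto `H⁰`. -/
def P0 (Binf : H →L[ℝ] H) : H →L[ℝ] H := (H0 Binf).starProjection

/-- `X^± = H^± ∩ X`, with the norm of `X`. -/
abbrev Xpm (ι : X →L[ℝ] H) (Binf : H →L[ℝ] H) : Submodule ℝ X :=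
  (Hpm Binf).comap (ι : X →ₗ[ℝ] H)

/-- `(I - P⁰) x` as an element of `X`, for `x ∈ X` (recall `H⁰ ⊂ X`). -/
def QX (ι : X →L[ℝ] H) (Binf : H →L[ℝ] H) (x : X) : X := x - lift ι (P0 Binf (ι x))

/-- `B(∞) x` as an element of `X`, for `x ∈ X`. -/
def BX (ι : X →L[ℝ] H) (Binf : H →L[ℝ] H) (x : X) : X := lift ι (Binf (ι x))

/-- `C_{R, δ} = B_{H⁰}(∞, R) ⊕ B_{H⁺}(θ, δ) ⊕ B_{H⁻}(θ, δ)`, where `δ = ∞` is allowed. -/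
def tube (Binf : H →L[ℝ] H) (R : ℝ) (δ : ℝ≥0∞) : Set H :=
  {w | ∃ z ∈ H0 Binf, ∃ u ∈ Hplus Binf, ∃ v ∈ Hminus Binf,
    R < ‖z‖ ∧ ‖u‖ₑ < δ ∧ ‖v‖ₑ < δ ∧ w = z + u + v}

/-- `B_{H⁰}(∞, R) ⊕ B_{H⁻}(θ, δ)`. -/
def tubeMinus (Binf : H →L[ℝ] H) (R : ℝ) (δ : ℝ≥0∞) : Set H :=
  {w | ∃ z ∈ H0 Binf, ∃ v ∈ Hminus Binf, R < ‖z‖ ∧ ‖v‖ₑ < δ ∧ w = z + v}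

/-- `B_{H⁰}(∞, R)`, as a subset of `H⁰`. -/
def ext0 (Binf : H →L[ℝ] H) (R : ℝ) : Set (H0 Binf) := {z | R < ‖z‖}

/-! ### The conditions -/

/-- (S): `X ⊂ H` is dense with continuous inclusion, and `‖x‖ ≤ ‖x‖_X`. -/
def CondS (ι : X →L[ℝ] H) : Prop :=
  Function.Injective ι ∧ DenseRange ι ∧ ∀ x, ‖ι x‖ ≤ ‖x‖

/-- `V` is an open neighbourhood of infinity in `H`. -/
def IsOpenNhdInfty (V : Set H) : Prop := IsOpen V ∧ ∃ R : ℝ, ∀ u : H, R < ‖u‖ → u ∈ V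

/-- (F1). -/
def CondF1 (V : Set H) (L : H → ℝ) : Prop := ContinuousOn L V ∧ ContDirDiffOn L V

/-- (F2), for the map `A`. -/
def CondF2 (ι : X →L[ℝ] H) (V : Set H) (L : H → ℝ) (A : X → X) : Prop :=
  ContinuousOn A (ι ⁻¹' V) ∧ ContDirDiffOn A (ι ⁻¹' V) ∧
    ∀ x ∈ ι ⁻¹' V, ∀ u : X, lineDeriv ℝ L (ι x) (ι u) = ⟪ι (A x), ι u⟫_ℝ

/-- (F3), for the map `B` on `V ∩ X` and its value `Binf` at infinity. -/
def CondF3 (ι : X →L[ℝ] H) (V : Set H) (A : X → X) (B : X → H →L[ℝ] H)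
    (Binf : H →L[ℝ] H) : Prop :=
  (∀ x ∈ ι ⁻¹' V, IsSelfAdjoint (B x)) ∧ IsSelfAdjoint Binf ∧
    (∀ u : X, Binf (ι u) ∈ range ι) ∧
    ∀ x ∈ ι ⁻¹' V, ∀ u v : X, ⟪ι (lineDeriv ℝ A x u), ι v⟫_ℝ = ⟪B x (ι u), ι v⟫_ℝ

/-- (C1): `0` is not in the spectrum of `B(∞)`, or is an isolated point of it. -/
def CondC1 (Binf : H →L[ℝ] H) : Prop :=
  (0 : ℝ) ∉ spectrum ℝ Binf ∨ ∃ ε > 0, spectrum ℝ Binf ∩ Metric.ball 0 ε = {0}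

/-- (C2). -/
def CondC2 (ι : X →L[ℝ] H) (Binf : H →L[ℝ] H) : Prop :=
  ∀ u : H, Binf u ∈ range ι → u ∈ range ι

/-- A positive definite operator (symmetry is not required). -/
def IsPosDef (P : H →L[ℝ] H) : Prop := ∀ u : H, u ≠ 0 → 0 < ⟪P u, u⟫_ℝ

/-- (D), with (D1)--(D4). -/
def CondD (ι : X →L[ℝ] H) (V : Set H) (B : X → H →L[ℝ] H) (Binf : H →L[ℝ] H) : Prop :=
  ∃ (P Q : X → H →L[ℝ] H) (Pinf Qinf : H →L[ℝ] H),
    (∀ x ∈ ι ⁻¹' V, B x = P x + Q x ∧ IsPosDef (P x) ∧ IsCompactOperator (Q x)) ∧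
    (Binf = Pinf + Qinf ∧ IsPosDef Pinf ∧ IsCompactOperator Qinf) ∧
    (∀ μ : ℝ, μ < 0 → ∀ u : H, Binf u = μ • u → u ∈ range ι) ∧
    (∀ x : ℕ → X, (∀ k, x k ∈ ι ⁻¹' V) → Tendsto (fun k => ‖ι (x k)‖) atTop atTop →
      ∀ u : H, Tendsto (fun k => P (x k) u) atTop (𝓝 (Pinf u))) ∧
    (∀ ε > 0, ∃ R : ℝ, ∀ x ∈ ι ⁻¹' V, R < ‖ι x‖ → ‖Q x - Qinf‖ < ε) ∧
    (∀ x : ℕ → X, (∀ k, x k ∈ ι ⁻¹' V) → Tendsto (fun k => ‖ι (x k)‖) atTop atTop →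
      ∃ C₀ > 0, ∃ n₀ : ℕ, ∀ n ≥ n₀, ∀ u : H, C₀ * ‖u‖ ^ 2 ≤ ⟪P (x n) u, u⟫_ℝ)

/-- `C₁ = ‖(B(∞)|_{X^±})⁻¹‖` in `L(X^±, X^±)`: since `B(∞)` maps `X^±` bijectively onto `X^±`, this
is the least `C ≥ 0` with `‖x‖_X ≤ C ‖B(∞) x‖_X` on `X^±`. -/
def C1const (ι : X →L[ℝ] H) (Binf : H →L[ℝ] H) : ℝ :=
  sInf {C : ℝ | 0 ≤ C ∧ ∀ x : Xpm ι Binf, ‖(x : X)‖ ≤ C * ‖BX ι Binf x‖}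

/-- `M(A) = lim_{R → ∞} sup {‖(I - P⁰) A(z)‖_X : z ∈ H⁰, ‖z‖_X ≥ R}`, in `[0, ∞]`; the supremum
is decreasing in `R`. -/
def MA (ι : X →L[ℝ] H) (A : X → X) (Binf : H →L[ℝ] H) : ℝ≥0∞ :=
  ⨅ R : ℝ, ⨆ z : H0 Binf, ⨆ _ : R ≤ ‖lift ι (z : H)‖, ‖QX ι Binf (A (lift ι (z : H)))‖ₑ

/-- `(I - P⁰) A(z + x) - B(∞) x`, for `z ∈ H⁰` and `x ∈ X^±`. -/
def remainder (ι : X →L[ℝ] H) (A : X → X) (Binf : H →L[ℝ] H) (z : H0 Binf)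
    (x : Xpm ι Binf) : X :=
  QX ι Binf (A (lift ι (z : H) + x)) - BX ι Binf x

/-- (E) with the radius `ρ = ρ_A ∈ (0, ∞]`. -/
def CondE (ι : X →L[ℝ] H) (V : Set H) (A : X → X) (Binf : H →L[ℝ] H) (ρ : ℝ≥0∞) : Prop :=
  ∃ R₁ > 0, ∃ κ > 1,
    (ρ = ⊤ ∨ (MA ι A Binf < ⊤ ∧
      ENNReal.ofReal (κ / (κ - 1) * C1const ι Binf) * MA ι A Binf < ρ)) ∧
    ∀ z₁ z₂ : H0 Binf, R₁ ≤ ‖z₁‖ → R₁ ≤ ‖z₂‖ → ∀ x₁ x₂ : Xpm ι Binf,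
      ‖x₁‖ₑ < ρ → ‖x₂‖ₑ < ρ → (z₁ : H) + ι x₁ ∈ V → (z₂ : H) + ι x₂ ∈ V →
      κ * C1const ι Binf * ‖remainder ι A Binf z₁ x₁ - remainder ι A Binf z₂ x₂‖ ≤
        ‖lift ι (z₁ : H) + (x₁ : X) - lift ι (z₂ : H) - (x₂ : X)‖

/-- (E') with the radius `ρ = ρ_A ∈ (0, ∞]`. -/
def CondE' (ι : X →L[ℝ] H) (V : Set H) (A : X → X) (Binf : H →L[ℝ] H) (ρ : ℝ≥0∞) : Prop :=
  ∃ R₁ > 0, ∃ κ > 1,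
    (ρ = ⊤ ∨ (MA ι A Binf < ⊤ ∧
      ENNReal.ofReal (κ / (κ - 1) * C1const ι Binf) * MA ι A Binf < ρ)) ∧
    ∀ z : H0 Binf, R₁ ≤ ‖z‖ → ∀ x₁ x₂ : Xpm ι Binf,
      ‖x₁‖ₑ < ρ → ‖x₂‖ₑ < ρ → (z : H) + ι x₁ ∈ V → (z : H) + ι x₂ ∈ V →
      κ * C1const ι Binf * ‖remainder ι A Binf z x₁ - remainder ι A Binf z x₂‖ ≤
        ‖(x₁ : X) - (x₂ : X)‖

/-- (SE) with the radius `ρ = ρ_A ∈ (0, ∞]`. -/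
def CondSE (ι : X →L[ℝ] H) (V : Set H) (A : X → X) (Binf : H →L[ℝ] H) (ρ : ℝ≥0∞) : Prop :=
  (ρ = ⊤ ∨ (MA ι A Binf < ⊤ ∧ ENNReal.ofReal (C1const ι Binf) * MA ι A Binf < ρ)) ∧
    ∀ ε > 0, ∃ R' : ℝ, ∀ z₁ z₂ : H0 Binf, R' < ‖z₁‖ → R' < ‖z₂‖ → ∀ x₁ x₂ : Xpm ι Binf,
      ‖x₁‖ₑ < ρ → ‖x₂‖ₑ < ρ → (z₁ : H) + ι x₁ ∈ V → (z₂ : H) + ι x₂ ∈ V →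
      ‖remainder ι A Binf z₁ x₁ - remainder ι A Binf z₂ x₂‖ ≤
        ε * ‖lift ι (z₁ : H) + (x₁ : X) - lift ι (z₂ : H) - (x₂ : X)‖

/-- `z + h(z)` as an element of `X`. -/
def graphPt (ι : X →L[ℝ] H) (Binf : H →L[ℝ] H) (h : H0 Binf → Xpm ι Binf) (z : H0 Binf) : X :=
  lift ι (z : H) + (h z : X)

/-- The reduced functional `z ↦ L(z + h(z))` on `H⁰`. -/
def reduced (ι : X →L[ℝ] H) (L : H → ℝ) (Binf : H →L[ℝ] H) (h : H0 Binf → Xpm ι Binf)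
    (z : H0 Binf) : ℝ :=
  L (ι (graphPt ι Binf h z))

end SplitInfty

end

/-! Condition (D) makes the operators B(x), for ‖x‖ large, inherit the saddle structure of B(∞):
with one constant a > 0 the form of B(x) is at least a‖u‖² on H⁺ and at most -a‖v‖² on H⁻, its mixed
part is bounded, and B(x) tends to 0 in norm on H⁰ (`exists_saddleAtInfty`). Since B(∞) is a compact
perturbation of a coercive operator, H⁰ and H⁻ have finite dimension and pointwise convergence is
uniform on them; H⁺ needs a weak compactness argument (`eventually_coercive`).

By (C2) and the closed graph theorem B(∞) restricts to an isomorphism of X^±. Condition (E') makes x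
↦ x - B(∞)⁻¹(I - P⁰)A(z + x) a contraction of ratio 1/κ, and the condition on M(A) keeps the
invariant ball inside radius ρ; this gives h (`exists_implicit`). The directional derivatives of A
are linear, because ι carries them to B(x)u, and they inherit the Lipschitz bound; as H⁰ has finite
dimension, h is C¹ already under (E') (`implicit_hasFDerivAt`). Since A(z + h(z)) is orthogonal to
H^±, the derivative of h drops out of dL^∞, which is formula (*).

For Φ no Taylor expansion in H is available, so convexity replaces it. On the whole fibre z + h(z) +
H^± the functional is convex along H⁺ and strongly concave along H⁻; this is proved on X by
differentiating twice and reaches H by density. Maximising over H⁻ gives a continuous section. The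
maximal value as a function of u, and the deficit below it as a function of v, vanish at 0, grow
quadratically and are star-convex, so a radial rescaling turns each into a squared norm
(`exists_radial_homeomorph`, `exists_morse_homeomorph`). The result is a homeomorphism of the whole
exterior region with linear bounds on the fibres, which is restricted to a tube.

For the behaviour at infinity, the saddle inequality bounds a‖h'(z)ζ‖ by ‖B(z + h(z))ζ‖, which is
small for ζ in H⁰. Mean value estimates along segments follow; pairs of points whose segment crosses
the excluded ball are handled by sublinear growth (`hasStrictFDerivAtInfty_zero`). -/

set_option linter.unusedSectionVars false

namespace SplitInfty

/-! ### Radial normalisation of star-convex functions. -/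

section Radial

variable {Y E : Type*} [TopologicalSpace Y] [NormedAddCommGroup E] [NormedSpace ℝ E]

/-- A function that is star-shaped convex and grows at least quadratically is turned into the
squared norm by a fibrewise radial homeomorphism. -/
theorem exists_radial_homeomorph (g : Y → E → ℝ) (hg : Continuous fun p : Y × E => g p.1 p.2)
    (g0 : ∀ y, g y 0 = 0) {c : ℝ} (hc : 0 < c) (hgc : ∀ y e, c * ‖e‖ ^ 2 ≤ g y e)
    (hconv : ∀ y e (s : ℝ), 0 ≤ s → s ≤ 1 → g y (s • e) ≤ s * g y e) :
    ∃ Θ : Y × E ≃ₜ Y × E, ∀ y e, (Θ (y, e)).1 = y ∧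
      (∃ s : ℝ, 0 < s ∧ (Θ (y, e)).2 = s • e) ∧ g y (Θ (y, e)).2 = ‖e‖ ^ 2 := by
  have gpos : ∀ y e, e ≠ 0 → 0 < g y e := fun y e he =>
    lt_of_lt_of_le (by have := norm_pos_iff.2 he; positivity) (hgc y e)
  -- On a ray g(s e) ≤ (s/t) g(t e) < g(t e). This strict monotonicity makes the rescaling factor
  -- unique.
  have mono : ∀ y e, e ≠ 0 → ∀ s t : ℝ, 0 ≤ s → s < t → g y (s • e) < g y (t • e) := by
    intro y e he s t hs hst
    have ht : 0 < t := hs.trans_lt hst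
    have h1 := hconv y (t • e) (s / t) (by positivity) ((div_le_one ht).2 hst.le)
    rw [smul_smul, div_mul_cancel₀ _ ht.ne'] at h1
    have h2 := gpos y (t • e) (smul_ne_zero ht.ne' he)
    have h3 : s / t < 1 := (div_lt_one ht).2 hst
    nlinarith
  have ex : ∀ (y : Y) (a : E), ∃ t : ℝ, 0 < t ∧ g y (t • a) = ‖a‖ ^ 2 := by
    intro y a
    by_cases ha : a = 0
    · exact ⟨1, one_pos, by simp [ha, g0]⟩
    have hcont : Continuous fun t : ℝ => g y (t • a) :=
      hg.comp (Continuous.prodMk continuous_const (continuous_id.smul continuous_const))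
    -- Quadratic growth gives g(T a) ≥ ‖a‖² at T = 1/√c, so the intermediate value theorem on [0, T]
    -- yields the factor.
    set T : ℝ := 1 / √c
    have hT : 0 < T := by positivity
    have hT2 : c * T ^ 2 = 1 := by
      simp only [T, div_pow, Real.sq_sqrt hc.le]; field_simp
    have hna : 0 < ‖a‖ := norm_pos_iff.2 ha
    have h1 : ‖a‖ ^ 2 ≤ g y (T • a) := by
      refine le_trans (le_of_eq ?_) (hgc y (T • a))
      rw [norm_smul, Real.norm_of_nonneg hT.le, mul_pow, ← mul_assoc, hT2, one_mul]
    obtain ⟨t, ht, hta⟩ := intermediate_value_Icc hT.le hcont.continuousOn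
      (show ‖a‖ ^ 2 ∈ Icc (g y ((0 : ℝ) • a)) (g y (T • a)) by
        rw [zero_smul, g0]; exact ⟨by positivity, h1⟩)
    refine ⟨t, lt_of_le_of_ne ht.1 ?_, hta⟩
    rintro rfl
    simp only [zero_smul, g0] at hta
    nlinarith
  choose τ hτ hgτ using ex
  have key : ∀ y a (s : ℝ), a ≠ 0 → 0 < s → g y (s • a) = ‖a‖ ^ 2 → s = τ y a := by
    intro y a s ha hs h
    rcases lt_trichotomy s (τ y a) with h1 | h1 | h1
    · have := mono y a ha s _ hs.le h1
      rw [h, hgτ] at this; exact absurd this (lt_irrefl _)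
    · exact h1
    · have := mono y a ha _ s (hτ y a).le h1
      rw [h, hgτ] at this; exact absurd this (lt_irrefl _)
  -- `fwd` gives e the length √(g y e) and keeps its direction; the map Θ wanted is its inverse
  -- `inv`.
  set inv : Y × E → Y × E := fun p => (p.1, τ p.1 p.2 • p.2)
  set fwd : Y × E → Y × E := fun p => (p.1, (√(g p.1 p.2) / ‖p.2‖) • p.2)
  have norm_fwd : ∀ y e, ‖(√(g y e) / ‖e‖) • e‖ = √(g y e) := by
    intro y e
    by_cases he : e = 0
    · simp [he, g0]
    · rw [norm_smul, Real.norm_of_nonneg (by positivity), div_mul_cancel₀ _ (norm_ne_zero_iff.2 he)]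
  have g_nonneg : ∀ y e, 0 ≤ g y e := fun y e => le_trans (by positivity) (hgc y e)
  refine ⟨⟨⟨inv, fwd, ?_, ?_⟩, ?_, ?_⟩, fun y e => ⟨rfl, ⟨τ y e, hτ y e, rfl⟩, hgτ y e⟩⟩
  · rintro ⟨y, a⟩
    by_cases ha : a = 0
    · simp [inv, fwd, ha]
    have hna : ‖a‖ ≠ 0 := norm_ne_zero_iff.2 ha
    simp only [inv, fwd, hgτ, Real.sqrt_sq (norm_nonneg a), norm_smul, smul_smul, Prod.mk.injEq,
      true_and, Real.norm_of_nonneg (hτ y a).le]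
    rw [show ‖a‖ / (τ y a * ‖a‖) * τ y a = 1 by have := (hτ y a).ne'; field_simp, one_smul]
  · rintro ⟨y, e⟩
    by_cases he : e = 0
    · simp [inv, fwd, he]
    have hne : ‖e‖ ≠ 0 := norm_ne_zero_iff.2 he
    have hsq : 0 < √(g y e) := Real.sqrt_pos.2 (gpos y e he)
    have hs : 0 < √(g y e) / ‖e‖ := by positivity
    have h1 : (√(g y e) / ‖e‖)⁻¹ = τ y ((√(g y e) / ‖e‖) • e) := by
      refine key y _ _ (smul_ne_zero hs.ne' he) (inv_pos.2 hs) ?_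
      rw [smul_smul, inv_mul_cancel₀ hs.ne', one_smul, norm_fwd, Real.sq_sqrt (g_nonneg y e)]
    simp only [inv, fwd, Prod.mk.injEq, true_and]
    rw [← h1, smul_smul, inv_mul_cancel₀ hs.ne', one_smul]
  · refine continuous_fst.prodMk (continuous_iff_continuousAt.2 ?_)
    rintro ⟨y, a⟩
    by_cases ha : a = 0
    · subst ha
      have hb : ∀ p : Y × E, ‖τ p.1 p.2 • p.2‖ ≤ √(c⁻¹) * ‖p.2‖ := by
        intro p
        have h1 := hgc p.1 (τ p.1 p.2 • p.2)
        rw [hgτ] at h1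
        refine le_of_sq_le_sq ?_ (by positivity)
        rw [mul_pow, Real.sq_sqrt (by positivity), inv_mul_eq_div, le_div_iff₀ hc]
        linarith
      rw [ContinuousAt]
      simp only [smul_zero]
      refine squeeze_zero_norm hb ?_
      have : Continuous fun p : Y × E => √(c⁻¹) * ‖p.2‖ := by fun_prop
      simpa using this.tendsto (y, (0 : E))
    -- As g is only continuous, τ is controlled by order: s < τ exactly when g(s a) < ‖a‖², and this
    -- is an open condition on the pair.
    · have hτc : ContinuousAt (fun p : Y × E => τ p.1 p.2) (y, a) := by
        have hc' : ∀ s : ℝ, Continuous fun p : Y × E => g p.1 (s • p.2) - ‖p.2‖ ^ 2 := fun s =>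
          (hg.comp (continuous_fst.prodMk (continuous_snd.const_smul s))).sub
            (continuous_snd.norm.pow 2)
        have hne : ∀ᶠ p : Y × E in 𝓝 (y, a), p.2 ≠ 0 :=
          continuous_snd.continuousAt.eventually_ne ha
        refine tendsto_order.2 ⟨fun s hs => ?_, fun s hs => ?_⟩
        · rcases lt_or_ge s 0 with h0 | h0
          · exact Eventually.of_forall fun p => h0.trans (hτ _ _)
          have h1 := mono y a ha s _ h0 hs
          rw [hgτ] at h1
          simp only at h1
          have h2 : ∀ᶠ p : Y × E in 𝓝 (y, a), g p.1 (s • p.2) - ‖p.2‖ ^ 2 < 0 :=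
            (hc' s).continuousAt.eventually_lt continuousAt_const (sub_neg.2 h1)
          filter_upwards [h2, hne] with p hp hp0
          by_contra! hcon
          rcases hcon.lt_or_eq with h3 | h3
          · have := mono p.1 p.2 hp0 _ _ (hτ p.1 p.2).le h3
            rw [hgτ] at this; linarith
          · rw [← h3, hgτ] at hp; linarith
        · have h1 := mono y a ha _ s (hτ y a).le hs
          rw [hgτ] at h1
          have h2 : ∀ᶠ p : Y × E in 𝓝 (y, a), 0 < g p.1 (s • p.2) - ‖p.2‖ ^ 2 :=
            continuousAt_const.eventually_lt (hc' s).continuousAt (sub_pos.2 h1)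
          filter_upwards [h2, hne] with p hp hp0
          by_contra! hcon
          rcases hcon.lt_or_eq with h3 | h3
          · have := mono p.1 p.2 hp0 s _ ((hτ y a).trans hs).le h3
            rw [hgτ] at this; linarith
          · rw [h3, hgτ] at hp; linarith
      exact hτc.smul continuous_snd.continuousAt
  · refine continuous_fst.prodMk (continuous_iff_continuousAt.2 ?_)
    rintro ⟨y, e⟩
    by_cases he : e = 0
    · subst he
      rw [ContinuousAt]
      simp only [smul_zero]
      refine squeeze_zero_norm (fun p => (norm_fwd p.1 p.2).le) ?_
      have := (hg.sqrt).tendsto (y, (0 : E))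
      simpa [g0] using this
    · exact (hg.sqrt.continuousAt.div continuous_snd.norm.continuousAt (norm_ne_zero_iff.2 he)).smul
        continuous_snd.continuousAt

end Radial

/-! ### Maximisers of strongly concave functions with parameters. -/

section Argmax

variable {Y F : Type*} [TopologicalSpace Y] [NormedAddCommGroup F] [NormedSpace ℝ F]
  [FiniteDimensional ℝ F]

/-- The maximiser of a strongly concave function on a finite-dimensional space depends
continuously on parameters. -/
theorem exists_continuous_argmax (f : Y → F → ℝ) (hf : Continuous fun p : Y × F => f p.1 p.2)
    {a : ℝ} (ha : 0 < a)
    (hconc : ∀ y p q (s : ℝ), 0 ≤ s → s ≤ 1 →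
      s * f y p + (1 - s) * f y q + a * (s * (1 - s)) * ‖p - q‖ ^ 2 ≤ f y (s • p + (1 - s) • q)) :
    ∃ φ : Y → F, Continuous φ ∧ ∀ y v, f y v + a * ‖v - φ y‖ ^ 2 ≤ f y (φ y) := by
  have ex : ∀ y, ∃ v, ∀ w, f y w ≤ f y v := by
    intro y
    have hfy : Continuous (f y) := hf.comp (continuous_const.prodMk continuous_id)
    obtain ⟨M, hM⟩ := (isCompact_closedBall (0 : F) 1).bddAbove_image hfy.continuousOn
    have hM' : ∀ w, ‖w‖ ≤ 1 → f y w ≤ M := fun w hw =>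
      hM ⟨w, by simpa using hw, rfl⟩
    set K := M - f y 0
    have hK : 0 ≤ K := sub_nonneg.2 (hM' 0 (by simp))
    -- The segment from 0 to w meets the unit sphere, where f ≤ M. Strong concavity there gives f w
    -- ≤ f 0 once ‖w‖ > 1 + K/a, so a maximum exists.
    have hlarge : ∀ w, 1 + K / a < ‖w‖ → f y w ≤ f y 0 := by
      intro w hw
      have h1 : 1 < ‖w‖ := lt_of_le_of_lt (by have : 0 ≤ K / a := by positivity
                                              linarith) hw
      have hw0 : 0 < ‖w‖ := by linarith
      set s := ‖w‖⁻¹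
      have hs : s * ‖w‖ = 1 := inv_mul_cancel₀ hw0.ne'
      have hs0 : 0 < s := by positivity
      have hs1 : s ≤ 1 := inv_le_one_of_one_le₀ h1.le
      have h2 := hconc y w 0 s hs0.le hs1
      rw [smul_zero, add_zero, sub_zero] at h2
      have h3 : f y (s • w) ≤ M :=
        hM' _ (by rw [norm_smul, Real.norm_of_nonneg hs0.le, hs])
      have h4 : a * (s * (1 - s)) * ‖w‖ ^ 2 = a * (‖w‖ - 1) := by
        calc _ = a * ((s * ‖w‖) * (‖w‖ - s * ‖w‖)) := by ring
          _ = _ := by rw [hs]; ring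
      rw [h4] at h2
      have h5 : K < a * (‖w‖ - 1) := by
        have : K / a < ‖w‖ - 1 := by linarith
        rwa [div_lt_iff₀ ha, mul_comm] at this
      have h6 : s * (f y w - f y 0) ≤ 0 := by simp only [K] at h5; nlinarith
      by_contra! hcon
      have : 0 < s * (f y w - f y 0) := mul_pos hs0 (by linarith)
      linarith
    refine hfy.exists_forall_ge' (0 : F) ?_
    have := tendsto_norm_cocompact_atTop (E := F) |>.eventually (eventually_gt_atTop (1 + K / a))
    filter_upwards [this] with w hw using hlarge w hw
  choose φ hφ using ex
  have hstrong : ∀ y v, f y v + a * ‖v - φ y‖ ^ 2 ≤ f y (φ y) := by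
    intro y v
    -- The maximum is compared with the value at s v + (1 - s) φ; after division by s, let s tend to
    -- 0.
    have h : ∀ s ∈ Ioo (0 : ℝ) 1, f y v + a * (1 - s) * ‖v - φ y‖ ^ 2 ≤ f y (φ y) := by
      rintro s ⟨hs0, hs1⟩
      have h1 := hconc y v (φ y) s hs0.le hs1.le
      have h2 := hφ y (s • v + (1 - s) • φ y)
      refine le_of_mul_le_mul_left ?_ hs0
      nlinarith
    have hc : Continuous fun s : ℝ => f y v + a * (1 - s) * ‖v - φ y‖ ^ 2 := by fun_prop
    have := le_of_tendsto (hc.continuousWithinAt (s := Ioi 0) (x := 0))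
      (by filter_upwards [Ioo_mem_nhdsGT (zero_lt_one' ℝ)] with s hs using h s hs)
    simpa using this
  refine ⟨φ, continuous_iff_continuousAt.2 fun y => ?_, hstrong⟩
  rw [ContinuousAt, Metric.tendsto_nhds]
  intro ε hε
  -- On this compact sphere f stays below its value at φ y, also for parameters near y. A maximiser
  -- outside the sphere would contradict concavity on the segment joining it to φ y.
  set S := Metric.sphere (φ y) (ε / 2)
  have hS : IsCompact S := isCompact_sphere _ _
  have hev : ∀ᶠ y' in 𝓝 y, ∀ v ∈ S, f y' v < f y' (φ y) := by
    refine hS.eventually_forall_of_forall_eventually fun v hv => ?_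
    have h1 : f y v < f y (φ y) := by
      have := hstrong y v
      have h2 : ‖v - φ y‖ = ε / 2 := by simpa [S, dist_eq_norm] using hv
      rw [h2] at this
      have : 0 < a * (ε / 2) ^ 2 := by positivity
      linarith
    have hc1 : Continuous fun z : Y × F => f z.1 (φ y) :=
      hf.comp (continuous_fst.prodMk continuous_const)
    exact (hf.continuousAt (x := (y, v))).eventually_lt hc1.continuousAt h1
  filter_upwards [hev] with y' hy'
  rw [dist_eq_norm]
  by_contra! hcon
  set d := ‖φ y' - φ y‖
  have hd : 0 < d := by linarith
  set s := ε / 2 / d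
  have hs0 : 0 ≤ s := by positivity
  have hs1 : s ≤ 1 := (div_le_one hd).2 (by linarith)
  have h1 := hconc y' (φ y') (φ y) s hs0 hs1
  have h2 : s • φ y' + (1 - s) • φ y ∈ S := by
    have : s • φ y' + (1 - s) • φ y - φ y = s • (φ y' - φ y) := by module
    rw [mem_sphere_iff_norm, this, norm_smul, Real.norm_of_nonneg hs0]
    exact div_mul_cancel₀ _ hd.ne'
  have h3 := hy' _ h2
  have h4 := hφ y' (φ y)
  have h5 : 0 ≤ a * (s * (1 - s)) * ‖φ y' - φ y‖ ^ 2 := by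
    have : 0 ≤ 1 - s := by linarith
    positivity
  nlinarith

end Argmax

/-! ### A Morse lemma from convexity and concavity. -/

section Morse

variable {Z E F : Type*} [TopologicalSpace Z] [NormedAddCommGroup E] [NormedSpace ℝ E]
  [NormedAddCommGroup F] [NormedSpace ℝ F] [FiniteDimensional ℝ F]

/-- A parametrised Morse lemma for functions that are convex in one variable and strongly concave
in a second, finite-dimensional one. -/
theorem exists_morse_homeomorph (J : Z → E → F → ℝ)
    (hJ : Continuous fun p : Z × E × F => J p.1 p.2.1 p.2.2) {a b : ℝ} (ha : 0 < a) (hb : 0 ≤ b)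
    (hconv : ∀ z u v (s : ℝ), 0 ≤ s → s ≤ 1 → J z (s • u) v ≤ s * J z u v + (1 - s) * J z 0 v)
    (hgrow : ∀ z u, J z 0 0 + a * ‖u‖ ^ 2 ≤ J z u 0)
    (hconc : ∀ z u p q (s : ℝ), 0 ≤ s → s ≤ 1 →
      s * J z u p + (1 - s) * J z u q + a * (s * (1 - s)) * ‖p - q‖ ^ 2 ≤
        J z u (s • p + (1 - s) • q))
    (hmax : ∀ z v, J z 0 v ≤ J z 0 0)
    (hcross : ∀ z u v, J z u v - J z u 0 - J z 0 v + J z 0 0 ≤ b * ‖u‖ * ‖v‖) :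
    ∃ Ψ : Z × E × F ≃ₜ Z × E × F, ∀ z x y, (Ψ (z, x, y)).1 = z ∧
      (∃ s : ℝ, 0 < s ∧ (Ψ (z, x, y)).2.1 = s • x) ∧
      J z (Ψ (z, x, y)).2.1 (Ψ (z, x, y)).2.2 = ‖x‖ ^ 2 - ‖y‖ ^ 2 + J z 0 0 ∧
      a * ‖(Ψ (z, x, y)).2.1‖ ^ 2 ≤ ‖x‖ ^ 2 ∧
      (∃ w, a * ‖(Ψ (z, x, y)).2.2 - w‖ ^ 2 ≤ ‖y‖ ^ 2 ∧
        a * ‖w‖ ≤ b * ‖(Ψ (z, x, y)).2.1‖) := by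
  obtain ⟨φ, hφc, hφ⟩ := exists_continuous_argmax (fun (y : Z × E) v => J y.1 y.2 v)
    (hJ.comp (by fun_prop : Continuous fun p : (Z × E) × F => (p.1.1, p.1.2, p.2))) ha
    (fun y p q s h0 h1 => hconc y.1 y.2 p q s h0 h1)
  have hφ' : ∀ z u v, J z u v + a * ‖v - φ (z, u)‖ ^ 2 ≤ J z u (φ (z, u)) :=
    fun z u v => hφ (z, u) v
  have hle : ∀ z u v, J z u v ≤ J z u (φ (z, u)) := fun z u v =>
    le_trans (le_add_of_nonneg_right (by positivity)) (hφ' z u v)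
  have hφ0 : ∀ z, φ (z, 0) = 0 := by
    intro z
    have h1 := hφ' z 0 0
    have h2 := hmax z (φ (z, 0))
    have h3 : a * ‖0 - φ (z, 0)‖ ^ 2 ≤ 0 := by linarith
    have h4 : ‖0 - φ (z, 0)‖ ^ 2 ≤ 0 := by
      by_contra! hcon
      have := mul_pos ha hcon
      linarith
    have h5 : ‖0 - φ (z, 0)‖ = 0 := by nlinarith [norm_nonneg (0 - φ (z, 0))]
    simpa using h5
  -- The maximum over v is star-convex in u: v is frozen at φ(z, s u), convexity in u is applied,
  -- and the two resulting values are bounded by the maxima at u and at 0.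
  obtain ⟨Θ, hΘ⟩ := exists_radial_homeomorph (fun z u => J z u (φ (z, u)) - J z 0 0)
    ((hJ.comp (by fun_prop : Continuous fun p : Z × E => (p.1, p.2, φ (p.1, p.2)))).sub
      (hJ.comp (by fun_prop : Continuous fun p : Z × E => (p.1, (0 : E), (0 : F)))))
    (fun z => by simp [hφ0]) ha
    (fun z u => by linarith [hgrow z u, hle z u 0])
    (fun z u s h0 h1 => by
      have h2 := hconv z u (φ (z, s • u)) s h0 h1
      have h3 := mul_le_mul_of_nonneg_left (hle z u (φ (z, s • u))) h0
      have h4 := mul_le_mul_of_nonneg_left (hmax z (φ (z, s • u))) (sub_nonneg.2 h1)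
      linarith)
  -- The second rescaling acts on the deficit below the maximum, as a function of w = v - φ(z, u).
  -- It is taken after the first, with (z, u) as parameter; the shear restores v.
  obtain ⟨Ξ, hΞ⟩ := exists_radial_homeomorph
    (fun (y : Z × E) (w : F) => J y.1 y.2 (φ y) - J y.1 y.2 (φ y + w))
    ((hJ.comp (by fun_prop : Continuous fun p : (Z × E) × F => (p.1.1, p.1.2, φ p.1))).sub
      (hJ.comp (by fun_prop : Continuous fun p : (Z × E) × F => (p.1.1, p.1.2, φ p.1 + p.2))))
    (fun y => by simp) ha
    (fun y w => by
      have := hφ' y.1 y.2 (φ y + w)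
      simp only [Prod.mk.eta, add_sub_cancel_left] at this ⊢
      linarith)
    (fun y w s h0 h1 => by
      have h2 := hconc y.1 y.2 (φ y + w) (φ y) s h0 h1
      rw [show s • (φ y + w) + (1 - s) • φ y = φ y + s • w by module] at h2
      have h5 : 0 ≤ a * (s * (1 - s)) * ‖φ y + w - φ y‖ ^ 2 := by
        have : 0 ≤ 1 - s := by linarith
        positivity
      linarith)
  let shear : (Z × E) × F ≃ₜ (Z × E) × F :=
    { toFun := fun p => (p.1, φ p.1 + p.2)
      invFun := fun p => (p.1, p.2 - φ p.1)
      left_inv := fun p => by simp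
      right_inv := fun p => by simp
      continuous_toFun := by fun_prop
      continuous_invFun := by fun_prop }
  refine ⟨(Homeomorph.prodAssoc Z E F).symm.trans ((Θ.prodCongr (Homeomorph.refl F)).trans
    (Ξ.trans (shear.trans (Homeomorph.prodAssoc Z E F)))), fun z x y => ?_⟩
  obtain ⟨h1, ⟨s, hs, h2⟩, h3⟩ := hΘ z x
  have hΘe : Θ (z, x) = (z, (Θ (z, x)).2) := Prod.ext h1 rfl
  obtain ⟨k1, ⟨t, ht, k2⟩, k3⟩ := hΞ (Θ (z, x)) y
  set u := (Θ (z, x)).2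
  set w := (Ξ (Θ (z, x), y)).2
  rw [hΘe] at k1 k3
  have hΞe : Ξ ((z, u), y) = ((z, u), w) := Prod.ext k1 (by simp only [w]; rw [hΘe])
  have hval : ((Homeomorph.prodAssoc Z E F).symm.trans ((Θ.prodCongr (Homeomorph.refl F)).trans
    (Ξ.trans (shear.trans (Homeomorph.prodAssoc Z E F))))) (z, x, y) = (z, u, φ (z, u) + w) := by
    simp only [Homeomorph.trans_apply, shear]
    have : (Θ.prodCongr (Homeomorph.refl F)) ((Homeomorph.prodAssoc Z E F).symm (z, x, y)) =
      ((z, u), y) := Prod.ext hΘe rfl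
    rw [this, hΞe]
    rfl
  rw [hval]
  refine ⟨rfl, ⟨s, hs, h2⟩, ?_, ?_, φ (z, u), ?_, ?_⟩
  · simp only at k3 h3 ⊢
    linarith
  · have := hgrow z u
    have := hle z u 0
    simp only at h3 ⊢
    linarith
  · have := hφ' z u (φ (z, u) + w)
    simp only at k3 ⊢
    linarith
  -- Both optimality gaps, at u and at 0, are at least a‖φ‖², so the mixed difference is at least
  -- 2a‖φ‖²; comparison with b‖u‖‖φ‖ bounds φ linearly in u.
  · have c1 := hφ' z u 0
    have c2 := hconc z 0 (φ (z, u)) 0 (1 / 2) (by norm_num) (by norm_num)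
    have c3 := hmax z ((1 / 2 : ℝ) • φ (z, u) + (1 - 1 / 2 : ℝ) • (0 : F))
    have c4 := hcross z u (φ (z, u))
    have c5 : J z 0 (φ (z, u)) + a * ‖φ (z, u)‖ ^ 2 ≤ J z 0 0 := by
      have := hφ' z 0 (φ (z, u))
      rwa [hφ0, sub_zero] at this
    rw [zero_sub, norm_neg] at c1
    simp only
    rcases (norm_nonneg (φ (z, u))).eq_or_lt with h0 | h0
    · rw [← h0]; simp only [mul_zero]; positivity
    · refine le_of_mul_le_mul_right ?_ h0
      nlinarith [mul_nonneg ha.le (sq_nonneg ‖φ (z, u)‖)]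

end Morse

end SplitInfty

namespace SplitInfty

variable {H : Type*} [NormedAddCommGroup H] [InnerProductSpace ℝ H]

/-! ### Compact perturbations of coercive operators. -/

section Coercive

theorem norm_le_of_coercive {P : H →L[ℝ] H} {c : ℝ} (hP : ∀ u, c * ‖u‖ ^ 2 ≤ ⟪P u, u⟫_ℝ) (u : H) :
    c * ‖u‖ ≤ ‖P u‖ := by
  rcases (norm_nonneg u).eq_or_lt with h | h
  · rw [← h, mul_zero]; positivity
  · have := (hP u).trans (real_inner_le_norm _ _)
    exact le_of_mul_le_mul_right (by linarith [sq ‖u‖]) h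

theorem antilipschitz_of_coercive {P : H →L[ℝ] H} {c : ℝ} (hc : 0 < c)
    (hP : ∀ u, c * ‖u‖ ^ 2 ≤ ⟪P u, u⟫_ℝ) : ∃ K, AntilipschitzWith K P :=
  ⟨c⁻¹.toNNReal, P.antilipschitz_of_bound fun u => by
    rw [Real.coe_toNNReal _ (by positivity), ← div_eq_inv_mul, le_div_iff₀ hc, mul_comm]
    exact norm_le_of_coercive hP u⟩

variable [CompleteSpace H]

/-- A subspace on which the form of a compact perturbation of a coercive operator is nonpositive is
finite-dimensional. -/
theorem finiteDimensional_of_inner_nonpos {P Q : H →L[ℝ] H} {c : ℝ} (hc : 0 < c)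
    (hP : ∀ u, c * ‖u‖ ^ 2 ≤ ⟪P u, u⟫_ℝ) (hQ : IsCompactOperator Q) (K : Submodule ℝ H)
    (hK : ∀ u ∈ K, ⟪(P + Q) u, u⟫_ℝ ≤ 0) : FiniteDimensional ℝ K := by
  set K' := K.topologicalClosure
  have hK' : ∀ u ∈ K', ⟪(P + Q) u, u⟫_ℝ ≤ 0 := by
    intro u hu
    have hcl : IsClosed {u : H | ⟪(P + Q) u, u⟫_ℝ ≤ 0} :=
      isClosed_le (by fun_prop) continuous_const
    exact closure_minimal (s := (K : Set H)) (fun u hu => hK u hu) hcl hu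
  -- Where the form of P + Q is nonpositive, Q must compensate the coercivity of P. Thus Q is
  -- compact and bounded below on K', so the unit ball of K' is compact.
  have hle : ∀ u ∈ K', c * ‖u‖ ≤ ‖Q u‖ := by
    intro u hu
    rcases (norm_nonneg u).eq_or_lt with h | h
    · rw [← h, mul_zero]; positivity
    · have h1 := hK' u hu
      rw [add_apply, inner_add_left] at h1
      have h2 := neg_le_of_abs_le (abs_real_inner_le_norm (Q u) u)
      have h3 := hP u
      exact le_of_mul_le_mul_right (by nlinarith) h
  have : CompleteSpace K' := K.isClosed_topologicalClosure.completeSpace_coe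
  set f : K' →L[ℝ] H := Q.comp K'.subtypeL
  have hf : AntilipschitzWith c⁻¹.toNNReal f := f.antilipschitz_of_bound fun u => by
    rw [Real.coe_toNNReal _ (by positivity), ← div_eq_inv_mul, le_div_iff₀ hc, mul_comm]
    exact hle u u.2
  have hce : IsClosedEmbedding f := hf.isClosedEmbedding f.uniformContinuous
  have hcomp := hQ.isCompact_closure_image_closedBall 1
  have hball : IsCompact (Metric.closedBall (0 : K') 1) := by
    refine (hce.isCompact_preimage hcomp).of_isClosed_subset Metric.isClosed_closedBall ?_
    intro u hu
    exact subset_closure ⟨u, by simpa using hu, rfl⟩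
  have : FiniteDimensional ℝ K' := FiniteDimensional.of_isCompact_closedBall₀ ℝ one_pos hball
  exact Submodule.finiteDimensional_of_le K.le_topologicalClosure

/-- An injective compact perturbation of a coercive operator is bounded below. -/
theorem bounded_below_of_injective {P Q : H →L[ℝ] H} {c : ℝ} (hc : 0 < c)
    (hP : ∀ u, c * ‖u‖ ^ 2 ≤ ⟪P u, u⟫_ℝ) (hQ : IsCompactOperator Q) (K : Submodule ℝ H)
    (hKc : IsClosed (K : Set H)) (hinj : ∀ u ∈ K, (P + Q) u = 0 → u = 0) :
    ∃ ε > 0, ∀ u ∈ K, ε * ‖u‖ ≤ ‖(P + Q) u‖ := by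
  by_contra! hcon
  have h1 : ∀ n : ℕ, ∃ u ∈ K, ‖u‖ = 1 ∧ ‖(P + Q) u‖ ≤ 1 / ((n : ℝ) + 1) := by
    intro n
    obtain ⟨u, hu, h⟩ := hcon (1 / ((n : ℝ) + 1)) (by positivity)
    have hu0 : 0 < ‖u‖ := by
      rcases (norm_nonneg u).eq_or_lt with h0 | h0
      · rw [← h0, mul_zero] at h; exact absurd h (not_lt.2 (norm_nonneg _))
      · exact h0
    refine ⟨‖u‖⁻¹ • u, K.smul_mem _ hu, ?_, ?_⟩
    · rw [norm_smul, norm_inv, norm_norm, inv_mul_cancel₀ hu0.ne']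
    · rw [map_smul, norm_smul, norm_inv, norm_norm, ← div_eq_inv_mul, div_le_iff₀ hu0]
      exact h.le
  choose u huK hu1 hu using h1
  -- Along a subsequence Q u converges, hence so does P u; as P is an embedding with closed range, u
  -- itself converges, to a unit vector annihilated by P + Q.
  obtain ⟨y, -, ψ, hψ, hy⟩ := (hQ.isCompact_closure_image_closedBall 1).tendsto_subseq
    (x := fun n => Q (u n)) (fun n => subset_closure ⟨u n, by simp [hu1], rfl⟩)
  have hPQ : Tendsto (fun n => (P + Q) (u n)) atTop (𝓝 0) :=
    squeeze_zero_norm hu tendsto_one_div_add_atTop_nhds_zero_nat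
  have hPu : Tendsto (fun n => P (u (ψ n))) atTop (𝓝 (0 - y)) := by
    refine ((hPQ.comp hψ.tendsto_atTop).sub hy).congr fun n => ?_
    simp
  obtain ⟨K₀, hK₀⟩ := antilipschitz_of_coercive hc hP
  have hce : IsClosedEmbedding P := hK₀.isClosedEmbedding P.uniformContinuous
  obtain ⟨w, hw⟩ : 0 - y ∈ range P :=
    hce.isClosed_range.mem_of_tendsto hPu (Eventually.of_forall fun n => mem_range_self _)
  rw [← hw] at hPu
  have hlim : Tendsto (fun n => u (ψ n)) atTop (𝓝 w) := hce.tendsto_nhds_iff.2 hPu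
  have hwK : w ∈ K := hKc.mem_of_tendsto hlim (Eventually.of_forall fun n => huK _)
  have hw0 : (P + Q) w = 0 :=
    tendsto_nhds_unique ((P + Q).continuous.continuousAt.tendsto.comp hlim)
      (hPQ.comp hψ.tendsto_atTop)
  have hw1 : ‖w‖ = 1 := tendsto_nhds_unique hlim.norm (by simp [hu1])
  rw [hinj w hwK hw0, norm_zero] at hw1
  exact zero_ne_one hw1

/-- Cauchy-Schwarz for a symmetric operator with nonnegative form on an invariant subspace. -/
theorem norm_sq_le_of_nonneg {T : H →L[ℝ] H} (hT : ∀ u v, ⟪T u, v⟫_ℝ = ⟪u, T v⟫_ℝ)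
    (K : Submodule ℝ H) (hinv : ∀ u ∈ K, T u ∈ K) (hpos : ∀ u ∈ K, 0 ≤ ⟪T u, u⟫_ℝ) {u : H}
    (hu : u ∈ K) : ‖T u‖ ^ 2 ≤ ‖T‖ * ⟪T u, u⟫_ℝ := by
  have h1 : ∀ t : ℝ, 0 ≤ ⟪T u, u⟫_ℝ + 2 * t * ‖T u‖ ^ 2 + t ^ 2 * ⟪T (T u), T u⟫_ℝ := by
    intro t
    have := hpos (u + t • T u) (K.add_mem hu (K.smul_mem t (hinv u hu)))
    rw [map_add, map_smul, inner_add_left, inner_add_right, inner_add_right, inner_smul_left,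
      inner_smul_left, inner_smul_right, inner_smul_right, hT (T u) u,
      real_inner_self_eq_norm_sq] at this
    simp only [conj_trivial] at this
    linarith
  have h2 : ⟪T (T u), T u⟫_ℝ ≤ ‖T‖ * ‖T u‖ ^ 2 := by
    refine (real_inner_le_norm _ _).trans ?_
    rw [sq, ← mul_assoc]
    exact mul_le_mul_of_nonneg_right (T.le_opNorm _) (norm_nonneg _)
  rcases (norm_nonneg T).eq_or_lt with h0 | h0
  · have : T = 0 := norm_eq_zero.1 h0.symm
    simp [this]
  -- At t = -1/‖T‖ the quadratic term cancels at most half of the linear one.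
  · have h3 := h1 (-(1 / ‖T‖))
    have h4 : (1 / ‖T‖) ^ 2 * ⟪T (T u), T u⟫_ℝ ≤ 1 / ‖T‖ * ‖T u‖ ^ 2 := by
      calc _ ≤ (1 / ‖T‖) ^ 2 * (‖T‖ * ‖T u‖ ^ 2) := by gcongr
        _ = _ := by field_simp
    have h5 : 1 / ‖T‖ * ‖T u‖ ^ 2 ≤ ⟪T u, u⟫_ℝ := by
      have : (-(1 / ‖T‖)) ^ 2 = (1 / ‖T‖) ^ 2 := by ring
      rw [this] at h3
      nlinarith
    rw [one_div, ← div_eq_inv_mul, div_le_iff₀ h0] at h5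
    linarith

/-- On a closed invariant subspace without eigenvectors to nonpositive eigenvalues, a symmetric
compact perturbation of a coercive operator is coercive. -/
theorem coercive_of_no_eigenvector {P Q : H →L[ℝ] H} {c : ℝ} (hc : 0 < c)
    (hP : ∀ u, c * ‖u‖ ^ 2 ≤ ⟪P u, u⟫_ℝ) (hQ : IsCompactOperator Q)
    (hsymm : ∀ u v, ⟪(P + Q) u, v⟫_ℝ = ⟪u, (P + Q) v⟫_ℝ) (K : Submodule ℝ H)
    (hKc : IsClosed (K : Set H)) (hinv : ∀ u ∈ K, (P + Q) u ∈ K)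
    (heig : ∀ μ : ℝ, μ ≤ 0 → ∀ u ∈ K, (P + Q) u = μ • u → u = 0) :
    ∃ a > 0, ∀ u ∈ K, a * ‖u‖ ^ 2 ≤ ⟪(P + Q) u, u⟫_ℝ := by
  set B := P + Q
  set S : Set ℝ := {a | ∀ u ∈ K, a * ‖u‖ ^ 2 ≤ ⟪B u, u⟫_ℝ}
  have hS0 : -‖B‖ ∈ S := by
    intro u _
    have h1 := neg_le_of_abs_le (abs_real_inner_le_norm (B u) u)
    have h2 := mul_le_mul_of_nonneg_right (B.le_opNorm u) (norm_nonneg u)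
    nlinarith
  by_cases hbot : ∀ u ∈ K, u = 0
  · exact ⟨1, one_pos, fun u hu => by simp [hbot u hu]⟩
  push Not at hbot
  obtain ⟨e, he, he0⟩ := hbot
  have hSb : BddAbove S := ⟨⟪B e, e⟫_ℝ / ‖e‖ ^ 2, fun a ha => by
    rw [le_div_iff₀ (by have := norm_pos_iff.2 he0; positivity)]
    exact ha e he⟩
  set μ := sSup S
  have hμS : μ ∈ S := by
    intro u hu
    rcases (norm_nonneg u).eq_or_lt with h0 | h0
    · rw [norm_eq_zero.1 h0.symm]; simp
    · rw [← le_div_iff₀ (by positivity)]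
      refine csSup_le ⟨_, hS0⟩ fun a ha => ?_
      rw [le_div_iff₀ (by positivity)]
      exact ha u hu
  rcases lt_or_ge 0 μ with hμ | hμ
  · exact ⟨μ, hμ, hμS⟩
  exfalso
  -- Here μ is the bottom of the form on K, assumed nonpositive. Then T = B - μ is still coercive
  -- plus compact, and injective on K, so it is bounded below by some ε; Cauchy-Schwarz raises the
  -- bottom by ε²/‖T‖, a contradiction.
  set T : H →L[ℝ] H := (P - μ • ContinuousLinearMap.id ℝ H) + Q
  have hTB : ∀ u, T u = B u - μ • u := fun u => by
    simp only [T, B, add_apply, sub_apply,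
      smul_apply, ContinuousLinearMap.id_apply]
    abel
  have hTi : ∀ u, ⟪T u, u⟫_ℝ = ⟪B u, u⟫_ℝ - μ * ‖u‖ ^ 2 := fun u => by
    rw [hTB, inner_sub_left, inner_smul_left, real_inner_self_eq_norm_sq]; rfl
  obtain ⟨ε, hε, hεT⟩ := bounded_below_of_injective (P := P - μ • ContinuousLinearMap.id ℝ H) hc
    (fun u => by
      have : ⟪(P - μ • ContinuousLinearMap.id ℝ H) u, u⟫_ℝ = ⟪P u, u⟫_ℝ - μ * ‖u‖ ^ 2 := by
        simp [inner_sub_left, inner_smul_left]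
      rw [this]
      have := mul_nonneg (neg_nonneg.2 hμ) (sq_nonneg ‖u‖)
      linarith [hP u]) hQ K hKc
    (fun u hu h => heig μ hμ u hu (by
      have := hTB u
      rw [show T u = 0 from h] at this
      exact (sub_eq_zero.1 this.symm)))
  have hTpos : ∀ u ∈ K, 0 ≤ ⟪T u, u⟫_ℝ := fun u hu => by rw [hTi]; linarith [hμS u hu]
  have hTinv : ∀ u ∈ K, T u ∈ K := fun u hu => by
    rw [hTB]; exact K.sub_mem (hinv u hu) (K.smul_mem _ hu)
  have hTs : ∀ u v, ⟪T u, v⟫_ℝ = ⟪u, T v⟫_ℝ := fun u v => by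
    rw [hTB, hTB, inner_sub_left, inner_sub_right, inner_smul_left, inner_smul_right, hsymm]; rfl
  have hT0 : 0 < ‖T‖ := by
    have h1 := (hεT e he).trans (T.le_opNorm e)
    have := norm_pos_iff.2 he0
    exact lt_of_lt_of_le hε (le_of_mul_le_mul_right h1 this)
  have hmem : μ + ε ^ 2 / ‖T‖ ∈ S := by
    intro u hu
    have h1 := norm_sq_le_of_nonneg hTs K hTinv hTpos hu
    have h2 : (ε * ‖u‖) ^ 2 ≤ ‖T u‖ ^ 2 := pow_le_pow_left₀ (by positivity) (hεT u hu) 2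
    have h3 : ε ^ 2 / ‖T‖ * ‖u‖ ^ 2 ≤ ⟪T u, u⟫_ℝ := by
      rw [div_mul_eq_mul_div, div_le_iff₀ hT0]
      nlinarith
    rw [hTi] at h3
    linarith
  have := le_csSup hSb hmem
  have : 0 < ε ^ 2 / ‖T‖ := by positivity
  linarith

end Coercive

/-! ### Orthogonality and spectral gap for H⁰, H⁺ and H⁻. -/

section Decomposition

variable [CompleteSpace H] {Binf : H →L[ℝ] H}

theorem inner_map_comm (hB : IsSelfAdjoint Binf) (u v : H) : ⟪Binf u, v⟫_ℝ = ⟪u, Binf v⟫_ℝ :=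
  (ContinuousLinearMap.isSelfAdjoint_iff_isSymmetric.1 hB) u v

theorem mem_H0 {u : H} : u ∈ H0 Binf ↔ Binf u = 0 := LinearMap.mem_ker

/-- The form of `B(∞)` on a finite sum of eigenvectors. -/
theorem inner_eigen_sum (hB : IsSelfAdjoint Binf) {u : H}
    (hu : u ∈ ⨆ μ : {μ : ℝ // μ ≤ 0}, Module.End.eigenspace (Binf : H →ₗ[ℝ] H) μ.1) :
    ⟪Binf u, u⟫_ℝ ≤ 0 ∧ (⟪Binf u, u⟫_ℝ = 0 → Binf u = 0) := by
  obtain ⟨f, hf, rfl⟩ := (Submodule.mem_iSup_iff_exists_finsupp _ u).1 hu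
  have hBf : ∀ i, Binf (f i) = i.1 • f i := fun i => Module.End.mem_eigenspace_iff.1 (hf i)
  have horth : ∀ i j, i ≠ j → ⟪f i, f j⟫_ℝ = 0 := by
    intro i j hij
    have h1 := inner_map_comm hB (f i) (f j)
    rw [hBf, hBf, inner_smul_left, inner_smul_right, conj_trivial] at h1
    have h2 : (i.1 - j.1) * ⟪f i, f j⟫_ℝ = 0 := by linarith
    exact (mul_eq_zero.1 h2).resolve_left (sub_ne_zero.2 fun h => hij (Subtype.ext h))
  have hsum : Binf (f.sum fun _ x => x) = ∑ i ∈ f.support, i.1 • f i := by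
    rw [Finsupp.sum, map_sum]
    exact Finset.sum_congr rfl fun i _ => hBf i
  have hval : ⟪Binf (f.sum fun _ x => x), f.sum fun _ x => x⟫_ℝ =
      ∑ i ∈ f.support, i.1 * ‖f i‖ ^ 2 := by
    rw [hsum, Finsupp.sum, sum_inner]
    refine Finset.sum_congr rfl fun i hi => ?_
    rw [inner_sum, Finset.sum_eq_single i, inner_smul_left, real_inner_self_eq_norm_sq]
    · rfl
    · intro j _ hj
      rw [inner_smul_left, horth i j hj.symm, mul_zero]
    · exact fun h => absurd hi h
  have hterm : ∀ i ∈ f.support, i.1 * ‖f i‖ ^ 2 ≤ 0 := fun i _ =>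
    mul_nonpos_of_nonpos_of_nonneg i.2 (sq_nonneg _)
  refine ⟨hval ▸ Finset.sum_nonpos hterm, fun h0 => ?_⟩
  rw [hval, Finset.sum_eq_zero_iff_of_nonpos hterm] at h0
  rw [hsum]
  refine Finset.sum_eq_zero fun i hi => ?_
  rcases mul_eq_zero.1 (h0 i hi) with h | h
  · rw [h, zero_smul]
  · rw [norm_eq_zero.1 (pow_eq_zero_iff (two_ne_zero) |>.1 h), smul_zero]

theorem H0_sup_Hminus_le :
    H0 Binf ⊔ Hminus Binf ≤
      ⨆ μ : {μ : ℝ // μ ≤ 0}, Module.End.eigenspace (Binf : H →ₗ[ℝ] H) μ.1 := by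
  refine sup_le ?_ (iSup_le fun μ => ?_)
  · refine le_trans (fun u hu => ?_)
      (le_iSup (fun μ : {μ : ℝ // μ ≤ 0} => Module.End.eigenspace (Binf : H →ₗ[ℝ] H) μ.1) ⟨0, le_rfl⟩)
    rw [Module.End.mem_eigenspace_iff, zero_smul]
    exact mem_H0.1 hu
  · exact le_iSup (fun μ : {μ : ℝ // μ ≤ 0} => Module.End.eigenspace (Binf : H →ₗ[ℝ] H) μ.1)
      ⟨μ.1, μ.2.le⟩

theorem inner_H0_Hminus (hB : IsSelfAdjoint Binf) {z v : H} (hz : z ∈ H0 Binf)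
    (hv : v ∈ Hminus Binf) : ⟪z, v⟫_ℝ = 0 := by
  have : Hminus Binf ≤ Hpm Binf := by
    refine iSup_le fun μ w hw => (Submodule.mem_orthogonal _ _).2 fun x hx => ?_
    have h1 := inner_map_comm hB x w
    have h2 : Binf w = μ.1 • w := Module.End.mem_eigenspace_iff.1 hw
    rw [mem_H0.1 hx, inner_zero_left, h2, inner_smul_right] at h1
    exact (mul_eq_zero.1 h1.symm).resolve_left μ.2.ne
  exact (Submodule.mem_orthogonal _ _).1 (this hv) z hz

theorem Hminus_le_Hpm (hB : IsSelfAdjoint Binf) : Hminus Binf ≤ Hpm Binf :=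
  fun _ hv => (Submodule.mem_orthogonal _ _).2 fun _ hz => inner_H0_Hminus hB hz hv

theorem Hplus_le_Hpm : Hplus Binf ≤ Hpm Binf := Submodule.orthogonal_le le_sup_left

theorem inner_H0_Hplus {z u : H} (hz : z ∈ H0 Binf) (hu : u ∈ Hplus Binf) : ⟪z, u⟫_ℝ = 0 :=
  (Submodule.mem_orthogonal _ _).1 hu z (Submodule.mem_sup_left hz)

theorem inner_Hminus_Hplus {v u : H} (hv : v ∈ Hminus Binf) (hu : u ∈ Hplus Binf) :
    ⟪v, u⟫_ℝ = 0 :=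
  (Submodule.mem_orthogonal _ _).1 hu v (Submodule.mem_sup_right hv)

theorem map_mem_Hminus {v : H} (hv : v ∈ Hminus Binf) : Binf v ∈ Hminus Binf := by
  have : Hminus Binf ≤ (Hminus Binf).comap (Binf : H →ₗ[ℝ] H) := by
    refine iSup_le fun μ w hw => ?_
    have h2 : Binf w = μ.1 • w := Module.End.mem_eigenspace_iff.1 hw
    change Binf w ∈ Hminus Binf
    rw [h2]
    exact Submodule.smul_mem _ _ ((le_iSup (fun μ : {μ : ℝ // μ < 0} =>
      Module.End.eigenspace (Binf : H →ₗ[ℝ] H) μ.1) μ) hw)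
  exact this hv

theorem map_mem_Hpm (hB : IsSelfAdjoint Binf) (u : H) : Binf u ∈ Hpm Binf :=
  (Submodule.mem_orthogonal _ _).2 fun z hz => by
    rw [← inner_map_comm hB, mem_H0.1 hz, inner_zero_left]

theorem map_mem_Hplus (hB : IsSelfAdjoint Binf) {u : H} (hu : u ∈ Hplus Binf) :
    Binf u ∈ Hplus Binf := by
  refine (Submodule.mem_orthogonal _ _).2 fun w hw => ?_
  rw [← inner_map_comm hB]
  obtain ⟨z, hz, v, hv, rfl⟩ := Submodule.mem_sup.1 hw
  rw [map_add, mem_H0.1 hz, zero_add]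
  exact inner_Hminus_Hplus (map_mem_Hminus hv) hu

/-- The spectral information on `B(∞)` used below. -/
theorem spectral_gap {P Q : H →L[ℝ] H} {c : ℝ} (hc : 0 < c)
    (hP : ∀ u, c * ‖u‖ ^ 2 ≤ ⟪P u, u⟫_ℝ) (hQ : IsCompactOperator Q) (hBPQ : Binf = P + Q)
    (hB : IsSelfAdjoint Binf) :
    FiniteDimensional ℝ (H0 Binf) ∧ FiniteDimensional ℝ (Hminus Binf) ∧
      ∃ a > 0, (∀ u ∈ Hplus Binf, a * ‖u‖ ^ 2 ≤ ⟪Binf u, u⟫_ℝ) ∧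
        ∀ v ∈ Hminus Binf, ⟪Binf v, v⟫_ℝ ≤ -(a * ‖v‖ ^ 2) := by
  have hfin : FiniteDimensional ℝ (H0 Binf ⊔ Hminus Binf : Submodule ℝ H) :=
    finiteDimensional_of_inner_nonpos hc hP hQ _ fun u hu =>
      hBPQ ▸ (inner_eigen_sum hB (H0_sup_Hminus_le hu)).1
  have hfm : FiniteDimensional ℝ (Hminus Binf) := Submodule.finiteDimensional_of_le (le_sup_right (a := H0 Binf))
  refine ⟨Submodule.finiteDimensional_of_le (le_sup_left (b := Hminus Binf)), hfm, ?_⟩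
  obtain ⟨a, ha, hplus⟩ := coercive_of_no_eigenvector hc hP hQ
    (by rw [← hBPQ]; exact inner_map_comm hB) (Hplus Binf)
    (Submodule.isClosed_orthogonal _) (by rw [← hBPQ]; exact fun u hu => map_mem_Hplus hB hu)
    (by
      rw [← hBPQ]
      intro μ hμ u hu h
      have hself : ⟪u, u⟫_ℝ = 0 := by
        rcases hμ.lt_or_eq with h1 | h1
        · refine inner_Hminus_Hplus ?_ hu
          exact (le_iSup (fun μ : {μ : ℝ // μ < 0} =>
            Module.End.eigenspace (Binf : H →ₗ[ℝ] H) μ.1) ⟨μ, h1⟩)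
              (Module.End.mem_eigenspace_iff.2 h)
        · rw [h1, zero_smul] at h
          exact inner_H0_Hplus (mem_H0.2 h) hu
      exact inner_self_eq_zero.1 hself)
  rw [← hBPQ] at hplus
  -- On sums of eigenvectors to nonpositive eigenvalues the form vanishes only on the kernel, which
  -- is orthogonal to H⁻. Strict negativity becomes uniform by compactness of the unit sphere of H⁻.
  have hneg : ∀ v ∈ Hminus Binf, v ≠ 0 → ⟪Binf v, v⟫_ℝ < 0 := by
    intro v hv hv0
    have h1 := inner_eigen_sum hB (H0_sup_Hminus_le (Submodule.mem_sup_right hv))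
    refine lt_of_le_of_ne h1.1 fun h => hv0 ?_
    exact inner_self_eq_zero.1 (inner_H0_Hminus hB (mem_H0.2 (h1.2 h)) hv)
  obtain ⟨a', ha', hminus⟩ : ∃ a' > 0, ∀ v ∈ Hminus Binf, ⟪Binf v, v⟫_ℝ ≤ -(a' * ‖v‖ ^ 2) := by
    by_cases hbot : ∀ v ∈ Hminus Binf, v = 0
    · exact ⟨1, one_pos, fun v hv => by simp [hbot v hv]⟩
    push Not at hbot
    obtain ⟨e, he, he0⟩ := hbot
    have : Nontrivial (Hminus Binf) := ⟨⟨e, he⟩, 0, fun h => he0 (congrArg Subtype.val h)⟩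
    obtain ⟨v₀, hv₀, hmax⟩ := (isCompact_sphere (0 : Hminus Binf) 1).exists_isMaxOn
      (NormedSpace.sphere_nonempty.2 zero_le_one)
      (f := fun v : Hminus Binf => ⟪Binf (v : H), (v : H)⟫_ℝ) (by fun_prop)
    have hv₀n : ‖v₀‖ = 1 := by simpa using hv₀
    refine ⟨-⟪Binf (v₀ : H), (v₀ : H)⟫_ℝ, ?_, fun v hv => ?_⟩
    · have := hneg v₀ v₀.2 (fun h => by
        rw [show v₀ = 0 from Subtype.ext h, norm_zero] at hv₀n; exact zero_ne_one hv₀n)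
      linarith
    · rcases (norm_nonneg v).eq_or_lt with h0 | h0
      · rw [norm_eq_zero.1 h0.symm]; simp
      · have h1 := hmax (a := (‖v‖⁻¹ • ⟨v, hv⟩ : Hminus Binf)) (by
          rw [mem_sphere_zero_iff_norm, norm_smul, norm_inv, norm_norm]
          exact inv_mul_cancel₀ h0.ne')
        simp only [mem_ofPred_eq, Submodule.coe_smul, map_smul, inner_smul_left, inner_smul_right,
          conj_trivial] at h1
        have h2 : ⟪Binf v, v⟫_ℝ ≤ ⟪Binf (v₀ : H), (v₀ : H)⟫_ℝ * ‖v‖ ^ 2 := by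
          rw [← mul_assoc, ← mul_inv, inv_mul_le_iff₀ (by positivity)] at h1
          linarith [sq ‖v‖]
        linarith
  refine ⟨min a a', lt_min ha ha', fun u hu => ?_, fun v hv => ?_⟩
  · exact (mul_le_mul_of_nonneg_right (min_le_left _ _) (sq_nonneg _)).trans (hplus u hu)
  · have := mul_le_mul_of_nonneg_right (min_le_right a a') (sq_nonneg ‖v‖)
    linarith [hminus v hv]

end Decomposition

end SplitInfty

namespace SplitInfty

variable {H X : Type*} [NormedAddCommGroup H] [InnerProductSpace ℝ H] [CompleteSpace H]
  [NormedAddCommGroup X] [NormedSpace ℝ X]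

/-! ### Weak limits along ultrafilters. -/

section WeakLimits

variable {α : Type*} (𝓤 : Ultrafilter α)

/-- Bounded families in a Hilbert space converge weakly along ultrafilters. -/
theorem exists_weak_limit (u : α → H) (hu : ∀ x, ‖u x‖ ≤ 1) :
    ∃ w : H, ∀ v, Tendsto (fun x => ⟪u x, v⟫_ℝ) 𝓤 (𝓝 ⟪w, v⟫_ℝ) := by
  let g : α → WeakDual ℝ H := fun x => StrongDual.toWeakDual (InnerProductSpace.toDual ℝ H (u x))
  have hcomp := WeakDual.isCompact_closedBall (𝕜 := ℝ) (E := H) 0 1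
  obtain ⟨f, -, hf⟩ := hcomp.ultrafilter_le_nhds (𝓤.map g) (by
    rw [le_principal_iff, Ultrafilter.coe_map, mem_map]
    refine univ_mem' fun x => ?_
    have : ‖InnerProductSpace.toDual ℝ H (u x)‖ ≤ 1 := by
      rw [LinearIsometryEquiv.norm_map]; exact hu x
    exact mem_closedBall_zero_iff.2 this)
  have hf' : Tendsto g 𝓤 (𝓝 f) := hf
  refine ⟨(InnerProductSpace.toDual ℝ H).symm (WeakDual.toStrongDual f), fun v => ?_⟩
  have h1 := ((WeakDual.eval_continuous v).tendsto f).comp hf'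
  rw [InnerProductSpace.toDual_symm_apply]
  exact h1

/-- The images remain in a compact set and so converge along the ultrafilter; pairing with v and
moving Q to its adjoint identifies the limit. -/
theorem tendsto_compact_of_weak {Q : H →L[ℝ] H} (hQ : IsCompactOperator Q) {u : α → H}
    (hu : ∀ x, ‖u x‖ ≤ 1) {w : H} (hw : ∀ v, Tendsto (fun x => ⟪u x, v⟫_ℝ) 𝓤 (𝓝 ⟪w, v⟫_ℝ)) :
    Tendsto (fun x => Q (u x)) 𝓤 (𝓝 (Q w)) := by
  obtain ⟨y, -, hy⟩ := (hQ.isCompact_closure_image_closedBall 1).ultrafilter_le_nhds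
    (𝓤.map fun x => Q (u x)) (by
      rw [le_principal_iff, Ultrafilter.coe_map, mem_map]
      exact univ_mem' fun x => subset_closure ⟨u x, by simpa using hu x, rfl⟩)
  have hy' : Tendsto (fun x => Q (u x)) 𝓤 (𝓝 y) := hy
  have : y = Q w := by
    refine ext_inner_right ℝ fun v => ?_
    have h1 : Tendsto (fun x => ⟪Q (u x), v⟫_ℝ) 𝓤 (𝓝 ⟪y, v⟫_ℝ) := hy'.inner tendsto_const_nhds
    have h2 := hw (ContinuousLinearMap.adjoint Q v)
    simp only [ContinuousLinearMap.adjoint_inner_right] at h2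
    exact tendsto_nhds_unique h1 h2
  rwa [← this]

end WeakLimits

section Inclusion

variable {ι : X →L[ℝ] H} {Binf : H →L[ℝ] H}

theorem lift_apply (hι : Function.Injective ι) (x : X) : lift ι (ι x) = x :=
  Function.leftInverse_invFun hι x

theorem apply_lift {u : H} (hu : u ∈ range ι) : ι (lift ι u) = u := Function.invFun_eq hu

theorem lift_eq (hι : Function.Injective ι) {u : H} {x : X} (h : ι x = u) : lift ι u = x := by
  rw [← h, lift_apply hι]

/-- The inverse of the inclusion is continuous on finite-dimensional subspaces. -/
theorem exists_lift_clm (hι : Function.Injective ι) (K : Submodule ℝ H) [FiniteDimensional ℝ K]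
    (hK : ∀ u ∈ K, u ∈ range ι) : ∃ e : K →L[ℝ] X, ∀ k : K, e k = lift ι (k : H) ∧ ι (e k) = k := by
  let f : K →ₗ[ℝ] X :=
    { toFun := fun k => lift ι (k : H)
      map_add' := fun x y => lift_eq hι (by
        rw [map_add, apply_lift (hK x x.2), apply_lift (hK y y.2)]; rfl)
      map_smul' := fun c x => lift_eq hι (by
        rw [map_smul, apply_lift (hK x x.2)]; rfl) }
  exact ⟨LinearMap.toContinuousLinearMap f, fun k => ⟨rfl, apply_lift (hK k k.2)⟩⟩

theorem H0_subset_range (hC2 : CondC2 ι Binf) {u : H} (hu : u ∈ H0 Binf) : u ∈ range ι :=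
  hC2 u ⟨0, by rw [map_zero, mem_H0.1 hu]⟩

theorem Hminus_subset_range
    (h : ∀ μ : ℝ, μ < 0 → ∀ u : H, Binf u = μ • u → u ∈ range ι) {u : H} (hu : u ∈ Hminus Binf) :
    u ∈ range ι := by
  have : Hminus Binf ≤ LinearMap.range (ι : X →ₗ[ℝ] H) :=
    iSup_le fun μ w hw => h μ.1 μ.2 w (Module.End.mem_eigenspace_iff.1 hw)
  exact this hu

end Inclusion

/-! ### Uniform bounds near infinity -/

/-- The properties of `B(x)` for large `x`, and of its limit, that the proof rests on. -/
structure SaddleAtInfty (ι : X →L[ℝ] H) (V : Set H) (B : X → H →L[ℝ] H) (Binf : H →L[ℝ] H)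
    (a R₀ : ℝ) : Prop where
  a_pos : 0 < a
  R_pos : 0 < R₀
  mem : ∀ u : H, R₀ < ‖u‖ → u ∈ V
  finite_zero : FiniteDimensional ℝ (H0 Binf)
  finite_minus : FiniteDimensional ℝ (Hminus Binf)
  zero_range : ∀ u ∈ H0 Binf, u ∈ range ι
  minus_range : ∀ u ∈ Hminus Binf, u ∈ range ι
  inf_plus : ∀ u ∈ Hplus Binf, a * ‖u‖ ^ 2 ≤ ⟪Binf u, u⟫_ℝ
  inf_minus : ∀ v ∈ Hminus Binf, ⟪Binf v, v⟫_ℝ ≤ -(a * ‖v‖ ^ 2)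
  plus : ∀ x, R₀ < ‖ι x‖ → ∀ u ∈ Hplus Binf, a * ‖u‖ ^ 2 ≤ ⟪B x u, u⟫_ℝ
  minus : ∀ x, R₀ < ‖ι x‖ → ∀ v ∈ Hminus Binf, ⟪B x v, v⟫_ℝ ≤ -(a * ‖v‖ ^ 2)
  cross : ∀ x, R₀ < ‖ι x‖ → ∀ u ∈ Hplus Binf, ∀ v ∈ Hminus Binf, |⟪B x u, v⟫_ℝ| ≤ ‖u‖ * ‖v‖
  small : ∀ ε > 0, ∃ R, ∀ x, R < ‖ι x‖ → ∀ z ∈ H0 Binf, ‖B x z‖ ≤ ε * ‖z‖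

section Infinity

variable {ι : X →L[ℝ] H} {V : Set H} {B : X → H →L[ℝ] H} {Binf : H →L[ℝ] H}

/-- The filter of the points of `V ∩ X` whose norm in `H` tends to infinity. -/
def atInfty (ι : X →L[ℝ] H) (V : Set H) : Filter X :=
  comap (fun x => ‖ι x‖) atTop ⊓ 𝓟 (ι ⁻¹' V)

instance : (atInfty ι V).IsCountablyGenerated := by
  unfold atInfty; infer_instance

theorem eventually_atInfty {p : X → Prop} (hV : IsOpenNhdInfty V) :
    (∀ᶠ x in atInfty ι V, p x) ↔ ∃ R, ∀ x, R < ‖ι x‖ → p x := by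
  obtain ⟨-, R₀, hR₀⟩ := hV
  rw [atInfty, eventually_inf_principal,
    ((atTop_basis_Ioi' R₀).comap fun x : X => ‖ι x‖).eventually_iff]
  constructor
  · rintro ⟨R, hR, h⟩
    exact ⟨R, fun x hx => h hx (hR₀ _ (hR.trans hx))⟩
  · rintro ⟨R, h⟩
    exact ⟨max R R₀ + 1, (le_max_right _ _).trans_lt (lt_add_one _), fun x hx _ =>
      h x (((le_max_left _ _).trans_lt (lt_add_one _)).trans hx)⟩

/-- Statements about sequences in `V ∩ X` tending to infinity pass to the filter. -/
theorem exists_seq_of_frequently (p : ℕ → X → Prop)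
    (h : ∀ n, ∃ᶠ x in atInfty ι V, p n x) : ∃ x : ℕ → X, (∀ k, x k ∈ ι ⁻¹' V) ∧
      Tendsto (fun k => ‖ι (x k)‖) atTop atTop ∧ ∀ n, p n (x n) := by
  have h1 : ∀ n : ℕ, ∃ x ∈ ι ⁻¹' V, (n : ℝ) < ‖ι x‖ ∧ p n x := by
    intro n
    have h2 : ∀ᶠ x in atInfty ι V, x ∈ ι ⁻¹' V ∧ (n : ℝ) < ‖ι x‖ :=
      (eventually_inf_principal.2 (Eventually.of_forall fun _ h => h)).and
        ((tendsto_comap.eventually (eventually_gt_atTop (n : ℝ))).filter_mono inf_le_left)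
    obtain ⟨x, hx, hx1, hx2⟩ := ((h n).and_eventually h2).exists
    exact ⟨x, hx1, hx2, hx⟩
  choose x hx1 hx2 hx3 using h1
  exact ⟨x, hx1, tendsto_atTop_mono (fun n => (hx2 n).le) tendsto_natCast_atTop_atTop, hx3⟩

/-- A nonzero vector of H⁰ lies in X by (C2), and its multiples run to infinity. Inequalities for
P(x) can therefore be passed to the limit P(∞). -/
theorem atInfty_neBot (hV : IsOpenNhdInfty V) (hν : H0 Binf ≠ ⊥) (hC2 : CondC2 ι Binf) :
    (atInfty ι V).NeBot := by
  obtain ⟨e, he, he0⟩ := Submodule.exists_mem_ne_zero_of_ne_bot hν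
  obtain ⟨x, hx⟩ := H0_subset_range hC2 he
  rw [neBot_iff]
  intro hbot
  have hf : ∀ᶠ x in atInfty ι V, False := by rw [hbot]; exact eventually_bot
  obtain ⟨R, hR⟩ := (eventually_atInfty hV).1 hf
  have hpos : 0 < ‖ι x‖ := by rw [hx]; exact norm_pos_iff.2 he0
  refine hR (((|R| + 1) / ‖ι x‖) • x) ?_
  rw [map_smul, norm_smul, Real.norm_of_nonneg (by positivity), div_mul_cancel₀ _ hpos.ne']
  linarith [le_abs_self R]

/-- Suppose unit vectors u with small form exist arbitrarily far out, and let w be their weak limit.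
Coercivity of P(x) applied to u - w gives C₀(1 - ‖w‖²) in the limit, the compact part of u - w tends
to 0, and the remaining terms tend to ⟪B(∞)w, w⟫ ≥ a‖w‖². The total is at least min a C₀, twice the
assumed upper bound. -/
theorem eventually_coercive {P Q : X → H →L[ℝ] H} {Qinf : H →L[ℝ] H} {C₀ a : ℝ} (hC₀ : 0 < C₀) (ha : 0 < a)
    (hBs : ∀ x ∈ ι ⁻¹' V, IsSelfAdjoint (B x))
    (hBPQ : ∀ x ∈ ι ⁻¹' V, B x = P x + Q x)
    (hP : ∀ᶠ x in atInfty ι V, ∀ u, C₀ * ‖u‖ ^ 2 ≤ ⟪P x u, u⟫_ℝ)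
    (hQ : Tendsto Q (atInfty ι V) (𝓝 Qinf)) (hQinf : IsCompactOperator Qinf)
    (hB : ∀ u, Tendsto (fun x => B x u) (atInfty ι V) (𝓝 (Binf u)))
    (hplus : ∀ u ∈ Hplus Binf, a * ‖u‖ ^ 2 ≤ ⟪Binf u, u⟫_ℝ) :
    ∀ᶠ x in atInfty ι V, ∀ u ∈ Hplus Binf, min a C₀ / 2 * ‖u‖ ^ 2 ≤ ⟪B x u, u⟫_ℝ := by
  have hm : 0 < min a C₀ := lt_min ha hC₀
  set bad : Set X := {x | ∃ u ∈ Hplus Binf, ‖u‖ = 1 ∧ ⟪B x u, u⟫_ℝ ≤ min a C₀ / 2}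
  suffices hgood : ∀ᶠ x in atInfty ι V, x ∉ bad by
    filter_upwards [hgood] with x hx u hu
    by_contra! hcon
    have hu0 : 0 < ‖u‖ := by
      rcases (norm_nonneg u).eq_or_lt with h0 | h0
      · rw [norm_eq_zero.1 h0.symm] at hcon; simp at hcon
      · exact h0
    refine hx ⟨‖u‖⁻¹ • u, Submodule.smul_mem _ _ hu, ?_, ?_⟩
    · rw [norm_smul, norm_inv, norm_norm, inv_mul_cancel₀ hu0.ne']
    · rw [map_smul, inner_smul_left, inner_smul_right, conj_trivial, ← mul_assoc, ← mul_inv,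
        inv_mul_le_iff₀ (by positivity)]
      linarith [sq ‖u‖]
  by_contra hcon
  rw [not_eventually] at hcon
  simp only [not_not] at hcon
  have hne := frequently_mem_iff_neBot.1 hcon
  set 𝓤 := Ultrafilter.of (atInfty ι V ⊓ 𝓟 bad)
  have h𝓤 : (𝓤 : Filter X) ≤ atInfty ι V := (Ultrafilter.of_le _).trans inf_le_left
  have h𝓤V : ∀ᶠ x in (𝓤 : Filter X), x ∈ ι ⁻¹' V :=
    (eventually_inf_principal.2 (Eventually.of_forall fun _ h => h)).filter_mono h𝓤
  have h𝓤b : ∀ᶠ x in (𝓤 : Filter X), x ∈ bad :=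
    (Ultrafilter.of_le _).trans inf_le_right (mem_principal_self bad)
  -- Outside the bad set the vector 0 serves as a default, so the family is bounded everywhere and
  -- has a weak limit.
  have hsel : ∀ x, ∃ u : H, u ∈ Hplus Binf ∧ ‖u‖ ≤ 1 ∧
      (x ∈ bad → ‖u‖ = 1 ∧ ⟪B x u, u⟫_ℝ ≤ min a C₀ / 2) := by
    intro x
    by_cases hx : x ∈ bad
    · obtain ⟨u, hu, hu1, hu2⟩ := hx
      exact ⟨u, hu, hu1.le, fun _ => ⟨hu1, hu2⟩⟩
    · exact ⟨0, Submodule.zero_mem _, by simp, fun h => absurd h hx⟩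
  choose u hu hu1 hub using hsel
  obtain ⟨w, hw⟩ := exists_weak_limit 𝓤 u hu1
  have hwK : w ∈ Hplus Binf := (Submodule.mem_orthogonal _ _).2 fun v hv => by
    rw [real_inner_comm]
    refine tendsto_nhds_unique (hw v) (tendsto_const_nhds.congr fun x => ?_)
    rw [real_inner_comm]
    exact ((Submodule.mem_orthogonal _ _).1 (hu x) v hv).symm
  have hQu := tendsto_compact_of_weak 𝓤 hQinf hu1 hw
  have hd : Tendsto (fun x => ‖u x - w‖ ^ 2) 𝓤 (𝓝 (1 - ‖w‖ ^ 2)) := by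
    have h1 : Tendsto (fun x => 1 - 2 * ⟪u x, w⟫_ℝ + ‖w‖ ^ 2) 𝓤 (𝓝 (1 - 2 * ⟪w, w⟫_ℝ + ‖w‖ ^ 2)) :=
      ((tendsto_const_nhds.sub ((hw w).const_mul 2)).add tendsto_const_nhds)
    rw [real_inner_self_eq_norm_sq] at h1
    rw [show 1 - ‖w‖ ^ 2 = 1 - 2 * ‖w‖ ^ 2 + ‖w‖ ^ 2 by ring]
    refine h1.congr' ?_
    filter_upwards [h𝓤b] with x hx
    rw [norm_sub_sq_real, (hub x hx).1]; ring
  have hdb : ∀ x, ‖u x - w‖ ≤ 1 + ‖w‖ := fun x =>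
    (norm_sub_le _ _).trans (by linarith [hu1 x])
  -- Q(x) is replaced by Q(∞) in operator norm, and compactness of Q(∞) turns the weak convergence
  -- of u into norm convergence.
  have hQd : Tendsto (fun x => ⟪Q x (u x - w), u x - w⟫_ℝ) 𝓤 (𝓝 0) := by
    have h1 : Tendsto (fun x => ‖Q x - Qinf‖ * (1 + ‖w‖) + ‖Qinf (u x) - Qinf w‖) 𝓤
        (𝓝 (0 * (1 + ‖w‖) + 0)) :=
      ((tendsto_iff_norm_sub_tendsto_zero.1 (hQ.mono_left h𝓤)).mul_const _).add
        (tendsto_iff_norm_sub_tendsto_zero.1 hQu)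
    have h2 := h1.mul_const (1 + ‖w‖)
    simp only [zero_mul, add_zero] at h2
    refine squeeze_zero_norm (fun x => ?_) h2
    refine (abs_real_inner_le_norm _ _).trans ?_
    refine mul_le_mul ?_ (hdb x) (norm_nonneg _) (by positivity)
    have h3 : Q x (u x - w) = (Q x - Qinf) (u x - w) + (Qinf (u x) - Qinf w) := by
      simp only [sub_apply, map_sub]; abel
    rw [h3]
    refine (norm_add_le _ _).trans (add_le_add ?_ le_rfl)
    exact ((Q x - Qinf).le_opNorm _).trans (mul_le_mul_of_nonneg_left (hdb x) (norm_nonneg _))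
  have hBw : Tendsto (fun x => B x w) 𝓤 (𝓝 (Binf w)) := (hB w).mono_left h𝓤
  have hBwu : Tendsto (fun x => ⟪B x w, u x⟫_ℝ) 𝓤 (𝓝 ⟪Binf w, w⟫_ℝ) := by
    have h1 : Tendsto (fun x => ⟪B x w - Binf w, u x⟫_ℝ) 𝓤 (𝓝 0) := by
      refine squeeze_zero_norm (fun x => ?_) (tendsto_iff_norm_sub_tendsto_zero.1 hBw)
      refine (abs_real_inner_le_norm _ _).trans ?_
      exact mul_le_of_le_one_right (norm_nonneg _) (hu1 x)
    have h2 := h1.add (hw (Binf w))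
    rw [zero_add, real_inner_comm] at h2
    refine h2.congr fun x => ?_
    rw [inner_sub_left, real_inner_comm (Binf w) (u x)]; ring
  have hlow : Tendsto (fun x => C₀ * ‖u x - w‖ ^ 2 + ⟪Q x (u x - w), u x - w⟫_ℝ +
      2 * ⟪B x w, u x⟫_ℝ - ⟪B x w, w⟫_ℝ) 𝓤
      (𝓝 (C₀ * (1 - ‖w‖ ^ 2) + 0 + 2 * ⟪Binf w, w⟫_ℝ - ⟪Binf w, w⟫_ℝ)) :=
    (((hd.const_mul C₀).add hQd).add (hBwu.const_mul 2)).sub (hBw.inner tendsto_const_nhds)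
  have hfin := le_of_tendsto hlow (b := min a C₀ / 2) (by
    filter_upwards [h𝓤b, h𝓤V, hP.filter_mono h𝓤] with x hx hxV hPx
    have h1 := (hub x hx).2
    have hs := inner_map_comm (hBs x hxV) (u x) w
    have h2 : ⟪B x (u x), u x⟫_ℝ = ⟪B x (u x - w), u x - w⟫_ℝ + 2 * ⟪B x w, u x⟫_ℝ -
        ⟪B x w, w⟫_ℝ := by
      simp only [map_sub, inner_sub_left, inner_sub_right]
      rw [hs, real_inner_comm (B x w) (u x)]; ring
    have h3 : ⟪B x (u x - w), u x - w⟫_ℝ =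
        ⟪P x (u x - w), u x - w⟫_ℝ + ⟪Q x (u x - w), u x - w⟫_ℝ := by
      rw [hBPQ x hxV, add_apply, inner_add_left]
    linarith [hPx (u x - w)])
  have hw1 : 0 ≤ 1 - ‖w‖ ^ 2 := ge_of_tendsto hd (Eventually.of_forall fun x => sq_nonneg _)
  have h4 := hplus w hwK
  have h5 := mul_le_mul_of_nonneg_right (min_le_left a C₀) (sq_nonneg ‖w‖)
  have h6 := mul_le_mul_of_nonneg_right (min_le_right a C₀) hw1
  nlinarith

/-- Pointwise convergence of operators is uniform on finite-dimensional subspaces. -/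
theorem eventually_norm_le_of_finiteDimensional {α : Type*} {l : Filter α} {T : α → H →L[ℝ] H}
    {T₀ : H →L[ℝ] H} (hT : ∀ u, Tendsto (fun x => T x u) l (𝓝 (T₀ u))) (K : Submodule ℝ H)
    [FiniteDimensional ℝ K] {ε : ℝ} (hε : 0 < ε) :
    ∀ᶠ x in l, ∀ u ∈ K, ‖T x u - T₀ u‖ ≤ ε * ‖u‖ := by
  let b := Module.finBasis ℝ K
  obtain ⟨C, hC, hbC⟩ := b.exists_opNorm_le (F := H)
  have h1 : ∀ᶠ x in l, ∀ i, ‖T x (b i) - T₀ (b i)‖ ≤ ε / C := by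
    refine eventually_all.2 fun i => ?_
    filter_upwards [(tendsto_iff_norm_sub_tendsto_zero.1 (hT (b i))).eventually
      (gt_mem_nhds (div_pos hε hC))] with x hx using hx.le
  filter_upwards [h1] with x hx u hu
  have h2 := hbC (u := (T x - T₀).comp K.subtypeL) (div_pos hε hC).le (fun i => hx i)
  rw [mul_div_cancel₀ _ hC.ne'] at h2
  exact ((T x - T₀).comp K.subtypeL).le_of_opNorm_le h2 ⟨u, hu⟩

/-- Only H⁺ needs the weak-limit argument. On the finite-dimensional H⁻ and H⁰ the convergence B(x)
→ B(∞) is uniform, and B(∞) preserves H⁻, which is orthogonal to H⁺, and annihilates H⁰. -/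
theorem exists_saddleAtInfty {A : X → X} (hV : IsOpenNhdInfty V)
    (hF3 : CondF3 ι V A B Binf) (hC2 : CondC2 ι Binf) (hD : CondD ι V B Binf) (hν : H0 Binf ≠ ⊥) :
    ∃ a R₀, SaddleAtInfty ι V B Binf a R₀ := by
  obtain ⟨P, Q, Pinf, Qinf, hBx, ⟨hBinf, -, hQinf⟩, hneg, hPlim, hQlim, hPcoer⟩ := hD
  obtain ⟨hBs, hBinfs, -, -⟩ := hF3
  have := atInfty_neBot hV hν hC2
  obtain ⟨Rv, hRv⟩ := hV.2
  have hQt : Tendsto Q (atInfty ι V) (𝓝 Qinf) := by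
    rw [tendsto_iff_norm_sub_tendsto_zero, Metric.tendsto_nhds]
    intro ε hε
    obtain ⟨R, hR⟩ := hQlim ε hε
    refine (eventually_atInfty hV).2 ⟨max R Rv, fun x hx => ?_⟩
    rw [Real.dist_0_eq_abs, abs_norm]
    exact hR x (hRv _ ((le_max_right _ _).trans_lt hx)) ((le_max_left _ _).trans_lt hx)
  have hPt : ∀ u, Tendsto (fun x => P x u) (atInfty ι V) (𝓝 (Pinf u)) := by
    intro u
    rw [Metric.tendsto_nhds]
    intro ε hε
    by_contra hcon
    obtain ⟨x, hxV, hx, hxp⟩ := exists_seq_of_frequently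
      (fun _ x => ¬ dist (P x u) (Pinf u) < ε) (fun _ => not_eventually.1 hcon)
    obtain ⟨n, hn⟩ := ((Metric.tendsto_nhds.1 (hPlim x hxV hx u)) ε hε).exists
    exact hxp n hn
  obtain ⟨C₀, hC₀, hPc⟩ : ∃ C₀ > 0, ∀ᶠ x in atInfty ι V, ∀ u, C₀ * ‖u‖ ^ 2 ≤ ⟪P x u, u⟫_ℝ := by
    -- The hypothesis concerns sequences with a constant depending on the sequence. If no constant
    -- served the whole filter, points violating 1/(n + 1) would form a sequence contradicting it.
    by_contra! hcon
    obtain ⟨x, hxV, hx, hxp⟩ := exists_seq_of_frequently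
      (fun n x => ¬ ∀ u, 1 / ((n : ℝ) + 1) * ‖u‖ ^ 2 ≤ ⟪P x u, u⟫_ℝ) (fun n => by
        simpa only [not_forall, not_le] using hcon (1 / ((n : ℝ) + 1)) (by positivity))
    obtain ⟨C₀, hC₀, n₀, hn₀⟩ := hPcoer x hxV hx
    obtain ⟨n₁, hn₁⟩ := exists_nat_one_div_lt hC₀
    refine hxp (max n₀ n₁) fun u => le_trans ?_ (hn₀ _ (le_max_left _ _) u)
    refine mul_le_mul_of_nonneg_right (le_trans ?_ hn₁.le) (sq_nonneg _)
    gcongr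
    exact le_max_right _ _
  have hPinf : ∀ u, C₀ * ‖u‖ ^ 2 ≤ ⟪Pinf u, u⟫_ℝ := fun u =>
    ge_of_tendsto ((hPt u).inner tendsto_const_nhds) (hPc.mono fun x hx => hx u)
  have hVev : ∀ᶠ x in atInfty ι V, x ∈ ι ⁻¹' V :=
    eventually_inf_principal.2 (Eventually.of_forall fun _ h => h)
  have hBt : ∀ u, Tendsto (fun x => B x u) (atInfty ι V) (𝓝 (Binf u)) := by
    intro u
    have h1 : Tendsto (fun x => P x u + Q x u) (atInfty ι V) (𝓝 (Pinf u + Qinf u)) :=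
      (hPt u).add (((ContinuousLinearMap.apply ℝ H u).continuous.tendsto Qinf).comp hQt)
    rw [hBinf]
    refine h1.congr' (hVev.mono fun x hx => ?_)
    simp only [(hBx x hx).1, add_apply]
  obtain ⟨hf0, hfm, a, ha, hplus, hminus⟩ := spectral_gap hC₀ hPinf hQinf hBinf hBinfs
  have hfin : FiniteDimensional ℝ (H0 Binf ⊔ Hminus Binf : Submodule ℝ H) := inferInstance
  have e1 := eventually_coercive hC₀ ha hBs (fun x hx => (hBx x hx).1) hPc hQt hQinf hBt
    hplus
  -- The bound 1 gives the estimate of the mixed form; the bound a/2 leaves half of the negativity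
  -- on H⁻.
  have e2 := eventually_norm_le_of_finiteDimensional hBt (Hminus Binf)
    (lt_min one_pos (half_pos ha))
  set a' := min (min a C₀ / 2) (a / 2)
  have hmin : 0 < min a C₀ := lt_min ha hC₀
  have ha' : 0 < a' := lt_min (by positivity) (by positivity)
  have ha'a : a' ≤ a := (min_le_right _ _).trans (by linarith)
  obtain ⟨R, hR⟩ := (eventually_atInfty hV).1 (e1.and (e2.and hVev))
  refine ⟨a', max 1 (max R Rv), ha', by positivity, fun u hu => hRv u ?_, hf0, hfm,
    fun u hu => H0_subset_range hC2 hu, fun u hu => Hminus_subset_range hneg hu,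
    fun u hu => (mul_le_mul_of_nonneg_right ha'a (sq_nonneg _)).trans (hplus u hu),
    fun v hv => ?_, fun x hx u hu => ?_, fun x hx v hv => ?_, fun x hx u hu v hv => ?_,
    fun ε hε => ?_⟩
  · exact ((le_max_right _ _).trans (le_max_right _ _)).trans_lt hu
  · have := mul_le_mul_of_nonneg_right ha'a (sq_nonneg ‖v‖)
    linarith [hminus v hv]
  · have h := (hR x (((le_max_left _ _).trans (le_max_right _ _)).trans_lt hx)).1 u hu
    exact (mul_le_mul_of_nonneg_right (min_le_left _ _) (sq_nonneg _)).trans h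
  · have h := (hR x (((le_max_left _ _).trans (le_max_right _ _)).trans_lt hx)).2.1 v hv
    have h1 := (le_abs_self _).trans (abs_real_inner_le_norm (B x v - Binf v) v)
    rw [inner_sub_left] at h1
    have h2 : ‖B x v - Binf v‖ * ‖v‖ ≤ a / 2 * ‖v‖ * ‖v‖ :=
      mul_le_mul_of_nonneg_right
        (h.trans (mul_le_mul_of_nonneg_right (min_le_right _ _) (norm_nonneg _))) (norm_nonneg _)
    have h3 := mul_le_mul_of_nonneg_right (min_le_right (min a C₀ / 2) (a / 2)) (sq_nonneg ‖v‖)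
    have h4 := hminus v hv
    change _ ≤ -(a' * ‖v‖ ^ 2)
    nlinarith
  · have hh := hR x (((le_max_left _ _).trans (le_max_right _ _)).trans_lt hx)
    have h := hh.2.1 v hv
    rw [inner_map_comm (hBs x hh.2.2)]
    have h0 : ⟪u, Binf v⟫_ℝ = 0 := by
      rw [real_inner_comm]; exact inner_Hminus_Hplus (map_mem_Hminus hv) hu
    have h1 : ⟪u, B x v⟫_ℝ = ⟪u, B x v - Binf v⟫_ℝ := by rw [inner_sub_right, h0, sub_zero]
    rw [h1]
    refine (abs_real_inner_le_norm _ _).trans (mul_le_mul_of_nonneg_left ?_ (norm_nonneg _))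
    refine h.trans ?_
    exact mul_le_of_le_one_left (norm_nonneg _) (min_le_left _ _)
  · obtain ⟨R', hR'⟩ := (eventually_atInfty hV).1
      (eventually_norm_le_of_finiteDimensional hBt (H0 Binf) hε)
    refine ⟨R', fun x hx z hz => ?_⟩
    have := hR' x hx z hz
    rwa [mem_H0.1 hz, sub_zero] at this

end Infinity

end SplitInfty

namespace SplitInfty

/-! ### From directional to Fréchet derivatives. -/

section LineDerivatives

variable {E F : Type*} [NormedAddCommGroup E] [NormedSpace ℝ E] [NormedAddCommGroup F]
  [NormedSpace ℝ F]

theorem hasDerivAt_line_of_hasLineDerivAt {f : E → F} {f' : F} {x u : E} {t : ℝ}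
    (h : HasLineDerivAt ℝ f f' (x + t • u) u) : HasDerivAt (fun s : ℝ => f (x + s • u)) f' t := by
  have h1 : HasDerivAt (fun s : ℝ => f (x + t • u + s • u)) f' (t - t) := by
    rw [sub_self]; exact h
  refine (h1.comp_sub_const t t).congr_of_eventuallyEq (Eventually.of_forall fun s => ?_)
  simp only
  congr 1
  module

/-- A function whose directional derivatives come from a continuous family of operators is
Fréchet differentiable. -/
theorem hasFDerivAt_of_hasLineDerivAt {f : E → F} {f' : E → E →L[ℝ] F} {U : Set E} (hU : IsOpen U)
    (hf : ∀ x ∈ U, ∀ u, HasLineDerivAt ℝ f (f' x u) x u) (hc : ContinuousOn f' U) {x : E}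
    (hx : x ∈ U) : HasFDerivAt f (f' x) x := by
  rw [hasFDerivAt_iff_isLittleO, Asymptotics.isLittleO_iff]
  intro ε hε
  have h1 : ∀ᶠ y in 𝓝 x, y ∈ U ∧ ‖f' y - f' x‖ ≤ ε := by
    refine (hU.eventually_mem hx).and ?_
    have := (tendsto_iff_norm_sub_tendsto_zero.1 (hc.continuousAt (hU.mem_nhds hx))).eventually
      (gt_mem_nhds hε)
    exact this.mono fun y hy => hy.le
  obtain ⟨δ, hδ, hball⟩ := Metric.eventually_nhds_iff_ball.1 h1
  filter_upwards [Metric.ball_mem_nhds x hδ] with y hy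
  have hseg : ∀ t ∈ Icc (0 : ℝ) 1, x + t • (y - x) ∈ Metric.ball x δ := by
    intro t ht
    rw [mem_ball_iff_norm, add_sub_cancel_left, norm_smul, Real.norm_of_nonneg ht.1]
    refine lt_of_le_of_lt (mul_le_of_le_one_left (norm_nonneg _) ht.2) ?_
    rwa [mem_ball_iff_norm] at hy
  have hd : ∀ t ∈ Icc (0 : ℝ) 1, HasDerivWithinAt
      (fun s : ℝ => f (x + s • (y - x)) - s • f' x (y - x))
      (f' (x + t • (y - x)) (y - x) - f' x (y - x)) (Icc 0 1) t := by
    intro t ht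
    have h2 := hasDerivAt_line_of_hasLineDerivAt (hf _ (hball _ (hseg t ht)).1 (y - x))
    have h3 := (hasDerivAt_id t).smul_const (f' x (y - x))
    rw [one_smul] at h3
    exact (h2.sub h3).hasDerivWithinAt
  have h4 := norm_image_sub_le_of_norm_deriv_le_segment_01' (C := ε * ‖y - x‖) hd (fun t ht => by
    have h5 := (hball _ (hseg t (Ico_subset_Icc_self ht))).2
    rw [← sub_apply]
    exact ((f' (x + t • (y - x)) - f' x).le_opNorm _).trans
      (mul_le_mul_of_nonneg_right h5 (norm_nonneg _)))
  simp only [one_smul, zero_smul, add_zero, sub_zero, add_sub_cancel] at h4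
  rwa [sub_right_comm] at h4

theorem contDiffOn_one_of_hasFDerivAt {f : E → F} {f' : E → E →L[ℝ] F} {U : Set E}
    (hU : IsOpen U) (hf : ∀ x ∈ U, HasFDerivAt f (f' x) x) (hc : ContinuousOn f' U) :
    ContDiffOn ℝ 1 f U := by
  rw [show (1 : WithTop ℕ∞) = 0 + 1 by simp, contDiffOn_succ_iff_fderiv_of_isOpen hU]
  refine ⟨fun x hx => (hf x hx).differentiableAt.differentiableWithinAt, by simp, ?_⟩
  rw [contDiffOn_zero]
  exact hc.congr fun x hx => (hf x hx).fderiv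

end LineDerivatives

/-! ### Implicit functions by contraction. -/

section Implicit

variable {Z W : Type*} [NormedAddCommGroup Z] [NormedSpace ℝ Z] [NormedAddCommGroup W]
  [NormedSpace ℝ W]

/-- The perturbation term satisfies C g ≤ d/κ and is absorbed on the left. This is the origin of the
factor κ/(κ - 1). -/
theorem norm_le_of_perturbation {C κ d f g : ℝ} (hκ : 1 < κ) (h1 : d ≤ C * (f + g))
    (h2 : κ * C * g ≤ d) : d ≤ κ / (κ - 1) * C * f := by
  have hk : 0 < κ - 1 := by linarith
  rw [show κ / (κ - 1) * C * f = κ * C * f / (κ - 1) by ring, le_div_iff₀ hk]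
  nlinarith

/-- Perturbed linear equations `F z x = 0`: two points are as close as their images. -/
theorem norm_sub_le_of_contraction {F : W → W} (hF : Continuous F) {BL : W ≃L[ℝ] W} {C κ : ℝ}
    {ρ : ℝ≥0∞} (hρ : 0 < ρ) (hC0 : 0 ≤ C) (hC : ∀ x, ‖x‖ ≤ C * ‖BL x‖) (hκ : 1 < κ)
    (hL : ∀ x₁ x₂, ‖x₁‖ₑ < ρ → ‖x₂‖ₑ < ρ →
      κ * C * ‖(F x₁ - BL x₁) - (F x₂ - BL x₂)‖ ≤ ‖x₁ - x₂‖) {x₁ x₂ : W} (h₁ : ‖x₁‖ₑ ≤ ρ)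
    (h₂ : ‖x₂‖ₑ ≤ ρ) : ‖x₁ - x₂‖ ≤ κ / (κ - 1) * C * ‖F x₁ - F x₂‖ := by
  have strict : ∀ x₁ x₂, ‖x₁‖ₑ < ρ → ‖x₂‖ₑ < ρ →
      ‖x₁ - x₂‖ ≤ κ / (κ - 1) * C * ‖F x₁ - F x₂‖ := by
    intro x₁ x₂ h₁ h₂
    refine norm_le_of_perturbation hκ ((hC _).trans (mul_le_mul_of_nonneg_left ?_ hC0))
      (hL x₁ x₂ h₁ h₂)
    have : BL (x₁ - x₂) = (F x₁ - F x₂) - ((F x₁ - BL x₁) - (F x₂ - BL x₂)) := by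
      rw [map_sub]; abel
    rw [this]
    exact norm_sub_le _ _
  -- The Lipschitz bound is available only on the open ball; points of norm ρ are reached by scaling
  -- with t < 1 and letting t tend to 1.
  have hs : ∀ t ∈ Ioo (0 : ℝ) 1, ∀ x : W, ‖x‖ₑ ≤ ρ → ‖t • x‖ₑ < ρ := by
    intro t ht x hx
    rcases eq_or_ne x 0 with rfl | hx0
    · simpa using hρ
    · refine lt_of_lt_of_le ?_ hx
      rw [← ofReal_norm, ← ofReal_norm, ENNReal.ofReal_lt_ofReal_iff (norm_pos_iff.2 hx0), norm_smul, Real.norm_of_nonneg ht.1.le]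
      exact mul_lt_of_lt_one_left (norm_pos_iff.2 hx0) ht.2
  have hc1 : Continuous fun t : ℝ => ‖t • x₁ - t • x₂‖ := by fun_prop
  have hc2 : Continuous fun t : ℝ => κ / (κ - 1) * C * ‖F (t • x₁) - F (t • x₂)‖ := by fun_prop
  have := le_of_tendsto_of_tendsto (hc1.continuousWithinAt (s := Iio 1) (x := 1))
    (hc2.continuousWithinAt (s := Iio 1) (x := 1)) (by
      filter_upwards [Ioo_mem_nhdsLT (zero_lt_one' ℝ)] with t ht
      exact strict _ _ (hs t ht _ h₁) (hs t ht _ h₂))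
  simpa using this

variable [CompleteSpace W]

/-- Zeros of F are the fixed points of S x = BL⁻¹(BL x - F x), which contracts with ratio 1/κ. The
radius r = κ/(κ - 1) C‖F 0‖ solves r/κ + C‖F 0‖ = r, so the closed ball of radius r is invariant,
and it lies inside the ball of radius ρ. -/
theorem exists_zero_of_contraction {F : W → W} {BL : W ≃L[ℝ] W} {C κ : ℝ}
    {ρ : ℝ≥0∞} (hC0 : 0 ≤ C) (hC : ∀ x, ‖x‖ ≤ C * ‖BL x‖) (hκ : 1 < κ)
    (hL : ∀ x₁ x₂, ‖x₁‖ₑ < ρ → ‖x₂‖ₑ < ρ →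
      κ * C * ‖(F x₁ - BL x₁) - (F x₂ - BL x₂)‖ ≤ ‖x₁ - x₂‖)
    (hρ : ENNReal.ofReal (κ / (κ - 1) * C * ‖F 0‖) < ρ) :
    ∃ x, F x = 0 ∧ ‖x‖ ≤ κ / (κ - 1) * C * ‖F 0‖ := by
  set r := κ / (κ - 1) * C * ‖F 0‖
  have hk : 0 < κ - 1 := by linarith
  have hκ0 : 0 < κ := by linarith
  have hr : 0 ≤ r := by positivity
  have hball : ∀ x : W, ‖x‖ ≤ r → ‖x‖ₑ < ρ := fun x hx =>
    lt_of_le_of_lt (by rw [← ofReal_norm]; exact ENNReal.ofReal_le_ofReal hx) hρ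
  have hsymm : ∀ y, ‖BL.symm y‖ ≤ C * ‖y‖ := fun y => by simpa using hC (BL.symm y)
  set S : W → W := fun x => BL.symm (BL x - F x)
  have hS : ∀ x y, ‖x‖ ≤ r → ‖y‖ ≤ r → ‖S x - S y‖ ≤ κ⁻¹ * ‖x - y‖ := by
    intro x y hx hy
    have h1 : S x - S y = BL.symm (-((F x - BL x) - (F y - BL y))) := by
      simp only [S, ← map_sub]; congr 1; abel
    rw [h1, inv_mul_eq_div, le_div_iff₀ hκ0]
    have h2 := hsymm (-((F x - BL x) - (F y - BL y)))
    rw [norm_neg] at h2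
    have h3 := hL x y (hball x hx) (hball y hy)
    have h4 := mul_le_mul_of_nonneg_right h2 hκ0.le
    linarith
  have hmaps : MapsTo S (Metric.closedBall 0 r) (Metric.closedBall 0 r) := by
    intro x hx
    rw [mem_closedBall_zero_iff] at hx ⊢
    have h1 := hS x 0 hx (by simpa using hr)
    rw [sub_zero] at h1
    have h2 : ‖S 0‖ ≤ C * ‖F 0‖ := by
      have := hsymm (BL 0 - F 0)
      simpa [S] using this
    have h3 : κ⁻¹ * r + C * ‖F 0‖ = r := by
      simp only [r]; field_simp; ring
    have h4 : κ⁻¹ * ‖x‖ ≤ κ⁻¹ * r := by gcongr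
    calc ‖S x‖ = ‖(S x - S 0) + S 0‖ := by rw [sub_add_cancel]
      _ ≤ ‖S x - S 0‖ + ‖S 0‖ := norm_add_le _ _
      _ ≤ r := by linarith
  have hcon : ContractingWith κ⁻¹.toNNReal (hmaps.restrict S _ _) := by
    refine ⟨Real.toNNReal_lt_one.2 (inv_lt_one_of_one_lt₀ hκ), LipschitzWith.of_dist_le_mul ?_⟩
    rintro ⟨x, hx⟩ ⟨y, hy⟩
    rw [mem_closedBall_zero_iff] at hx hy
    rw [Real.coe_toNNReal _ (by positivity), Subtype.dist_eq, Subtype.dist_eq, dist_eq_norm,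
      dist_eq_norm]
    exact hS x y hx hy
  obtain ⟨x, hx, hfix, -⟩ := hcon.exists_fixedPoint' Metric.isClosed_closedBall.isComplete hmaps
    (x := 0) (by simpa using hr) (edist_ne_top _ _)
  refine ⟨x, ?_, by simpa using hx⟩
  have h1 : BL (S x) = BL x := by rw [hfix]
  simp only [S, ContinuousLinearEquiv.apply_symm_apply] at h1
  simpa using h1

/-- A contraction version of the implicit function theorem, on a given domain of parameters. -/
theorem exists_implicit {U : Set Z} {F : Z → W → W} {BL : W ≃L[ℝ] W} {C κ : ℝ}
    {ρ : ℝ≥0∞} (hC0 : 0 ≤ C) (hC : ∀ x, ‖x‖ ≤ C * ‖BL x‖) (hκ : 1 < κ)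
    (hF : ContinuousOn (fun p : Z × W => F p.1 p.2) (U ×ˢ univ))
    (hL : ∀ z ∈ U, ∀ x₁ x₂, ‖x₁‖ₑ < ρ → ‖x₂‖ₑ < ρ →
      κ * C * ‖(F z x₁ - BL x₁) - (F z x₂ - BL x₂)‖ ≤ ‖x₁ - x₂‖)
    (hρ : ∀ z ∈ U, ENNReal.ofReal (κ / (κ - 1) * C * ‖F z 0‖) < ρ) :
    ∃ h : Z → W, ContinuousOn h U ∧ ∀ z ∈ U, F z (h z) = 0 ∧ ‖h z‖ₑ < ρ ∧
      ‖h z‖ ≤ κ / (κ - 1) * C * ‖F z 0‖ ∧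
      ∀ x, ‖x‖ₑ ≤ ρ → ‖x - h z‖ ≤ κ / (κ - 1) * C * ‖F z x‖ := by
  have hFz : ∀ z ∈ U, Continuous (F z) := fun z hz => by
    rw [← continuousOn_univ]
    exact hF.comp (continuous_const.prodMk continuous_id).continuousOn fun x _ => ⟨hz, mem_univ _⟩
  have ex : ∀ z, ∃ x, z ∈ U → F z x = 0 ∧ ‖x‖ ≤ κ / (κ - 1) * C * ‖F z 0‖ := by
    intro z
    by_cases hz : z ∈ U
    · obtain ⟨x, hx⟩ := exists_zero_of_contraction hC0 hC hκ (hL z hz) (hρ z hz)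
      exact ⟨x, fun _ => hx⟩
    · exact ⟨0, fun h => absurd h hz⟩
  choose h hh using ex
  have hlt : ∀ z ∈ U, ‖h z‖ₑ < ρ := fun z hz =>
    lt_of_le_of_lt (by rw [← ofReal_norm]; exact ENNReal.ofReal_le_ofReal (hh z hz).2) (hρ z hz)
  have hest : ∀ z ∈ U, ∀ x, ‖x‖ₑ ≤ ρ → ‖x - h z‖ ≤ κ / (κ - 1) * C * ‖F z x‖ := by
    intro z hz x hx
    have := norm_sub_le_of_contraction (hFz z hz) (bot_le.trans_lt (hlt z hz)) hC0 hC hκ (hL z hz)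
      hx (hlt z hz).le
    rwa [(hh z hz).1, sub_zero] at this
  refine ⟨h, fun z hz => ?_, fun z hz => ⟨(hh z hz).1, hlt z hz, (hh z hz).2, hest z hz⟩⟩
  rw [ContinuousWithinAt, tendsto_iff_norm_sub_tendsto_zero]
  -- The residual of the fixed point h z in the equation at z' tends to 0, and it bounds the
  -- distance from h z to h z'.
  have h1 : Tendsto (fun z' => κ / (κ - 1) * C * ‖F z' (h z)‖) (𝓝[U] z) (𝓝 0) := by
    have h2 : ContinuousOn (fun z' => F z' (h z)) U :=
      hF.comp (continuous_id.prodMk continuous_const).continuousOn fun x hx => ⟨hx, mem_univ _⟩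
    have h3 := ((h2 z hz).norm).const_mul (κ / (κ - 1) * C)
    simpa [ContinuousWithinAt, (hh z hz).1] using h3
  refine squeeze_zero' (Eventually.of_forall fun _ => norm_nonneg _) ?_ h1
  filter_upwards [self_mem_nhdsWithin] with z' hz'
  rw [norm_sub_rev]
  exact hest z' hz' _ (hlt z hz).le

/-- As x is interior to the ball, the Lipschitz bound for F - BL holds for the difference quotients
and passes to the directional derivative. -/
theorem norm_derivative_sub_le {F : W → W} {BL : W ≃L[ℝ] W} {C κ : ℝ}
    {ρ : ℝ≥0∞} (hC0 : 0 ≤ C) (hκ : 1 < κ)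
    (hL : ∀ x₁ x₂, ‖x₁‖ₑ < ρ → ‖x₂‖ₑ < ρ →
      κ * C * ‖(F x₁ - BL x₁) - (F x₂ - BL x₂)‖ ≤ ‖x₁ - x₂‖) {x ξ y : W} (hx : ‖x‖ₑ < ρ)
    (hd : HasDerivAt (fun t : ℝ => F (x + t • ξ)) y 0) : κ * C * ‖y - BL ξ‖ ≤ ‖ξ‖ := by
  have h1 : HasDerivAt (fun t : ℝ => BL (x + t • ξ)) (BL ξ) 0 := by
    have h2 : HasDerivAt (fun t : ℝ => x + t • ξ) ξ 0 := by
      simpa using ((hasDerivAt_id (0 : ℝ)).smul_const ξ).const_add x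
    exact BL.toContinuousLinearMap.hasFDerivAt.comp_hasDerivAt (0 : ℝ) h2
  have h3 := ((hd.sub h1).const_smul (κ * C)).le_of_lip' (norm_nonneg ξ) (by
    have hc : Continuous fun t : ℝ => x + t • ξ := by fun_prop
    have hopen : IsOpen {w : W | ‖w‖ₑ < ρ} := isOpen_lt continuous_enorm continuous_const
    filter_upwards [hc.continuousAt.preimage_mem_nhds (hopen.mem_nhds (x := x + (0 : ℝ) • ξ)
      (by simpa using hx))] with t ht
    have h4 := hL (x + t • ξ) x ht hx
    simp only [Pi.smul_apply, Pi.sub_apply, zero_smul, add_zero, sub_zero, ← smul_sub]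
    rw [norm_smul, Real.norm_of_nonneg (by positivity)]
    refine h4.trans (le_of_eq ?_)
    rw [add_sub_cancel_left, norm_smul, mul_comm])
  rwa [norm_smul, Real.norm_of_nonneg (by positivity)] at h3

/-- A linear map close to an isomorphism is an isomorphism. -/
theorem exists_equiv_of_perturbation {BL : W ≃L[ℝ] W} {C κ : ℝ} (hC0 : 0 ≤ C)
    (hC : ∀ x, ‖x‖ ≤ C * ‖BL x‖) (hκ : 1 < κ) (T : W →ₗ[ℝ] W)
    (hT : ∀ ξ, κ * C * ‖T ξ - BL ξ‖ ≤ ‖ξ‖) :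
    ∃ S : W ≃L[ℝ] W, (∀ ξ, S ξ = T ξ) ∧ ∀ ξ, ‖ξ‖ ≤ κ / (κ - 1) * C * ‖T ξ‖ := by
  have hκ0 : 0 < κ := by linarith
  have hbound : ∀ ξ, ‖ξ‖ ≤ κ / (κ - 1) * C * ‖T ξ‖ := fun ξ =>
    norm_le_of_perturbation hκ ((hC ξ).trans (mul_le_mul_of_nonneg_left
      (norm_le_norm_add_norm_sub (T ξ) (BL ξ)) hC0)) (hT ξ)
  -- T = BL(I - N) with N = BL⁻¹(BL - T), and the hypothesis bounds N by 1/κ, so a Neumann series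
  -- inverts I - N. Continuity of T is a consequence.
  set N : W →L[ℝ] W := LinearMap.mkContinuous
    ((BL.symm : W ≃ₗ[ℝ] W).toLinearMap ∘ₗ ((BL : W ≃ₗ[ℝ] W).toLinearMap - T)) κ⁻¹ (fun ξ => by
      have h1 := hC (BL.symm (BL ξ - T ξ))
      rw [ContinuousLinearEquiv.apply_symm_apply, norm_sub_rev] at h1
      rw [inv_mul_eq_div, le_div_iff₀ hκ0]
      have h2 := mul_le_mul_of_nonneg_right h1 hκ0.le
      have h3 := hT ξ
      change ‖BL.symm (BL ξ - T ξ)‖ * κ ≤ ‖ξ‖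
      linarith) with hN
  have hNξ : ∀ ξ, N ξ = BL.symm (BL ξ - T ξ) := fun ξ => rfl
  have hN1 : ‖N‖ < 1 := lt_of_le_of_lt
    (LinearMap.mkContinuous_norm_le _ (inv_nonneg.2 hκ0.le) _) (inv_lt_one_of_one_lt₀ hκ)
  refine ⟨(ContinuousLinearEquiv.ofUnit (Units.oneSub N hN1)).trans BL, fun ξ => ?_, hbound⟩
  have : (ContinuousLinearEquiv.ofUnit (Units.oneSub N hN1)) ξ = ξ - N ξ := rfl
  rw [ContinuousLinearEquiv.trans_apply, this, hNξ]
  simp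

/-- Under directional differentiability the implicit function is continuously differentiable when
the parameter space is finite-dimensional. -/
theorem implicit_hasFDerivAt [FiniteDimensional ℝ Z] {U : Set Z} (hU : IsOpen U) {F : Z → W → W}
    {BL : W ≃L[ℝ] W} {C κ : ℝ} {ρ : ℝ≥0∞} (hC0 : 0 ≤ C) (hC : ∀ x, ‖x‖ ≤ C * ‖BL x‖) (hκ : 1 < κ)
    (hL : ∀ z ∈ U, ∀ x₁ x₂, ‖x₁‖ₑ < ρ → ‖x₂‖ₑ < ρ →
      κ * C * ‖(F z x₁ - BL x₁) - (F z x₂ - BL x₂)‖ ≤ ‖x₁ - x₂‖)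
    {D : Z → W → (Z × W →ₗ[ℝ] W)}
    (hD : ∀ z ∈ U, ∀ x ζ ξ, HasDerivAt (fun t : ℝ => F (z + t • ζ) (x + t • ξ)) (D z x (ζ, ξ)) 0)
    (hDc : ∀ ζ ξ, ContinuousOn (fun p : Z × W => D p.1 p.2 (ζ, ξ)) (U ×ˢ univ))
    {h : Z → W} (hhc : ContinuousOn h U)
    (hh : ∀ z ∈ U, F z (h z) = 0 ∧ ‖h z‖ₑ < ρ ∧
      ∀ x, ‖x‖ₑ ≤ ρ → ‖x - h z‖ ≤ κ / (κ - 1) * C * ‖F z x‖) :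
    ∃ (T : Z → W ≃L[ℝ] W) (h' : Z → Z →L[ℝ] W), ContinuousOn h' U ∧ ∀ z ∈ U,
      (∀ ξ, T z ξ = D z (h z) (0, ξ)) ∧ (∀ ζ, T z (h' z ζ) = -D z (h z) (ζ, 0)) ∧
      HasFDerivAt h (h' z) z := by
  have exT : ∀ z, ∃ S : W ≃L[ℝ] W, z ∈ U → (∀ ξ, S ξ = D z (h z) (0, ξ)) ∧
      ∀ ξ, ‖ξ‖ ≤ κ / (κ - 1) * C * ‖D z (h z) (0, ξ)‖ := by
    intro z
    by_cases hz : z ∈ U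
    · obtain ⟨S, hS⟩ := exists_equiv_of_perturbation (BL := BL) hC0 hC hκ
        ((D z (h z)) ∘ₗ LinearMap.inr ℝ Z W) (fun ξ => by
          have h1 := hD z hz (h z) 0 ξ
          simp only [smul_zero, add_zero] at h1
          exact norm_derivative_sub_le hC0 hκ (hL z hz) (hh z hz).2.1 h1)
      exact ⟨S, fun _ => hS⟩
    · exact ⟨BL, fun h => absurd h hz⟩
  choose T hT using exT
  set h' : Z → Z →L[ℝ] W := fun z => LinearMap.toContinuousLinearMap
    (-((T z).symm : W ≃ₗ[ℝ] W).toLinearMap ∘ₗ (D z (h z)) ∘ₗ LinearMap.inl ℝ Z W) with hh'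
  have hTh' : ∀ z ζ, T z (h' z ζ) = -D z (h z) (ζ, 0) := by
    intro z ζ
    have : h' z ζ = -(T z).symm (D z (h z) (ζ, 0)) := rfl
    rw [this, map_neg, ContinuousLinearEquiv.apply_symm_apply]
  have hzero : ∀ z ∈ U, ∀ ζ, D z (h z) (ζ, h' z ζ) = 0 := by
    intro z hz ζ
    have h1 : (ζ, h' z ζ) = (ζ, (0 : W)) + ((0 : Z), h' z ζ) := by simp
    rw [h1, map_add, ← (hT z hz).1, hTh']
    simp
  have hgraph : ContinuousOn (fun z => (z, h z)) U := continuousOn_id.prodMk hhc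
  -- D is continuous only for fixed directions. Freezing the direction at (ζ, h' z₀ ζ), where D
  -- vanishes at z₀, and using the uniform bound on the inverse of T z suffices.
  have hcont : ContinuousOn h' U := by
    rw [continuousOn_clm_apply]
    intro ζ z₀ hz₀
    rw [ContinuousWithinAt, tendsto_iff_norm_sub_tendsto_zero]
    have h1 : ContinuousWithinAt (fun z => D z (h z) (ζ, h' z₀ ζ)) U z₀ :=
      (hDc ζ (h' z₀ ζ)).comp (t := U ×ˢ univ) hgraph (fun z hz => ⟨hz, mem_univ _⟩) z₀ hz₀
    have h2 := (h1.norm).const_mul (κ / (κ - 1) * C)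
    rw [ContinuousWithinAt, hzero z₀ hz₀, norm_zero, mul_zero] at h2
    refine squeeze_zero' (Eventually.of_forall fun _ => norm_nonneg _) ?_ h2
    filter_upwards [self_mem_nhdsWithin] with z hz
    refine ((hT z hz).2 _).trans (le_of_eq ?_)
    congr 1
    rw [← (hT z hz).1, map_sub, hTh', (hT z hz).1, ← norm_neg, ← map_neg]
    have h3 : (ζ, h' z₀ ζ) = (ζ, (0 : W)) + ((0 : Z), h' z₀ ζ) := by simp
    rw [h3, map_add, map_neg]
    congr 1; abel
  refine ⟨T, h', hcont, fun z hz => ⟨(hT z hz).1, hTh' z, ?_⟩⟩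
  refine hasFDerivAt_of_hasLineDerivAt hU (fun z hz ζ => ?_) hcont hz
  rw [HasLineDerivAt, hasDerivAt_iff_isLittleO]
  have h1 := hD z hz (h z) ζ (h' z ζ)
  rw [hzero z hz, hasDerivAt_iff_isLittleO] at h1
  simp only [zero_smul, add_zero, (hh z hz).1, sub_zero, smul_zero] at h1 ⊢
  -- On the tangent line (z + tζ, h z + t h' z ζ) the value of F is o(t), and it controls the
  -- distance of that point from the graph of h.
  refine (Asymptotics.IsBigO.of_bound (κ / (κ - 1) * C) ?_).trans_isLittleO h1
  have hc1 : Continuous fun t : ℝ => z + t • ζ := by fun_prop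
  have hc2 : Continuous fun t : ℝ => h z + t • h' z ζ := by fun_prop
  have hopen : IsOpen {w : W | ‖w‖ₑ < ρ} := isOpen_lt continuous_enorm continuous_const
  filter_upwards [hc1.continuousAt.preimage_mem_nhds (hU.mem_nhds (x := z + (0 : ℝ) • ζ)
      (by simpa using hz)), hc2.continuousAt.preimage_mem_nhds
      (hopen.mem_nhds (x := h z + (0 : ℝ) • h' z ζ) (by simpa using (hh z hz).2.1))] with t ht1 ht2
  have h2 := (hh _ ht1).2.2 _ (le_of_lt ht2)
  refine le_trans (le_of_eq ?_) h2
  rw [norm_sub_rev]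
  beta_reduce
  congr 1
  abel

end Implicit

end SplitInfty

namespace SplitInfty

variable {H X : Type*} [NormedAddCommGroup H] [InnerProductSpace ℝ H] [CompleteSpace H]
  [NormedAddCommGroup X] [NormedSpace ℝ X]

/-! ### Saddle forms on H^±. -/

section Hilbert

variable {ι : X →L[ℝ] H} {V : Set H} {B : X → H →L[ℝ] H} {Binf : H →L[ℝ] H} {a R₀ : ℝ}

theorem exists_add_of_mem_Hpm (hB : IsSelfAdjoint Binf) [FiniteDimensional ℝ (Hminus Binf)] {w : H}
    (hw : w ∈ Hpm Binf) : ∃ u ∈ Hplus Binf, ∃ v ∈ Hminus Binf, u + v = w := by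
  set v : H := (Hminus Binf).starProjection w
  have hv : v ∈ Hminus Binf := Submodule.starProjection_apply_mem _ _
  refine ⟨w - v, (Submodule.mem_orthogonal _ _).2 fun y hy => ?_, v, hv, sub_add_cancel _ _⟩
  obtain ⟨z, hz, y', hy', rfl⟩ := Submodule.mem_sup.1 hy
  rw [inner_add_left, inner_sub_right, (Submodule.mem_orthogonal _ _).1 hw z hz,
    inner_H0_Hminus hB hz hv, sub_zero, zero_add]
  exact (Submodule.mem_orthogonal _ _).1 (Submodule.sub_starProjection_mem_orthogonal w) y' hy'

theorem norm_add_sq_of_orthogonal {u v : H} (h : ⟪u, v⟫_ℝ = 0) :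
    ‖u + v‖ ^ 2 = ‖u‖ ^ 2 + ‖v‖ ^ 2 := by
  rw [norm_add_sq_real, h]; ring

/-- A symmetric form that is positive on `H⁺` and negative on `H⁻` is bounded below on `H^±`. -/
theorem norm_le_of_saddle (hB : IsSelfAdjoint Binf) [FiniteDimensional ℝ (Hminus Binf)]
    {T : H →L[ℝ] H} (hT : ∀ u v, ⟪T u, v⟫_ℝ = ⟪u, T v⟫_ℝ)
    (hp : ∀ u ∈ Hplus Binf, a * ‖u‖ ^ 2 ≤ ⟪T u, u⟫_ℝ)
    (hm : ∀ v ∈ Hminus Binf, ⟪T v, v⟫_ℝ ≤ -(a * ‖v‖ ^ 2)) {w : H} (hw : w ∈ Hpm Binf) {c : ℝ}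
    (hc0 : 0 ≤ c) (hc : ∀ y ∈ Hpm Binf, ⟪T w, y⟫_ℝ ≤ c * ‖y‖) : a * ‖w‖ ≤ c := by
  obtain ⟨u, hu, v, hv, rfl⟩ := exists_add_of_mem_Hpm hB hw
  have huv : ⟪u, v⟫_ℝ = 0 := by rw [real_inner_comm]; exact inner_Hminus_Hplus hv hu
  -- Testing with u - v reverses the sign on H⁻, so the two definite parts add up; orthogonality
  -- gives u - v the norm of u + v.
  have h1 := hc (u - v) (Submodule.sub_mem _ (Hplus_le_Hpm hu) (Hminus_le_Hpm hB hv))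
  have h2 : ⟪T (u + v), u - v⟫_ℝ = ⟪T u, u⟫_ℝ - ⟪T v, v⟫_ℝ := by
    rw [map_add, inner_add_left, inner_sub_right, inner_sub_right, hT u v, real_inner_comm (T v) u]
    ring
  have h3 : ‖u - v‖ = ‖u + v‖ := by
    rw [← sq_eq_sq₀ (norm_nonneg _) (norm_nonneg _), norm_add_sq_of_orthogonal huv, sub_eq_add_neg,
      norm_add_sq_of_orthogonal (by rw [inner_neg_right, huv, neg_zero]), norm_neg]
  rw [h2, h3] at h1
  have h4 := norm_add_sq_of_orthogonal huv
  have h5 : a * ‖u + v‖ ^ 2 = a * ‖u‖ ^ 2 + a * ‖v‖ ^ 2 := by rw [h4]; ring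
  rcases (norm_nonneg (u + v)).eq_or_lt with h0 | h0
  · rwa [← h0, mul_zero]
  · refine le_of_mul_le_mul_right ?_ h0
    linarith [hp u hu, hm v hv, sq ‖u + v‖]

/-- `B(∞)` maps `H^±` onto itself. -/
theorem exists_preimage (hB : IsSelfAdjoint Binf) [FiniteDimensional ℝ (Hminus Binf)]
    (ha : 0 < a) (hp : ∀ u ∈ Hplus Binf, a * ‖u‖ ^ 2 ≤ ⟪Binf u, u⟫_ℝ)
    (hm : ∀ v ∈ Hminus Binf, ⟪Binf v, v⟫_ℝ ≤ -(a * ‖v‖ ^ 2)) {y : H} (hy : y ∈ Hpm Binf) :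
    ∃ w ∈ Hpm Binf, Binf w = y := by
  have hbelow : ∀ w ∈ Hpm Binf, a * ‖w‖ ≤ ‖Binf w‖ := fun w hw =>
    norm_le_of_saddle hB (inner_map_comm hB) hp hm hw (norm_nonneg _) fun y _ => real_inner_le_norm _ _
  set f : Hpm Binf →L[ℝ] H := Binf.comp (Hpm Binf).subtypeL
  have hf : AntilipschitzWith a⁻¹.toNNReal f := f.antilipschitz_of_bound fun u => by
    rw [Real.coe_toNNReal _ (by positivity), ← div_eq_inv_mul, le_div_iff₀ ha, mul_comm]
    exact hbelow u u.2
  have hce : IsClosedEmbedding f := hf.isClosedEmbedding f.uniformContinuous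
  set R : Submodule ℝ H := LinearMap.range (f : Hpm Binf →ₗ[ℝ] H)
  have hRc : IsClosed (R : Set H) := hce.isClosed_range
  have hRcomp : CompleteSpace R := hRc.completeSpace_coe
  -- The range R is closed because B(∞) is bounded below on H^±; its complement lies in the kernel
  -- by symmetry, so R contains H^±.
  have hperp : Rᗮ ≤ H0 Binf := by
    intro x hx
    rw [mem_H0]
    have h1 : ∀ w ∈ Hpm Binf, ⟪w, Binf x⟫_ℝ = 0 := fun w hw => by
      rw [← inner_map_comm hB]
      exact (Submodule.mem_orthogonal _ _).1 hx (Binf w) ⟨⟨w, hw⟩, rfl⟩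
    exact inner_self_eq_zero.1 (h1 _ (map_mem_Hpm hB x))
  have h2 : y ∈ Rᗮᗮ := Submodule.orthogonal_le hperp hy
  rw [Submodule.orthogonal_orthogonal] at h2
  obtain ⟨w, hw⟩ := h2
  exact ⟨w, w.2, hw⟩

end Hilbert

/-! ### The linear structure on X. -/

section Frame

variable [CompleteSpace X]

/-- The linear maps on `X` that the proof uses: the inclusion `H⁰ ⊂ X`, the projection of `X` onto
`X^±`, and the isomorphism of `X^±` induced by `B(∞)`. -/
structure XFrame (ι : X →L[ℝ] H) (Binf : H →L[ℝ] H) where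
  e : H0 Binf →L[ℝ] X
  e_eq : ∀ z : H0 Binf, lift ι (z : H) = e z
  ι_e : ∀ z, ι (e z) = z
  q : X →L[ℝ] Xpm ι Binf
  coe_q : ∀ x, (q x : X) = QX ι Binf x
  ι_q : ∀ x, ι (q x) = ι x - P0 Binf (ι x)
  q_coe : ∀ x : Xpm ι Binf, q (x : X) = x
  BL : Xpm ι Binf ≃L[ℝ] Xpm ι Binf
  coe_BL : ∀ x, (BL x : X) = BX ι Binf x
  ι_BL : ∀ x, ι (BL x) = Binf (ι x)
  complete : CompleteSpace (Xpm ι Binf)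

variable {ι : X →L[ℝ] H} {V : Set H} {B : X → H →L[ℝ] H} {Binf : H →L[ℝ] H} {a R₀ : ℝ}

theorem isClosed_Xpm : IsClosed (Xpm ι Binf : Set X) :=
  (Submodule.isClosed_orthogonal (H0 Binf)).preimage ι.continuous

theorem P0_apply_mem (u : H) : P0 Binf u ∈ H0 Binf := Submodule.starProjection_apply_mem _ _

theorem sub_P0_mem (u : H) : u - P0 Binf u ∈ Hpm Binf :=
  Submodule.sub_starProjection_mem_orthogonal u

theorem P0_of_mem {u : H} (hu : u ∈ H0 Binf) : P0 Binf u = u :=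
  Submodule.starProjection_eq_self_iff.2 hu

theorem P0_of_mem_Hpm {u : H} (hu : u ∈ Hpm Binf) : P0 Binf u = 0 :=
  (Submodule.starProjection_apply_eq_zero_iff _).2 hu

/-- The projection is continuous on X because H⁰ has finite dimension. B(∞) on X^± has closed graph,
as limits can be identified in H; it is onto because preimages found in H^± lie in X by (C2), and
injective because H^± meets the kernel trivially. -/
theorem exists_xFrame (hι : Function.Injective ι) (hB : IsSelfAdjoint Binf)
    (hBX : ∀ u : X, Binf (ι u) ∈ range ι) (hC2 : CondC2 ι Binf)
    (hs : SaddleAtInfty ι V B Binf a R₀) : Nonempty (XFrame ι Binf) := by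
  have := hs.finite_zero
  have := hs.finite_minus
  have hcomp : CompleteSpace (Xpm ι Binf) := isClosed_Xpm.completeSpace_coe
  obtain ⟨e, he⟩ := exists_lift_clm hι (H0 Binf) hs.zero_range
  have hlP : ∀ u : H, ι (lift ι (P0 Binf u)) = P0 Binf u := fun u =>
    apply_lift (hs.zero_range _ (P0_apply_mem u))
  have hqmem : ∀ x, QX ι Binf x ∈ Xpm ι Binf := by
    intro x
    change ι (QX ι Binf x) ∈ Hpm Binf
    rw [QX, map_sub, hlP]
    exact sub_P0_mem _
  let q₀ : X →L[ℝ] X := ContinuousLinearMap.id ℝ X -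
    e.comp ((H0 Binf).orthogonalProjectionOnto.comp ι)
  have hq₀ : ∀ x, q₀ x = QX ι Binf x := fun x => by
    change x - e ((H0 Binf).orthogonalProjectionOnto (ι x)) = x - lift ι (P0 Binf (ι x))
    rw [(he _).1]; rfl
  let q : X →L[ℝ] Xpm ι Binf := q₀.codRestrict (Xpm ι Binf) fun x => by
    rw [hq₀]; exact hqmem x
  have hq : ∀ x, (q x : X) = QX ι Binf x := hq₀
  have hιB : ∀ x, ι (BX ι Binf x) = Binf (ι x) := fun x => apply_lift (hBX x)
  let b : Xpm ι Binf →ₗ[ℝ] Xpm ι Binf :=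
    { toFun := fun x => ⟨BX ι Binf x, by
        change ι (BX ι Binf x) ∈ Hpm Binf
        rw [hιB]; exact map_mem_Hpm hB _⟩
      map_add' := fun x y => Subtype.ext (hι (by
        change ι (BX ι Binf (x + y)) = ι (BX ι Binf x + BX ι Binf y)
        rw [map_add, hιB, hιB, hιB, map_add, map_add]))
      map_smul' := fun c x => Subtype.ext (hι (by
        change ι (BX ι Binf (c • x)) = ι (c • BX ι Binf x)
        rw [map_smul, hιB, hιB, map_smul, map_smul])) }
  have hb : ∀ x, ι (b x) = Binf (ι x) := fun x => hιB x
  let bl : Xpm ι Binf →L[ℝ] Xpm ι Binf := ContinuousLinearMap.ofSeqClosedGraph (g := b) (by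
    intro u x y hu hy
    refine Subtype.ext (hι ?_)
    have h1 : Tendsto (fun n => ι (b (u n))) atTop (𝓝 (ι y)) :=
      ((ι.continuous.comp continuous_subtype_val).tendsto y).comp hy
    have h2 : Tendsto (fun n => Binf (ι (u n))) atTop (𝓝 (Binf (ι x))) :=
      ((Binf.continuous.comp (ι.continuous.comp continuous_subtype_val)).tendsto x).comp hu
    rw [hb]
    exact tendsto_nhds_unique h1 (h2.congr fun n => (hb _).symm))
  have hbl : ∀ x, bl x = b x := fun x => rfl
  let BL := ContinuousLinearEquiv.ofBijective bl
    (LinearMap.ker_eq_bot'.2 fun x hx => by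
      have h1 : Binf (ι x) = 0 := by
        rw [← hb, ← hbl, show bl x = 0 from hx]; simp
      have h2 : ⟪ι (x : X), ι (x : X)⟫_ℝ = 0 := (Submodule.mem_orthogonal _ _).1 x.2 _ (mem_H0.2 h1)
      exact Subtype.ext (hι (by rw [inner_self_eq_zero.1 h2]; simp)))
    (LinearMap.range_eq_top.2 fun y => by
      obtain ⟨w, hw, hwy⟩ := exists_preimage hB hs.a_pos hs.inf_plus hs.inf_minus y.2
      obtain ⟨x, rfl⟩ := hC2 w (by rw [hwy]; exact ⟨y, rfl⟩)
      exact ⟨⟨x, hw⟩, Subtype.ext (hι ((hb _).trans hwy))⟩)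
  refine ⟨⟨e, fun z => (he z).1.symm, fun z => (he z).2, q, hq, fun x => ?_, fun x => ?_,
    BL, fun x => rfl, fun x => hb x, hcomp⟩⟩
  · rw [hq, QX, map_sub, hlP]
  · refine Subtype.ext (hι ?_)
    have h0 : P0 Binf (ι (x : X)) = 0 := P0_of_mem_Hpm x.2
    rw [hq, QX, map_sub, hlP, h0, sub_zero]

theorem C1const_nonneg : 0 ≤ C1const ι Binf := Real.sInf_nonneg fun _ h => h.1

/-- The set defining C₁ is nonempty since `BL` has a bounded inverse, and its infimum is attained
because the bound is a closed condition for each x. -/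
theorem XFrame.norm_le (fr : XFrame ι Binf) (x : Xpm ι Binf) :
    ‖x‖ ≤ C1const ι Binf * ‖fr.BL x‖ := by
  set S := {C : ℝ | 0 ≤ C ∧ ∀ x : Xpm ι Binf, ‖(x : X)‖ ≤ C * ‖BX ι Binf x‖}
  have hne : S.Nonempty := by
    refine ⟨‖(fr.BL.symm : Xpm ι Binf →L[ℝ] Xpm ι Binf)‖,
      ContinuousLinearMap.opNorm_nonneg _, fun x => ?_⟩
    have := (fr.BL.symm : Xpm ι Binf →L[ℝ] Xpm ι Binf).le_opNorm (fr.BL x)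
    rw [ContinuousLinearEquiv.coe_coe, ContinuousLinearEquiv.symm_apply_apply] at this
    rwa [← fr.coe_BL]
  have hnorm : ‖fr.BL x‖ = ‖BX ι Binf x‖ := by rw [← fr.coe_BL]; rfl
  rcases (norm_nonneg (fr.BL x)).eq_or_lt with h0 | h0
  · rw [(map_eq_zero_iff fr.BL fr.BL.injective).1 (norm_eq_zero.1 h0.symm)]; simp
  · rw [← div_le_iff₀ h0]
    refine le_csInf hne fun C hC => ?_
    rw [div_le_iff₀ h0, hnorm]
    exact hC.2 x

end Frame

end SplitInfty

namespace SplitInfty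

/-! ### Convexity along lines. -/

section OneDim

variable {f f' f'' : ℝ → ℝ} {c : ℝ}

/-- Subtracting the parabola c t²/2 reduces strong convexity to monotonicity of the derivative. -/
theorem convexity_of_second_deriv (hf : ∀ t, HasDerivAt f (f' t) t)
    (hf' : ∀ t, HasDerivAt f' (f'' t) t) (hc : ∀ t, c ≤ f'' t) :
    (∀ s, 0 ≤ s → s ≤ 1 → f s ≤ s * f 1 + (1 - s) * f 0 - c / 2 * (s * (1 - s))) ∧
      f 0 + f' 0 + c / 2 ≤ f 1 := by
  set g : ℝ → ℝ := fun t => f t - c / 2 * t ^ 2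
  have hg : ∀ t, HasDerivAt g (f' t - c * t) t := fun t => by
    have h1 := (hf t).sub ((hasDerivAt_pow 2 t).const_mul (c / 2))
    refine h1.congr_deriv ?_
    norm_num
    ring
  have hg' : ∀ t, HasDerivAt (fun t => f' t - c * t) (f'' t - c) t := fun t =>
    ((hf' t).sub ((hasDerivAt_id t).const_mul c)).congr_deriv (by rw [mul_one])
  have hmono : Monotone fun t => f' t - c * t :=
    monotone_of_deriv_nonneg (fun t => (hg' t).differentiableAt) fun t => by
      rw [(hg' t).deriv]; linarith [hc t]
  have hdg : deriv g = fun t => f' t - c * t := funext fun t => (hg t).deriv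
  have hconv : ConvexOn ℝ univ g :=
    Monotone.convexOn_univ_of_deriv (fun t => (hg t).differentiableAt) (by rw [hdg]; exact hmono)
  constructor
  · intro s h0 h1
    have := hconv.2 (mem_univ 1) (mem_univ 0) h0 (sub_nonneg.2 h1) (by ring)
    simp only [smul_eq_mul, g, mul_one, mul_zero, add_zero] at this
    nlinarith
  · obtain ⟨ξ, hξ, h⟩ := exists_hasDerivAt_eq_slope g (fun t => f' t - c * t) one_pos
      (fun t _ => (hg t).continuousAt.continuousWithinAt) fun t _ => hg t
    have h2 := hmono hξ.1.le
    simp only [g] at h h2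
    rw [h] at h2
    norm_num at h2
    linarith

end OneDim

variable {H X : Type*} [NormedAddCommGroup H] [InnerProductSpace ℝ H] [CompleteSpace H]
  [NormedAddCommGroup X] [NormedSpace ℝ X]

variable {ι : X →L[ℝ] H} {V : Set H} {L : H → ℝ} {A : X → X} {B : X → H →L[ℝ] H}
  {Binf : H →L[ℝ] H} {a R₀ : ℝ}

instance : CompleteSpace (Hplus Binf) :=
  (Submodule.isClosed_orthogonal (H0 Binf ⊔ Hminus Binf)).completeSpace_coe

theorem norm_P0_le (u : H) : ‖P0 Binf u‖ ≤ ‖u‖ := Submodule.norm_starProjection_apply_le _ _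

theorem P0_add_of_mem_Hpm (p : H) {u : H} (hu : u ∈ Hpm Binf) :
    P0 Binf (p + u) = P0 Binf p := by
  rw [map_add, P0_of_mem_Hpm hu, add_zero]

/-- The standing assumptions, with the bounds at infinity that follow from (D). -/
structure Setting (ι : X →L[ℝ] H) (V : Set H) (L : H → ℝ) (A : X → X) (B : X → H →L[ℝ] H)
    (Binf : H →L[ℝ] H) (a R₀ : ℝ) : Prop where
  S : CondS ι
  isOpen : IsOpen V
  F1 : CondF1 V L
  F2 : CondF2 ι V L A
  F3 : CondF3 ι V A B Binf
  saddle : SaddleAtInfty ι V B Binf a R₀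

namespace Setting

variable (st : Setting ι V L A B Binf a R₀)
include st

theorem norm_lt_of_P0 {p : H} (hp : R₀ < ‖P0 Binf p‖) : R₀ < ‖p‖ := hp.trans_le (norm_P0_le p)

theorem mem_of_P0 {p : H} (hp : R₀ < ‖P0 Binf p‖) : p ∈ V :=
  st.saddle.mem p (st.norm_lt_of_P0 hp)

/-- Both sides agree when paired with the dense subspace X. As ι is injective, the directional
derivative of A is therefore linear in the direction. -/
theorem ι_lineDeriv {x : X} (hx : x ∈ ι ⁻¹' V) (u : X) : ι (lineDeriv ℝ A x u) = B x (ι u) :=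
  st.S.2.1.eq_of_inner_left ℝ fun v => st.F3.2.2.2 x hx u v

theorem hasLineDerivAt_A {x : X} (hx : x ∈ ι ⁻¹' V) (u : X) :
    HasLineDerivAt ℝ A (lineDeriv ℝ A x u) x u :=
  ((st.F2.2.1 u).1 x hx).hasLineDerivAt

theorem hasLineDerivAt_L {x : X} (hx : x ∈ ι ⁻¹' V) (u : X) :
    HasLineDerivAt ℝ (fun x => L (ι x)) ⟪ι (A x), ι u⟫_ℝ x u := by
  have h1 := ((st.F1.2 (ι u)).1 (ι x) hx).hasLineDerivAt
  rw [st.F2.2.2 x hx u] at h1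
  refine HasDerivAt.congr_of_eventuallyEq h1 (Eventually.of_forall fun t => ?_)
  simp

theorem hasDerivAt_L {x u : X} {t : ℝ} (h : x + t • u ∈ ι ⁻¹' V) :
    HasDerivAt (fun s : ℝ => L (ι (x + s • u))) ⟪ι (A (x + t • u)), ι u⟫_ℝ t :=
  hasDerivAt_line_of_hasLineDerivAt (st.hasLineDerivAt_L h u)

theorem hasDerivAt_A {x u : X} {t : ℝ} (h : x + t • u ∈ ι ⁻¹' V) (w : H) :
    HasDerivAt (fun s : ℝ => ⟪ι (A (x + s • u)), w⟫_ℝ) ⟪B (x + t • u) (ι u), w⟫_ℝ t := by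
  have h1 := hasDerivAt_line_of_hasLineDerivAt (st.hasLineDerivAt_A h u)
  have h2 := (ι.hasFDerivAt.comp_hasDerivAt t h1).inner ℝ (hasDerivAt_const t w)
  rw [st.ι_lineDeriv h] at h2
  simpa using h2

/-- Motion along H^± does not change the component in H⁰. Hence entire fibres over far points stay
in V and in the region of the uniform bounds. -/
theorem P0_line {x u : X} (hx : R₀ < ‖P0 Binf (ι x)‖) (hu : ι u ∈ Hpm Binf) (t : ℝ) :
    R₀ < ‖P0 Binf (ι (x + t • u))‖ := by
  rwa [map_add, map_smul, P0_add_of_mem_Hpm _ (Submodule.smul_mem _ t hu)]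

/-- The second derivative along u is the form of B on H⁺, hence at least a‖u‖²; if the first
derivative vanishes, quadratic growth follows. -/
theorem plus_line {x u : X} (hx : R₀ < ‖P0 Binf (ι x)‖) (hu : ι u ∈ Hplus Binf) :
    (∀ s, 0 ≤ s → s ≤ 1 →
      L (ι x + s • ι u) ≤ s * L (ι x + ι u) + (1 - s) * L (ι x)) ∧
    (⟪ι (A x), ι u⟫_ℝ = 0 → L (ι x) + a / 2 * ‖ι u‖ ^ 2 ≤ L (ι x + ι u)) := by
  have hl := st.P0_line hx (Hplus_le_Hpm hu)
  have h1 := convexity_of_second_deriv (f := fun t : ℝ => L (ι (x + t • u)))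
    (fun t => st.hasDerivAt_L (st.mem_of_P0 (hl t)))
    (fun t => st.hasDerivAt_A (st.mem_of_P0 (hl t)) (ι u))
    (fun t => st.saddle.plus _ (st.norm_lt_of_P0 (hl t)) (ι u) hu)
  simp only [zero_smul, one_smul, add_zero, map_add, map_smul] at h1
  refine ⟨fun s h0 hs => (h1.1 s h0 hs).trans ?_, fun h => ?_⟩
  · have := st.saddle.a_pos
    have : 0 ≤ a * ‖ι u‖ ^ 2 / 2 * (s * (1 - s)) := by
      have : 0 ≤ 1 - s := by linarith
      positivity
    linarith
  · have := h1.2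
    rw [h] at this
    linarith

theorem minus_line {x v : X} (hx : R₀ < ‖P0 Binf (ι x)‖) (hv : ι v ∈ Hminus Binf) :
    (∀ s, 0 ≤ s → s ≤ 1 →
      s * L (ι x + ι v) + (1 - s) * L (ι x) + a / 2 * (s * (1 - s)) * ‖ι v‖ ^ 2 ≤
        L (ι x + s • ι v)) ∧
    (⟪ι (A x), ι v⟫_ℝ = 0 → L (ι x + ι v) ≤ L (ι x)) := by
  have hl := st.P0_line hx (Hminus_le_Hpm st.F3.2.1 hv)
  have h1 := convexity_of_second_deriv (f := fun t : ℝ => -L (ι (x + t • v)))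
    (fun t => (st.hasDerivAt_L (st.mem_of_P0 (hl t))).neg)
    (fun t => (st.hasDerivAt_A (st.mem_of_P0 (hl t)) (ι v)).neg)
    (c := a * ‖ι v‖ ^ 2)
    (fun t => by linarith [st.saddle.minus _ (st.norm_lt_of_P0 (hl t)) (ι v) hv])
  simp only [zero_smul, one_smul, add_zero, map_add, map_smul] at h1
  refine ⟨fun s h0 hs => ?_, fun h => ?_⟩
  · linarith [h1.1 s h0 hs]
  · have := h1.2
    rw [h] at this
    have h3 : 0 ≤ a * ‖ι v‖ ^ 2 := mul_nonneg st.saddle.a_pos.le (sq_nonneg _)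
    linarith

/-- Two applications of the mean value theorem turn the mixed second difference into a value ⟪B(x)u,
v⟫ at an intermediate point. -/
theorem cross_le {x u v : X} (hx : R₀ < ‖P0 Binf (ι x)‖) (hu : ι u ∈ Hplus Binf)
    (hv : ι v ∈ Hminus Binf) :
    L (ι x + ι u + ι v) - L (ι x + ι u) - L (ι x + ι v) + L (ι x) ≤ ‖ι u‖ * ‖ι v‖ := by
  have hl : ∀ t s : ℝ, R₀ < ‖P0 Binf (ι (x + t • v + s • u))‖ := fun t s =>
    st.P0_line (st.P0_line hx (Hminus_le_Hpm st.F3.2.1 hv) t) (Hplus_le_Hpm hu) s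
  have hA : ∀ t : ℝ, ⟪ι (A (x + t • v + u)), ι v⟫_ℝ - ⟪ι (A (x + t • v)), ι v⟫_ℝ ≤
      ‖ι u‖ * ‖ι v‖ := by
    intro t
    obtain ⟨ξ, -, hξ⟩ := exists_hasDerivAt_eq_slope
      (fun s : ℝ => ⟪ι (A (x + t • v + s • u)), ι v⟫_ℝ) _ one_pos
      (fun s _ => (st.hasDerivAt_A (st.mem_of_P0 (hl t s)) (ι v)).continuousAt.continuousWithinAt)
      fun s _ => st.hasDerivAt_A (st.mem_of_P0 (hl t s)) (ι v)
    simp only [one_smul, zero_smul, add_zero, sub_zero, div_one] at hξ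
    rw [← hξ]
    exact (le_abs_self _).trans
      (st.saddle.cross _ (st.norm_lt_of_P0 (hl t ξ)) (ι u) hu (ι v) hv)
  have hd : ∀ t : ℝ, HasDerivAt (fun t : ℝ => L (ι (x + u + t • v)) - L (ι (x + t • v)))
      (⟪ι (A (x + t • v + u)), ι v⟫_ℝ - ⟪ι (A (x + t • v)), ι v⟫_ℝ) t := by
    intro t
    have h1 := hl t 1
    have h0 := hl t 0
    rw [one_smul] at h1
    rw [zero_smul, add_zero] at h0
    have e : x + t • v + u = x + u + t • v := by abel
    rw [e] at h1 ⊢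
    exact (st.hasDerivAt_L (st.mem_of_P0 h1)).sub (st.hasDerivAt_L (st.mem_of_P0 h0))
  obtain ⟨ξ, -, hξ⟩ := exists_hasDerivAt_eq_slope
    (fun t : ℝ => L (ι (x + u + t • v)) - L (ι (x + t • v))) _ one_pos
    (fun t _ => (hd t).continuousAt.continuousWithinAt) fun t _ => hd t
  have := hA ξ
  rw [hξ] at this
  simp only [one_smul, zero_smul, add_zero, sub_zero, div_one, map_add] at this
  linarith

/-! ### Passage to `H` by density -/

theorem exists_seq_tendsto (p : H) : ∃ x : ℕ → X, Tendsto (fun n => ι (x n)) atTop (𝓝 p) := by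
  obtain ⟨y, hy, hlim⟩ := mem_closure_iff_seq_limit.1 (st.S.2.1 p)
  choose x hx using hy
  exact ⟨x, by simpa only [hx] using hlim⟩

/-- Projection onto H⁺ preserves X, because the part removed lies in H⁰ ⊕ H⁻, which is contained in
X. Approximations from X can thus be projected. -/
theorem exists_seq_tendsto_plus {u : H} (hu : u ∈ Hplus Binf) : ∃ y : ℕ → X,
    (∀ n, ι (y n) ∈ Hplus Binf) ∧ Tendsto (fun n => ι (y n)) atTop (𝓝 u) := by
  have := st.saddle.finite_zero
  have := st.saddle.finite_minus
  obtain ⟨x, hx⟩ := st.exists_seq_tendsto u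
  have hpr : ∀ n, ∃ y, ι y = (Hplus Binf).starProjection (ι (x n)) := by
    intro n
    have h1 : ι (x n) - (Hplus Binf).starProjection (ι (x n)) ∈ (H0 Binf ⊔ Hminus Binf)ᗮᗮ :=
      Submodule.sub_starProjection_mem_orthogonal _
    rw [Submodule.orthogonal_orthogonal] at h1
    obtain ⟨z, hz, v, hv, h2⟩ := Submodule.mem_sup.1 h1
    obtain ⟨z', rfl⟩ := st.saddle.zero_range z hz
    obtain ⟨v', rfl⟩ := st.saddle.minus_range v hv
    refine ⟨x n - (z' + v'), ?_⟩
    rw [map_sub, map_add, h2, sub_sub_cancel]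
  choose y hy using hpr
  refine ⟨y, fun n => ?_, ?_⟩
  · rw [hy]; exact Submodule.starProjection_apply_mem _ _
  · have h3 := (((Hplus Binf).starProjection.continuous.tendsto u).comp hx)
    rw [Submodule.starProjection_eq_self_iff.2 hu] at h3
    exact h3.congr fun n => (hy n).symm

theorem tendsto_L {p : H} (hp : R₀ < ‖P0 Binf p‖) {q : ℕ → H} (hq : Tendsto q atTop (𝓝 p)) :
    Tendsto (fun n => L (q n)) atTop (𝓝 (L p)) :=
  ((st.F1.1.continuousAt (st.isOpen.mem_nhds (st.mem_of_P0 hp))).tendsto).comp hq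

theorem eventually_P0 {p : H} (hp : R₀ < ‖P0 Binf p‖) {q : ℕ → H} (hq : Tendsto q atTop (𝓝 p)) :
    ∀ᶠ n in atTop, R₀ < ‖P0 Binf (q n)‖ :=
  ((P0 Binf).continuous.norm.tendsto p).comp hq |>.eventually (lt_mem_nhds hp)

theorem convex_plus {p u : H} (hp : R₀ < ‖P0 Binf p‖) (hu : u ∈ Hplus Binf) {s : ℝ} (h0 : 0 ≤ s)
    (h1 : s ≤ 1) : L (p + s • u) ≤ s * L (p + u) + (1 - s) * L p := by
  obtain ⟨x, hx⟩ := st.exists_seq_tendsto p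
  obtain ⟨y, hy, hyu⟩ := st.exists_seq_tendsto_plus hu
  have hm : ∀ {w : H}, w ∈ Hplus Binf → R₀ < ‖P0 Binf (p + w)‖ := fun hw => by
    rwa [P0_add_of_mem_Hpm _ (Hplus_le_Hpm hw)]
  refine le_of_tendsto_of_tendsto
    (st.tendsto_L (hm (Submodule.smul_mem _ s hu)) (hx.add (hyu.const_smul s)))
    (((st.tendsto_L (hm hu) (hx.add hyu)).const_mul s).add
      ((st.tendsto_L hp hx).const_mul (1 - s))) ?_
  filter_upwards [st.eventually_P0 hp hx] with n hn
  exact (st.plus_line hn (hy n)).1 s h0 h1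

theorem growth_plus {x : X} {u : H} (hx : R₀ < ‖P0 Binf (ι x)‖)
    (hcrit : ∀ w ∈ Hpm Binf, ⟪ι (A x), w⟫_ℝ = 0) (hu : u ∈ Hplus Binf) :
    L (ι x) + a / 2 * ‖u‖ ^ 2 ≤ L (ι x + u) := by
  obtain ⟨y, hy, hyu⟩ := st.exists_seq_tendsto_plus hu
  have hm : R₀ < ‖P0 Binf (ι x + u)‖ := by rwa [P0_add_of_mem_Hpm _ (Hplus_le_Hpm hu)]
  refine le_of_tendsto_of_tendsto (((hyu.norm.pow 2).const_mul (a / 2)).const_add (L (ι x)))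
    (st.tendsto_L hm (hyu.const_add (ι x))) (Eventually.of_forall fun n => ?_)
  exact (st.plus_line hx (hy n)).2 (hcrit _ (Hplus_le_Hpm (hy n)))

theorem concave_minus {p v : H} (hp : R₀ < ‖P0 Binf p‖) (hv : v ∈ Hminus Binf) {s : ℝ}
    (h0 : 0 ≤ s) (h1 : s ≤ 1) :
    s * L (p + v) + (1 - s) * L p + a / 2 * (s * (1 - s)) * ‖v‖ ^ 2 ≤ L (p + s • v) := by
  obtain ⟨x, hx⟩ := st.exists_seq_tendsto p
  obtain ⟨y, rfl⟩ := st.saddle.minus_range v hv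
  have hm : ∀ {w : H}, w ∈ Hminus Binf → R₀ < ‖P0 Binf (p + w)‖ := fun hw => by
    rwa [P0_add_of_mem_Hpm _ (Hminus_le_Hpm st.F3.2.1 hw)]
  refine le_of_tendsto_of_tendsto
    ((((st.tendsto_L (hm hv) (hx.add_const (ι y))).const_mul s).add
      ((st.tendsto_L hp hx).const_mul (1 - s))).add_const _)
    (st.tendsto_L (hm (Submodule.smul_mem _ s hv)) (hx.add_const (s • ι y))) ?_
  filter_upwards [st.eventually_P0 hp hx] with n hn
  exact (st.minus_line hn hv).1 s h0 h1

theorem max_minus {x : X} {v : H} (hx : R₀ < ‖P0 Binf (ι x)‖)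
    (hcrit : ∀ w ∈ Hpm Binf, ⟪ι (A x), w⟫_ℝ = 0) (hv : v ∈ Hminus Binf) :
    L (ι x + v) ≤ L (ι x) := by
  obtain ⟨y, rfl⟩ := st.saddle.minus_range v hv
  exact (st.minus_line hx hv).2 (hcrit _ (Hminus_le_Hpm st.F3.2.1 hv))

theorem cross_plus_minus {x : X} {u v : H} (hx : R₀ < ‖P0 Binf (ι x)‖) (hu : u ∈ Hplus Binf)
    (hv : v ∈ Hminus Binf) :
    L (ι x + u + v) - L (ι x + u) - L (ι x + v) + L (ι x) ≤ ‖u‖ * ‖v‖ := by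
  obtain ⟨y, hy, hyu⟩ := st.exists_seq_tendsto_plus hu
  obtain ⟨v, rfl⟩ := st.saddle.minus_range v hv
  have hmu : R₀ < ‖P0 Binf (ι x + u)‖ := by rwa [P0_add_of_mem_Hpm _ (Hplus_le_Hpm hu)]
  have hmv : R₀ < ‖P0 Binf (ι x + u + ι v)‖ := by
    rwa [P0_add_of_mem_Hpm _ (Hminus_le_Hpm st.F3.2.1 hv)]
  have h1 := hyu.const_add (ι x)
  refine le_of_tendsto_of_tendsto
    ((((st.tendsto_L hmv (h1.add_const (ι v))).sub (st.tendsto_L hmu h1)).sub_const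
      (L (ι x + ι v))).add_const (L (ι x)))
    (hyu.norm.mul_const ‖ι v‖) (Eventually.of_forall fun n => ?_)
  exact st.cross_le hx (hy n) hv

end Setting

end SplitInfty

namespace SplitInfty

variable {H X : Type*} [NormedAddCommGroup H] [InnerProductSpace ℝ H] [CompleteSpace H]
  [NormedAddCommGroup X] [NormedSpace ℝ X] [CompleteSpace X]

variable {ι : X →L[ℝ] H} {V : Set H} {L : H → ℝ} {A : X → X} {B : X → H →L[ℝ] H}
  {Binf : H →L[ℝ] H} {a R₀ R : ℝ} {ρ : ℝ≥0∞}

theorem isOpen_ext0 : IsOpen (ext0 Binf R) := isOpen_lt continuous_const continuous_norm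

/-- The solution map `h` of `(I - P⁰) A(z + x) = 0`, together with its derivative. -/
structure Reduction (A : X → X) (fr : XFrame ι Binf) (ρ : ℝ≥0∞) (K R : ℝ)
    (h : H0 Binf → Xpm ι Binf) (T : H0 Binf → Xpm ι Binf ≃L[ℝ] Xpm ι Binf)
    (h' : H0 Binf → H0 Binf →L[ℝ] Xpm ι Binf) : Prop where
  cont : ContinuousOn h (ext0 Binf R)
  lt : ∀ z ∈ ext0 Binf R, ‖h z‖ₑ < ρ
  zero : ∀ z ∈ ext0 Binf R, fr.q (A (fr.e z + h z)) = 0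
  bound : ∀ z ∈ ext0 Binf R, ‖h z‖ ≤ K * ‖fr.q (A (fr.e z))‖
  unique : ∀ z ∈ ext0 Binf R, ∀ x : Xpm ι Binf, ‖x‖ₑ ≤ ρ → fr.q (A (fr.e z + x)) = 0 → x = h z
  T_apply : ∀ z ∈ ext0 Binf R, ∀ ξ : Xpm ι Binf,
    T z ξ = fr.q (lineDeriv ℝ A (fr.e z + h z) (ξ : X))
  T_deriv : ∀ z ∈ ext0 Binf R, ∀ ζ, T z (h' z ζ) = -fr.q (lineDeriv ℝ A (fr.e z + h z) (fr.e ζ))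
  deriv : ∀ z ∈ ext0 Binf R, HasFDerivAt h (h' z) z
  deriv_cont : ContinuousOn h' (ext0 Binf R)

namespace XFrame

variable (fr : XFrame ι Binf)

theorem coe_remainder (z : H0 Binf) (x : Xpm ι Binf) :
    remainder ι A Binf z x = ((fr.q (A (fr.e z + x)) - fr.BL x : Xpm ι Binf) : X) := by
  rw [remainder, fr.e_eq, Submodule.coe_sub, fr.coe_q, fr.coe_BL]

theorem norm_remainder_sub (z₁ z₂ : H0 Binf) (x₁ x₂ : Xpm ι Binf) :
    ‖remainder ι A Binf z₁ x₁ - remainder ι A Binf z₂ x₂‖ =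
      ‖(fr.q (A (fr.e z₁ + x₁)) - fr.BL x₁) - (fr.q (A (fr.e z₂ + x₂)) - fr.BL x₂)‖ := by
  rw [fr.coe_remainder, fr.coe_remainder, ← Submodule.coe_sub]; rfl

theorem P0_add (z : H0 Binf) (x : Xpm ι Binf) : P0 Binf (ι (fr.e z + x)) = z := by
  rw [map_add, fr.ι_e, map_add, P0_of_mem z.2]
  have : P0 Binf (ι (x : X)) = 0 := P0_of_mem_Hpm x.2
  rw [this, add_zero]

theorem norm_le_e (hS : CondS ι) (z : H0 Binf) : ‖z‖ ≤ ‖fr.e z‖ := by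
  have := hS.2.2 (fr.e z)
  rwa [fr.ι_e] at this

/-- The radius beyond which the sup in the definition of `M(A)` is controlled. -/
theorem exists_radius (hS : CondS ι) {K : ℝ} (hK : 0 ≤ K) (hρ : ρ = ⊤ ∨ (MA ι A Binf < ⊤ ∧
    ENNReal.ofReal K * MA ι A Binf < ρ)) : ∃ R, ∀ z : H0 Binf, R ≤ ‖z‖ →
      ENNReal.ofReal (K * ‖fr.q (A (fr.e z))‖) < ρ := by
  rcases hρ with rfl | ⟨-, h⟩
  · exact ⟨0, fun _ _ => ENNReal.ofReal_lt_top⟩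
  rcases hK.eq_or_lt with rfl | hK0
  · exact ⟨0, fun _ _ => by simpa using bot_le.trans_lt h⟩
  have hK' : ENNReal.ofReal K ≠ 0 := by simpa using hK0
  have h1 : MA ι A Binf < ρ / ENNReal.ofReal K :=
    (ENNReal.lt_div_iff_mul_lt (Or.inl hK') (Or.inl ENNReal.ofReal_ne_top)).2 (by rwa [mul_comm])
  obtain ⟨R, hR⟩ := iInf_lt_iff.1 h1
  refine ⟨R, fun z hz => ?_⟩
  have h2 : ‖fr.q (A (fr.e z))‖ₑ < ρ / ENNReal.ofReal K := by
    refine lt_of_le_of_lt ?_ hR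
    have h3 : ‖fr.q (A (fr.e z))‖ₑ = ‖QX ι Binf (A (lift ι (z : H)))‖ₑ := by
      rw [fr.e_eq, ← fr.coe_q]; rfl
    rw [h3]
    refine le_iSup₂_of_le (f := fun (z : H0 Binf) (_ : R ≤ ‖lift ι (z : H)‖) =>
      ‖QX ι Binf (A (lift ι (z : H)))‖ₑ) z ?_ le_rfl
    rw [fr.e_eq]; exact hz.trans (fr.norm_le_e hS z)
  rw [ENNReal.ofReal_mul hK, ofReal_norm, mul_comm]
  exact (ENNReal.lt_div_iff_mul_lt (Or.inl hK') (Or.inl ENNReal.ofReal_ne_top)).1 h2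

end XFrame

/-! ### Solution of the equation on X^±. -/

namespace Setting

variable (st : Setting ι V L A B Binf a R₀)
include st

theorem mem_of_ext0 (hR : R₀ ≤ R) (fr : XFrame ι Binf) {z : H0 Binf} (hz : z ∈ ext0 Binf R)
    (x : Xpm ι Binf) : fr.e z + x ∈ ι ⁻¹' V :=
  st.mem_of_P0 (by rw [fr.P0_add]; exact lt_of_le_of_lt hR hz)

/-- The directional derivatives of `A` are linear. -/
theorem exists_linear_derivative : ∃ DA : X → X →ₗ[ℝ] X, ∀ x ∈ ι ⁻¹' V, ∀ u,
    DA x u = lineDeriv ℝ A x u := by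
  have : ∀ x, ∃ D : X →ₗ[ℝ] X, x ∈ ι ⁻¹' V → ∀ u, D u = lineDeriv ℝ A x u := by
    intro x
    by_cases hx : x ∈ ι ⁻¹' V
    · refine ⟨⟨⟨fun u => lineDeriv ℝ A x u, fun u v => st.S.1 ?_⟩, fun c u => st.S.1 ?_⟩,
        fun _ u => rfl⟩
      · rw [map_add, st.ι_lineDeriv hx, st.ι_lineDeriv hx, st.ι_lineDeriv hx, map_add, map_add]
      · simp only [RingHom.id_apply]
        rw [map_smul, st.ι_lineDeriv hx, st.ι_lineDeriv hx, map_smul, map_smul]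
    · exact ⟨0, fun h => absurd h hx⟩
  choose D hD using this
  exact ⟨D, hD⟩

/-- The contraction argument is applied to F(z, x) = (I - P⁰)A(z + x). A threshold valid for all
larger R allows R to be increased later for other purposes. -/
theorem exists_reduction (fr : XFrame ι Binf) (hE' : CondE' ι V A Binf ρ) : ∃ K, ∃ R₂ : ℝ, ∀ R,
    R₂ ≤ R → ∃ h T h', Reduction A fr ρ K R h T h' := by
  have := fr.complete
  have := st.saddle.finite_zero
  obtain ⟨R₁, -, κ, hκ, hρ, hlip⟩ := hE'
  have hC0 : 0 ≤ C1const ι Binf := C1const_nonneg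
  have hK : 0 ≤ κ / (κ - 1) * C1const ι Binf := by
    have : 0 < κ - 1 := by linarith
    positivity
  obtain ⟨R₃, hR₃⟩ := fr.exists_radius (A := A) st.S hK hρ
  refine ⟨κ / (κ - 1) * C1const ι Binf, max R₀ (max R₁ R₃), fun R hR => ?_⟩
  have hR0 : R₀ ≤ R := (le_max_left _ _).trans hR
  have hR1 : R₁ ≤ R := ((le_max_left _ _).trans (le_max_right _ _)).trans hR
  have hR3 : R₃ ≤ R := ((le_max_right _ _).trans (le_max_right _ _)).trans hR
  set F : H0 Binf → Xpm ι Binf → Xpm ι Binf := fun z x => fr.q (A (fr.e z + x))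
  have hF : ContinuousOn (fun p : H0 Binf × Xpm ι Binf => F p.1 p.2) (ext0 Binf R ×ˢ univ) := by
    refine fr.q.continuous.comp_continuousOn (st.F2.1.comp ?_ ?_)
    · exact ((fr.e.continuous.comp continuous_fst).add
        (continuous_subtype_val.comp continuous_snd)).continuousOn
    · exact fun p hp => st.mem_of_ext0 hR0 fr hp.1 _
  have hL : ∀ z ∈ ext0 Binf R, ∀ x₁ x₂, ‖x₁‖ₑ < ρ → ‖x₂‖ₑ < ρ →
      κ * C1const ι Binf * ‖(F z x₁ - fr.BL x₁) - (F z x₂ - fr.BL x₂)‖ ≤ ‖x₁ - x₂‖ := by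
    intro z hz x₁ x₂ h₁ h₂
    have hmem : ∀ x : Xpm ι Binf, (z : H) + ι x ∈ V := fun x => by
      have := st.mem_of_ext0 hR0 fr hz x
      rwa [mem_preimage, map_add, fr.ι_e] at this
    have := hlip z (hR1.trans hz.le) x₁ x₂ h₁ h₂ (hmem _) (hmem _)
    rwa [fr.norm_remainder_sub] at this
  have hsmall : ∀ z ∈ ext0 Binf R,
      ENNReal.ofReal (κ / (κ - 1) * C1const ι Binf * ‖F z 0‖) < ρ := by
    intro z hz
    have := hR₃ z (hR3.trans hz.le)
    simpa [F] using this
  obtain ⟨h, hhc, hh⟩ := exists_implicit hC0 fr.norm_le hκ hF hL hsmall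
  obtain ⟨DA, hDA⟩ := st.exists_linear_derivative
  set D : H0 Binf → Xpm ι Binf → (H0 Binf × Xpm ι Binf →ₗ[ℝ] Xpm ι Binf) := fun z x =>
    (fr.q : X →ₗ[ℝ] Xpm ι Binf) ∘ₗ DA (fr.e z + x) ∘ₗ
      ((fr.e : H0 Binf →ₗ[ℝ] X).coprod (Xpm ι Binf).subtype)
  have hDval : ∀ z ∈ ext0 Binf R, ∀ x ζ ξ, D z x (ζ, ξ) =
      fr.q (lineDeriv ℝ A (fr.e z + x) (fr.e ζ + ξ)) := by
    intro z hz x ζ ξ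
    rw [← hDA _ (st.mem_of_ext0 hR0 fr hz x)]
    rfl
  obtain ⟨T, h', hh'c, hT⟩ := implicit_hasFDerivAt (isOpen_ext0 (Binf := Binf) (R := R)) hC0
    fr.norm_le hκ hL (D := D) (fun z hz x ζ ξ => by
      rw [hDval z hz]
      have h1 := st.hasLineDerivAt_A (st.mem_of_ext0 hR0 fr hz x) (fr.e ζ + ξ)
      have h2 := fr.q.hasFDerivAt.comp_hasDerivAt (0 : ℝ) (show HasDerivAt _ _ _ from h1)
      refine h2.congr_of_eventuallyEq (Eventually.of_forall fun t => ?_)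
      simp only [F, Function.comp_apply, map_add, map_smul, Submodule.coe_add, Submodule.coe_smul]
      congr 2
      module)
    (fun ζ ξ => by
      have h1 : ContinuousOn (fun p : H0 Binf × Xpm ι Binf =>
          fr.q (lineDeriv ℝ A (fr.e p.1 + p.2) (fr.e ζ + ξ))) (ext0 Binf R ×ˢ univ) := by
        refine fr.q.continuous.comp_continuousOn ((st.F2.2.1 _).2.comp ?_ ?_)
        · exact ((fr.e.continuous.comp continuous_fst).add
            (continuous_subtype_val.comp continuous_snd)).continuousOn
        · exact fun p hp => st.mem_of_ext0 hR0 fr hp.1 _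
      exact h1.congr fun p hp => hDval p.1 hp.1 p.2 ζ ξ)
    hhc (fun z hz => ⟨(hh z hz).1, (hh z hz).2.1, (hh z hz).2.2.2⟩)
  refine ⟨h, T, h', hhc, fun z hz => (hh z hz).2.1, fun z hz => (hh z hz).1, fun z hz => ?_,
    fun z hz x hx hx0 => ?_, fun z hz ξ => ?_, fun z hz ζ => ?_, fun z hz => (hT z hz).2.2, hh'c⟩
  · have := (hh z hz).2.2.1
    simpa [F] using this
  · have h1 := (hh z hz).2.2.2 x hx
    have h2 : F z x = 0 := hx0
    rw [h2, norm_zero, mul_zero] at h1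
    exact sub_eq_zero.1 (norm_le_zero_iff.1 h1)
  · rw [(hT z hz).1, hDval z hz, map_zero, zero_add]
  · rw [(hT z hz).2.1, hDval z hz, Submodule.coe_zero, add_zero]

end Setting

/-! ### The reduced functional. -/

namespace Reduction

variable {fr : XFrame ι Binf} {K : ℝ} {h : H0 Binf → Xpm ι Binf}
  {T : H0 Binf → Xpm ι Binf ≃L[ℝ] Xpm ι Binf} {h' : H0 Binf → H0 Binf →L[ℝ] Xpm ι Binf}
  (rd : Reduction A fr ρ K R h T h') (st : Setting ι V L A B Binf a R₀) (hR : R₀ ≤ R)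

theorem graphPt_eq (fr : XFrame ι Binf) (h : H0 Binf → Xpm ι Binf) (z : H0 Binf) :
    graphPt ι Binf h z = fr.e z + h z := by rw [graphPt, fr.e_eq]

include rd

/-- The equation says that A(z + h(z)) equals its projection to H⁰, hence is orthogonal to H^±. -/
theorem critical {z : H0 Binf} (hz : z ∈ ext0 Binf R) {w : H} (hw : w ∈ Hpm Binf) :
    ⟪ι (A (fr.e z + h z)), w⟫_ℝ = 0 := by
  have h1 := fr.ι_q (A (fr.e z + h z))
  rw [rd.zero z hz, Submodule.coe_zero, map_zero] at h1
  rw [sub_eq_zero.1 h1.symm]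
  exact (Submodule.mem_orthogonal _ _).1 hw _ (P0_apply_mem _)

theorem contDiffOn : ContDiffOn ℝ 1 h (ext0 Binf R) :=
  contDiffOn_one_of_hasFDerivAt isOpen_ext0 rd.deriv rd.deriv_cont

theorem hasFDerivAt_graph {z : H0 Binf} (hz : z ∈ ext0 Binf R) :
    HasFDerivAt (fun z => fr.e z + h z) (fr.e + (Xpm ι Binf).subtypeL.comp (h' z)) z :=
  fr.e.hasFDerivAt.add ((Xpm ι Binf).subtypeL.hasFDerivAt.comp z (rd.deriv z hz))

theorem continuousOn_graph : ContinuousOn (fun z => fr.e z + (h z : X)) (ext0 Binf R) :=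
  fr.e.continuous.continuousOn.add (continuous_subtype_val.comp_continuousOn rd.cont)

include st hR

/-- In the topology of X the gradient A is continuous, so L ∘ ι is Fréchet differentiable on X. In
the chain rule the term with the derivative of h vanishes by `critical`. -/
theorem hasFDerivAt_reduced {z : H0 Binf} (hz : z ∈ ext0 Binf R) :
    HasFDerivAt (reduced ι L Binf h)
      ((innerSL ℝ (ι (A (fr.e z + h z)))).comp (H0 Binf).subtypeL) z := by
  have h1 := hasFDerivAt_of_hasLineDerivAt (f := fun x => L (ι x))
    (f' := fun x => (innerSL ℝ (ι (A x))).comp ι) (st.isOpen.preimage ι.continuous)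
    (fun x hx u => by simpa using st.hasLineDerivAt_L hx u)
    (((innerSL ℝ).continuous.comp_continuousOn
      (ι.continuous.comp_continuousOn st.F2.1)).clm_comp continuousOn_const)
    (st.mem_of_ext0 hR fr hz (h z))
  have h2 := h1.comp z (rd.hasFDerivAt_graph hz)
  have h3 : reduced ι L Binf h = (fun x => L (ι x)) ∘ fun z => fr.e z + (h z : X) := by
    funext y
    rw [reduced, graphPt_eq fr]; rfl
  rw [h3]
  refine h2.congr_fderiv ?_
  ext ζ
  have h4 := rd.critical hz (h' z ζ).2
  simp only [ContinuousLinearMap.comp_apply, add_apply, innerSL_apply_apply,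
    Submodule.subtypeL_apply, map_add, fr.ι_e]
  rw [show ⟪ι (A (fr.e z + h z)), ι (h' z ζ : X)⟫_ℝ = 0 from h4, add_zero]

theorem fderiv_reduced {z : H0 Binf} (hz : z ∈ ext0 Binf R) (ζ : H0 Binf) :
    fderiv ℝ (reduced ι L Binf h) z ζ = ⟪ι (A (fr.e z + h z)), (ζ : H)⟫_ℝ := by
  rw [(rd.hasFDerivAt_reduced st hR hz).fderiv]; rfl

theorem continuousOn_A_graph : ContinuousOn (fun z => A (fr.e z + h z)) (ext0 Binf R) :=
  st.F2.1.comp rd.continuousOn_graph fun _ hz => st.mem_of_ext0 hR fr hz _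

theorem contDiffOn_reduced : ContDiffOn ℝ 1 (reduced ι L Binf h) (ext0 Binf R) := by
  have := st.saddle.finite_zero
  refine contDiffOn_one_of_hasFDerivAt isOpen_ext0 (fun z hz => rd.hasFDerivAt_reduced st hR hz) ?_
  rw [continuousOn_clm_apply]
  intro ζ
  exact (ι.continuous.comp_continuousOn (rd.continuousOn_A_graph st hR)).inner continuousOn_const

/-- The derivative of h does not occur in dL^∞, so one derivative of A and of h suffices for two of
L^∞. -/
theorem contDiffOn_two_reduced (hA : ContDiffOn ℝ 1 A (ι ⁻¹' V)) :
    ContDiffOn ℝ 2 (reduced ι L Binf h) (ext0 Binf R) := by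
  have := st.saddle.finite_zero
  rw [show (2 : WithTop ℕ∞) = 1 + 1 by norm_num, contDiffOn_succ_iff_fderiv_of_isOpen isOpen_ext0]
  refine ⟨fun z hz => (rd.hasFDerivAt_reduced st hR hz).differentiableAt.differentiableWithinAt,
    by simp, ?_⟩
  rw [contDiffOn_clm_apply]
  intro ζ
  have h1 : ContDiffOn ℝ 1 (fun z => fr.e z + (h z : X)) (ext0 Binf R) :=
    fr.e.contDiff.contDiffOn.add
      ((Xpm ι Binf).subtypeL.contDiff.comp_contDiffOn rd.contDiffOn)
  have h2 : ContDiffOn ℝ 1 (fun z => A (fr.e z + h z)) (ext0 Binf R) :=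
    hA.comp h1 fun z hz => st.mem_of_ext0 hR fr hz _
  exact ((ι.contDiff.comp_contDiffOn h2).inner ℝ contDiffOn_const).congr fun z hz =>
    rd.fderiv_reduced st hR hz ζ

theorem lineDeriv_eq_fderiv (hA : ContDiffOn ℝ 1 A (ι ⁻¹' V)) {z : H0 Binf}
    (hz : z ∈ ext0 Binf R) (u : X) :
    lineDeriv ℝ A (fr.e z + h z) u = fderiv ℝ A (fr.e z + h z) u :=
  ((hA.differentiableOn one_ne_zero).differentiableAt
    ((st.isOpen.preimage ι.continuous).mem_nhds
      (st.mem_of_ext0 hR fr hz (h z)))).lineDeriv_eq_fderiv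

/-- Estimate of the derivative of `h` in the norm of `H`. -/
theorem norm_ι_deriv_le {z : H0 Binf} (hz : z ∈ ext0 Binf R) (ζ : H0 Binf) :
    a * ‖ι (h' z ζ)‖ ≤ ‖B (fr.e z + h z) (ζ : H)‖ := by
  have := st.saddle.finite_minus
  set x := fr.e z + (h z : X)
  have hxV : x ∈ ι ⁻¹' V := st.mem_of_ext0 hR fr hz (h z)
  have hxR : R₀ < ‖ι x‖ := st.norm_lt_of_P0 (by rw [fr.P0_add]; exact lt_of_le_of_lt hR hz)
  refine norm_le_of_saddle st.F3.2.1 (T := B x) (inner_map_comm (st.F3.1 x hxV))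
    (st.saddle.plus x hxR) (st.saddle.minus x hxR) (h' z ζ).2 (norm_nonneg _) fun y hy => ?_
  have hq : ∀ u : X, ⟪ι (fr.q u), y⟫_ℝ = ⟪ι u, y⟫_ℝ := fun u => by
    rw [fr.ι_q, inner_sub_left, (Submodule.mem_orthogonal _ _).1 hy _ (P0_apply_mem _), sub_zero]
  have h1 := rd.T_deriv z hz ζ
  rw [rd.T_apply z hz] at h1
  -- The differentiated equation, tested with y in H^±, reads ⟪B(x)h'ζ, y⟫ = -⟪B(x)ζ, y⟫.
  have h2 : ⟪ι (fr.q (lineDeriv ℝ A x (h' z ζ : X))), y⟫_ℝ =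
      -⟪ι (fr.q (lineDeriv ℝ A x (fr.e ζ))), y⟫_ℝ := by
    rw [h1, Submodule.coe_neg, map_neg, inner_neg_left]
  rw [hq, hq, st.ι_lineDeriv hxV, st.ι_lineDeriv hxV, fr.ι_e] at h2
  have h3 := neg_le_of_abs_le (abs_real_inner_le_norm (B x (ζ : H)) y)
  change ⟪B x (ι (h' z ζ : X)), y⟫_ℝ ≤ _
  linarith

end Reduction

end SplitInfty

namespace SplitInfty

/-! ### Strict derivatives at infinity. -/

section Exterior

variable {E F : Type*} [NormedAddCommGroup E] [NormedSpace ℝ E] [FiniteDimensional ℝ E]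
  [NormedAddCommGroup F] [NormedSpace ℝ F]

/-- If `f` is `ε`-Lipschitz along segments outside a large ball, for every `ε`, then `f` has the
strict derivative `0` at infinity. -/
theorem hasStrictFDerivAtInfty_zero {f : E → F} {R : ℝ} (hf : ContinuousOn f {z | R < ‖z‖})
    (h : ∀ ε > 0, ∃ R', R ≤ R' ∧ ∀ z₁ z₂, (∀ z ∈ segment ℝ z₁ z₂, R' < ‖z‖) →
      ‖f z₁ - f z₂‖ ≤ ε * ‖z₁ - z₂‖) :
    HasStrictFDerivAtInfty f 0 {z | R < ‖z‖} := by
  intro ε hε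
  obtain ⟨R', hRR', hR'⟩ := h (ε / 3) (by positivity)
  set S := max R' 0 + 1
  have hS : 0 < S := by positivity
  have hSR : R' < S := lt_of_le_of_lt (le_max_left _ _) (lt_add_one _)
  obtain ⟨c, hc⟩ := (isCompact_sphere (0 : E) S).exists_bound_of_continuousOn
    (hf.mono fun z hz => by
      rw [mem_sphere_zero_iff_norm] at hz
      exact (hRR'.trans_lt hSR).trans_eq hz.symm)
  -- The radial segment from the sphere of radius S out to z avoids the ball, so f grows at most
  -- linearly with slope ε/3.
  have hrad : ∀ z : E, S ≤ ‖z‖ → ‖f z‖ ≤ c + ε / 3 * ‖z‖ := by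
    intro z hz
    have hz0 : 0 < ‖z‖ := hS.trans_le hz
    set z' := (S / ‖z‖) • z
    have hz' : ‖z'‖ = S := by
      rw [norm_smul, Real.norm_of_nonneg (by positivity), div_mul_cancel₀ _ hz0.ne']
    have h1 := hR' z z' (by
      rintro w ⟨s, t, hs, ht, hst, rfl⟩
      have h2 : s • z + t • z' = (s + t * (S / ‖z‖)) • z := by simp only [z']; module
      rw [h2, norm_smul, Real.norm_of_nonneg (by positivity), add_mul, mul_assoc,
        div_mul_cancel₀ _ hz0.ne']
      refine hSR.trans_le ?_
      calc S = s * S + t * S := by rw [← add_mul, hst, one_mul]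
        _ ≤ s * ‖z‖ + t * S := by gcongr)
    have h2 : ‖z - z'‖ ≤ ‖z‖ := by
      have h3 : z - z' = (1 - S / ‖z‖) • z := by simp only [z']; module
      have h4 : S / ‖z‖ ≤ 1 := (div_le_one hz0).2 hz
      have h5 : 0 ≤ S / ‖z‖ := by positivity
      rw [h3, norm_smul, Real.norm_of_nonneg (by linarith)]
      exact mul_le_of_le_one_left hz0.le (by linarith)
    have h6 := hc z' (by rw [mem_sphere_zero_iff_norm, hz'])
    calc ‖f z‖ = ‖f z' + (f z - f z')‖ := by rw [add_sub_cancel]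
      _ ≤ ‖f z'‖ + ‖f z - f z'‖ := norm_add_le _ _
      _ ≤ c + ε / 3 * ‖z‖ := add_le_add h6 (h1.trans (by gcongr))
  -- If the segment meets the ball of radius R', then ‖z₁ - z₂‖ ≥ ‖z₁‖ + ‖z₂‖ - 2R', and the growth
  -- bound suffices. The radius makes c + εR' at most (2ε/3)‖zᵢ‖, the slack between the slopes ε/3
  -- and ε.
  refine ⟨max S (3 / (2 * ε) * (c + ε * R')), fun z₁ _ z₂ _ h₁ h₂ => ?_⟩
  simp only [zero_apply, sub_zero]
  by_cases hseg : ∀ z ∈ segment ℝ z₁ z₂, R' < ‖z‖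
  · exact (hR' z₁ z₂ hseg).trans (by gcongr; linarith)
  push Not at hseg
  obtain ⟨z, hz, hzR⟩ := hseg
  have h3 := dist_add_dist_of_mem_segment hz
  rw [dist_eq_norm, dist_eq_norm, dist_eq_norm] at h3
  have h4 : ‖z₁‖ - ‖z‖ ≤ ‖z₁ - z‖ := norm_sub_norm_le _ _
  have h5 : ‖z₂‖ - ‖z‖ ≤ ‖z - z₂‖ := by rw [norm_sub_rev]; exact norm_sub_norm_le _ _
  have h6 := hrad z₁ ((le_max_left _ _).trans h₁.le)
  have h7 := hrad z₂ ((le_max_left _ _).trans h₂.le)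
  have h8 := norm_sub_le (f z₁) (f z₂)
  have key : ∀ x, max S (3 / (2 * ε) * (c + ε * R')) < x → c + ε * R' ≤ 2 * ε / 3 * x := by
    intro x hx
    have := (le_max_right _ _).trans hx.le
    calc c + ε * R' = 2 * ε / 3 * (3 / (2 * ε) * (c + ε * R')) := by field_simp
      _ ≤ 2 * ε / 3 * x := by gcongr
  have h9 := key _ h₁
  have h10 := key _ h₂
  have h11 : ε * (‖z₁‖ + ‖z₂‖ - 2 * R') ≤ ε * ‖z₁ - z₂‖ := by
    gcongr; linarith
  linarith

end Exterior

variable {H X : Type*} [NormedAddCommGroup H] [InnerProductSpace ℝ H] [CompleteSpace H]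
  [NormedAddCommGroup X] [NormedSpace ℝ X] [CompleteSpace X]

variable {ι : X →L[ℝ] H} {V : Set H} {L : H → ℝ} {A : X → X} {B : X → H →L[ℝ] H}
  {Binf : H →L[ℝ] H} {a R₀ R : ℝ} {ρ : ℝ≥0∞}

namespace Reduction

variable {fr : XFrame ι Binf} {K : ℝ} {h : H0 Binf → Xpm ι Binf}
  {T : H0 Binf → Xpm ι Binf ≃L[ℝ] Xpm ι Binf} {h' : H0 Binf → H0 Binf →L[ℝ] Xpm ι Binf}
  (rd : Reduction A fr ρ K R h T h') (st : Setting ι V L A B Binf a R₀) (hR : R₀ ≤ R)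

theorem norm_lt_of_P0_eq {x : X} {z : H0 Binf} (hx : P0 Binf (ι x) = z) {R' : ℝ} (hz : R' < ‖z‖) :
    R' < ‖ι x‖ :=
  lt_of_lt_of_le (by rw [hx]; exact hz) (norm_P0_le (Binf := Binf) (ι x))

include rd st hR

theorem norm_ι_sub_le {c R' : ℝ} (hc0 : 0 ≤ c) (hRR' : R ≤ R')
    (hc : ∀ x, R' < ‖ι x‖ → ∀ z ∈ H0 Binf, ‖B x z‖ ≤ c * ‖z‖) {z₁ z₂ : H0 Binf}
    (hseg : ∀ z ∈ segment ℝ z₁ z₂, R' < ‖z‖) :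
    ‖ι (h z₁) - ι (h z₂)‖ ≤ c / a * ‖z₁ - z₂‖ := by
  have ha := st.saddle.a_pos
  have hmem : ∀ z ∈ segment ℝ z₁ z₂, z ∈ ext0 Binf R := fun z hz => hRR'.trans_lt (hseg z hz)
  set j : Xpm ι Binf →L[ℝ] H := ι.comp (Xpm ι Binf).subtypeL
  refine Convex.norm_image_sub_le_of_norm_hasFDerivWithin_le (𝕜 := ℝ) (f := fun z => j (h z))
    (f' := fun z => j.comp (h' z)) (fun z hz =>
      (j.hasFDerivAt.comp z (rd.deriv z (hmem z hz))).hasFDerivWithinAt)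
    (fun z hz => ContinuousLinearMap.opNorm_le_bound _ (by positivity) fun ζ => ?_)
    (convex_segment z₁ z₂) (right_mem_segment ℝ z₁ z₂) (left_mem_segment ℝ z₁ z₂)
  have h1 := rd.norm_ι_deriv_le st hR (hmem z hz) ζ
  have h2 := hc _ (norm_lt_of_P0_eq (fr.P0_add z (h z)) (hseg z hz)) ζ ζ.2
  rw [div_mul_eq_mul_div, le_div_iff₀ ha, mul_comm]
  exact h1.trans h2

/-- The difference of derivatives is ⟪A(g z₁) - A(g z₂), ζ⟫. Along the chord between the graph
points, whose component in H⁰ runs through the given segment, the mean value theorem gives B, and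
symmetry moves it onto ζ in H⁰, where it is small. No C¹ assumption on A is needed. -/
theorem norm_fderiv_reduced_sub_le {c R' : ℝ} (hc0 : 0 ≤ c) (hRR' : R ≤ R')
    (hc : ∀ x, R' < ‖ι x‖ → ∀ z ∈ H0 Binf, ‖B x z‖ ≤ c * ‖z‖) {z₁ z₂ : H0 Binf}
    (hseg : ∀ z ∈ segment ℝ z₁ z₂, R' < ‖z‖) :
    ‖fderiv ℝ (reduced ι L Binf h) z₁ - fderiv ℝ (reduced ι L Binf h) z₂‖ ≤
      c * (1 + c / a) * ‖z₁ - z₂‖ := by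
  have ha := st.saddle.a_pos
  have hmem : ∀ z ∈ segment ℝ z₁ z₂, z ∈ ext0 Binf R := fun z hz => hRR'.trans_lt (hseg z hz)
  refine ContinuousLinearMap.opNorm_le_bound _ (by positivity) fun ζ => ?_
  rw [sub_apply, rd.fderiv_reduced st hR (hmem _ (left_mem_segment ℝ z₁ z₂)),
    rd.fderiv_reduced st hR (hmem _ (right_mem_segment ℝ z₁ z₂))]
  set g : H0 Binf → X := fun z => fr.e z + h z
  have hg : ∀ z, P0 Binf (ι (g z)) = z := fun z => fr.P0_add z (h z)
  have hΔ : ‖ι (g z₁ - g z₂)‖ ≤ (1 + c / a) * ‖z₁ - z₂‖ := by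
    have h1 := rd.norm_ι_sub_le st hR hc0 hRR' hc hseg
    have h2 : ι (g z₁ - g z₂) = ((z₁ - z₂ : H0 Binf) : H) + (ι (h z₁) - ι (h z₂)) := by
      simp only [g, map_sub, map_add, fr.ι_e, Submodule.coe_sub]; abel
    rw [h2, add_mul, one_mul]
    exact (norm_add_le _ _).trans (add_le_add le_rfl h1)
  have hline : ∀ t ∈ Icc (0 : ℝ) 1, R' < ‖P0 Binf (ι (g z₂ + t • (g z₁ - g z₂)))‖ := by
    intro t ht
    have h1 : P0 Binf (ι (g z₂ + t • (g z₁ - g z₂))) =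
        ((t • z₁ + (1 - t) • z₂ : H0 Binf) : H) := by
      simp only [map_add, map_smul, map_sub, hg, Submodule.coe_add, Submodule.coe_smul]; module
    rw [h1]
    exact hseg _ ⟨t, 1 - t, ht.1, by linarith [ht.2], by ring, rfl⟩
  have hV : ∀ t ∈ Icc (0 : ℝ) 1, g z₂ + t • (g z₁ - g z₂) ∈ ι ⁻¹' V := fun t ht =>
    st.mem_of_P0 ((hR.trans hRR').trans_lt (hline t ht))
  obtain ⟨t, ht, hslope⟩ := exists_hasDerivAt_eq_slope
    (fun s : ℝ => ⟪ι (A (g z₂ + s • (g z₁ - g z₂))), (ζ : H)⟫_ℝ) _ one_pos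
    (fun s hs => (st.hasDerivAt_A (hV s hs) ζ).continuousAt.continuousWithinAt)
    fun s hs => st.hasDerivAt_A (hV s (Ioo_subset_Icc_self hs)) ζ
  simp only [one_smul, zero_smul, add_zero, sub_zero, div_one, add_sub_cancel] at hslope
  have ht' := Ioo_subset_Icc_self ht
  rw [← hslope, inner_map_comm (st.F3.1 _ (hV t ht'))]
  refine (abs_real_inner_le_norm _ _).trans ?_
  have h3 := hc _ ((hline t ht').trans_le (norm_P0_le _)) ζ ζ.2
  calc _ ≤ (1 + c / a) * ‖z₁ - z₂‖ * (c * ‖(ζ : H)‖) := by gcongr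
    _ = c * (1 + c / a) * ‖z₁ - z₂‖ * ‖ζ‖ := by change _ * (c * ‖ζ‖) = _; ring

theorem strict_ι : HasStrictFDerivAtInfty (fun z => ι (h z)) 0 (ext0 Binf R) := by
  have := st.saddle.finite_zero
  have ha := st.saddle.a_pos
  refine hasStrictFDerivAtInfty_zero
    (ι.continuous.comp_continuousOn (continuous_subtype_val.comp_continuousOn rd.cont))
    fun ε hε => ?_
  obtain ⟨R', hR'⟩ := st.saddle.small (a * ε) (by positivity)
  refine ⟨max R R', le_max_left _ _, fun z₁ z₂ hseg => ?_⟩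
  have := rd.norm_ι_sub_le st hR (c := a * ε) (by positivity) (le_max_left R R')
    (fun x hx => hR' x ((le_max_right _ _).trans_lt hx)) hseg
  rwa [mul_div_cancel_left₀ _ ha.ne'] at this

theorem strict_fderiv_reduced :
    HasStrictFDerivAtInfty (fderiv ℝ (reduced ι L Binf h)) 0 (ext0 Binf R) := by
  have := st.saddle.finite_zero
  have ha := st.saddle.a_pos
  refine hasStrictFDerivAtInfty_zero
    ((rd.contDiffOn_reduced st hR).continuousOn_fderiv_of_isOpen isOpen_ext0 le_rfl)
    fun ε hε => ?_
  -- With c = min a (ε/2) the factor c(1 + c/a) is at most ε.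
  have hc : 0 < min a (ε / 2) := lt_min ha (by positivity)
  obtain ⟨R', hR'⟩ := st.saddle.small _ hc
  refine ⟨max R R', le_max_left _ _, fun z₁ z₂ hseg => ?_⟩
  refine (rd.norm_fderiv_reduced_sub_le st hR hc.le (le_max_left R R')
    (fun x hx => hR' x ((le_max_right _ _).trans_lt hx)) hseg).trans ?_
  have h1 : min a (ε / 2) / a ≤ 1 := (div_le_one ha).2 (min_le_left _ _)
  have h2 : min a (ε / 2) ≤ ε / 2 := min_le_right _ _
  have h3 : min a (ε / 2) * (1 + min a (ε / 2) / a) ≤ ε := by nlinarith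
  gcongr

theorem isC2minus0On_reduced (hc : ∀ x, R < ‖ι x‖ → ∀ z ∈ H0 Binf, ‖B x z‖ ≤ 1 * ‖z‖) :
    IsC2minus0On (reduced ι L Binf h) (ext0 Binf R) := by
  have ha := st.saddle.a_pos
  refine ⟨rd.contDiffOn_reduced st hR, fun z hz => ?_⟩
  obtain ⟨δ, hδ, hball⟩ := Metric.isOpen_iff.1 (isOpen_ext0 (Binf := Binf) (R := R)) z hz
  refine ⟨(1 * (1 + 1 / a)).toNNReal, Metric.ball z δ,
    mem_nhdsWithin_of_mem_nhds (Metric.ball_mem_nhds z hδ), LipschitzOnWith.of_dist_le_mul ?_⟩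
  intro z₁ h₁ z₂ h₂
  rw [Real.coe_toNNReal _ (by positivity), dist_eq_norm, dist_eq_norm]
  exact rd.norm_fderiv_reduced_sub_le st hR zero_le_one le_rfl hc
    fun w hw => hball ((convex_ball z δ).segment_subset h₁ h₂ hw)

/-- At a solution the remainder is -B(∞)h(z), so differences of h are recovered through the inverse
of B(∞). -/
theorem norm_sub_le_remainder {z₁ z₂ : H0 Binf} (h₁ : z₁ ∈ ext0 Binf R) (h₂ : z₂ ∈ ext0 Binf R) :
    ‖h z₁ - h z₂‖ ≤
      C1const ι Binf * ‖remainder ι A Binf z₁ (h z₁) - remainder ι A Binf z₂ (h z₂)‖ := by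
  refine (fr.norm_le _).trans (mul_le_mul_of_nonneg_left (le_of_eq ?_) C1const_nonneg)
  rw [fr.norm_remainder_sub, rd.zero z₁ h₁, rd.zero z₂ h₂, zero_sub, zero_sub, ← norm_neg, map_sub]
  congr 1
  abel

theorem mem_V {z : H0 Binf} (hz : z ∈ ext0 Binf R) : (z : H) + ι (h z) ∈ V := by
  have := st.mem_of_ext0 hR fr hz (h z)
  rwa [mem_preimage, map_add, fr.ι_e] at this

theorem norm_graph_sub_le (z₁ z₂ : H0 Binf) :
    ‖lift ι (z₁ : H) + (h z₁ : X) - lift ι (z₂ : H) - (h z₂ : X)‖ ≤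
      ‖fr.e‖ * ‖z₁ - z₂‖ + ‖h z₁ - h z₂‖ := by
  rw [fr.e_eq, fr.e_eq, show fr.e z₁ + (h z₁ : X) - fr.e z₂ - (h z₂ : X) =
    fr.e (z₁ - z₂) + ((h z₁ - h z₂ : Xpm ι Binf) : X) by rw [map_sub, Submodule.coe_sub]; abel]
  exact (norm_add_le _ _).trans (add_le_add (fr.e.le_opNorm _) le_rfl)

/-- Condition (E) at the two graph points gives κ‖h z₁ - h z₂‖ ≤ ‖e‖‖z₁ - z₂‖ + ‖h z₁ - h z₂‖, and κ
> 1 absorbs the last term. -/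
theorem exists_lipschitzOnWith {R₁ κ : ℝ} (hR₁ : R₁ ≤ R) (hκ : 1 < κ)
    (hE : ∀ z₁ z₂ : H0 Binf, R₁ ≤ ‖z₁‖ → R₁ ≤ ‖z₂‖ → ∀ x₁ x₂ : Xpm ι Binf,
      ‖x₁‖ₑ < ρ → ‖x₂‖ₑ < ρ → (z₁ : H) + ι x₁ ∈ V → (z₂ : H) + ι x₂ ∈ V →
      κ * C1const ι Binf * ‖remainder ι A Binf z₁ x₁ - remainder ι A Binf z₂ x₂‖ ≤
        ‖lift ι (z₁ : H) + (x₁ : X) - lift ι (z₂ : H) - (x₂ : X)‖) :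
    ∃ K, LipschitzOnWith K h (ext0 Binf R) := by
  have hk : 0 < κ - 1 := by linarith
  refine ⟨(‖fr.e‖ / (κ - 1)).toNNReal, LipschitzOnWith.of_dist_le_mul fun z₁ h₁ z₂ h₂ => ?_⟩
  rw [Real.coe_toNNReal _ (by positivity), dist_eq_norm, dist_eq_norm, div_mul_eq_mul_div,
    le_div_iff₀ hk]
  have e1 := rd.norm_sub_le_remainder st hR h₁ h₂
  have e2 := hE z₁ z₂ (hR₁.trans (le_of_lt h₁)) (hR₁.trans (le_of_lt h₂)) _ _ (rd.lt _ h₁)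
    (rd.lt _ h₂) (rd.mem_V st hR h₁) (rd.mem_V st hR h₂)
  have e3 := rd.norm_graph_sub_le st hR z₁ z₂
  have e4 := mul_le_mul_of_nonneg_left e1 (by linarith : (0 : ℝ) ≤ κ)
  linarith

theorem strict_of_condSE (hSE : CondSE ι V A Binf ρ) :
    HasStrictFDerivAtInfty h 0 (ext0 Binf R) := by
  intro ε hε
  have hC0 : 0 ≤ C1const ι Binf := C1const_nonneg
  -- The bound 1/2 absorbs the difference of h on the left; the other bound leaves ε after the
  -- resulting factor 2.
  set η := min (1 / 2) (ε / (2 * (‖fr.e‖ + 1)))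
  have hη : 0 < η := lt_min (by norm_num) (by positivity)
  obtain ⟨R', hR'⟩ := hSE.2 (η / (C1const ι Binf + 1)) (by positivity)
  refine ⟨R', fun z₁ h₁ z₂ h₂ h₁' h₂' => ?_⟩
  simp only [zero_apply, sub_zero]
  have e1 := rd.norm_sub_le_remainder st hR h₁ h₂
  have e2 := hR' z₁ z₂ h₁' h₂' _ _ (rd.lt _ h₁)
    (rd.lt _ h₂) (rd.mem_V st hR h₁) (rd.mem_V st hR h₂)
  have e3 := rd.norm_graph_sub_le st hR z₁ z₂
  set G := ‖lift ι (z₁ : H) + (h z₁ : X) - lift ι (z₂ : H) - (h z₂ : X)‖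
  have e4 : ‖h z₁ - h z₂‖ ≤ η * G := by
    refine (e1.trans (mul_le_mul_of_nonneg_left e2 hC0)).trans ?_
    rw [← mul_assoc]
    refine mul_le_mul_of_nonneg_right ?_ (norm_nonneg _)
    rw [mul_div_assoc', div_le_iff₀ (by positivity)]
    nlinarith
  have e5 : η * G ≤ η * (‖fr.e‖ * ‖z₁ - z₂‖) + 1 / 2 * ‖h z₁ - h z₂‖ := by
    have h1 := mul_le_mul_of_nonneg_left e3 hη.le
    have h2 := mul_le_mul_of_nonneg_right (min_le_left (1 / 2) (ε / (2 * (‖fr.e‖ + 1))))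
      (norm_nonneg (h z₁ - h z₂))
    change η * _ ≤ _ at h2
    linarith
  have e6 : η * ‖fr.e‖ ≤ ε / 2 := by
    have h1 : η ≤ ε / (2 * (‖fr.e‖ + 1)) := min_le_right _ _
    calc η * ‖fr.e‖ ≤ ε / (2 * (‖fr.e‖ + 1)) * (‖fr.e‖ + 1) := by gcongr; linarith
      _ = ε / 2 := by field_simp
  have e7 := mul_le_mul_of_nonneg_right e6 (norm_nonneg (z₁ - z₂))
  linarith

theorem tendsto_zero (hM : MA ι A Binf = 0) : Tendsto (fun z : H0 Binf => ‖h z‖)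
    (comap (fun z : H0 Binf => ‖lift ι (z : H)‖) atTop) (𝓝 0) := by
  rw [Metric.tendsto_nhds]
  intro ε hε
  have h1 : MA ι A Binf < ENNReal.ofReal (ε / (|K| + 1)) := by
    rw [hM]; exact ENNReal.ofReal_pos.2 (by positivity)
  obtain ⟨R', hR'⟩ := iInf_lt_iff.1 h1
  -- A norm in X above ‖e‖R forces the norm in H above R, where h is controlled.
  filter_upwards [tendsto_comap.eventually (eventually_gt_atTop (max R' (‖fr.e‖ * R)))] with z hz
  have hzR : z ∈ ext0 Binf R := by
    by_contra! hcon
    have h2 : ‖z‖ ≤ R := not_lt.1 hcon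
    have h3 := (fr.e.le_opNorm z).trans (mul_le_mul_of_nonneg_left h2 (norm_nonneg _))
    rw [← fr.e_eq] at h3
    exact absurd ((le_max_right _ _).trans_lt hz) (not_lt.2 h3)
  have h4 : ‖fr.q (A (fr.e z))‖ₑ < ENNReal.ofReal (ε / (|K| + 1)) := by
    refine lt_of_le_of_lt ?_ hR'
    have h3 : ‖fr.q (A (fr.e z))‖ₑ = ‖QX ι Binf (A (lift ι (z : H)))‖ₑ := by
      rw [fr.e_eq, ← fr.coe_q]; rfl
    rw [h3]
    exact le_iSup₂_of_le (f := fun (z : H0 Binf) (_ : R' ≤ ‖lift ι (z : H)‖) =>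
      ‖QX ι Binf (A (lift ι (z : H)))‖ₑ) z ((le_max_left _ _).trans hz.le) le_rfl
  rw [← ofReal_norm, ENNReal.ofReal_lt_ofReal_iff (by positivity)] at h4
  rw [Real.dist_0_eq_abs, abs_norm]
  have h5 := rd.bound z hzR
  have h6 := mul_le_mul_of_nonneg_right (le_abs_self K) (norm_nonneg (fr.q (A (fr.e z))))
  rw [lt_div_iff₀ (by positivity)] at h4
  nlinarith [norm_nonneg (fr.q (A (fr.e z)))]

end Reduction

/-! ### Conditions (SE) and (E) from a strict derivative of A. -/

section StrictA

variable {ρ' : ℝ≥0∞} (fr : XFrame ι Binf) {T : X →L[ℝ] X}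

include fr in
-- Since B(∞) kills z, the remainder is (I - P⁰)(A - B(∞)) at z + x; moreover ‖z‖ is at most the
-- norm of z + x in X, so large z puts these points near infinity.
theorem condSE_of_strict (hS : CondS ι) (hT : ∀ x, ι (T x) = Binf (ι x))
    (hA : HasStrictFDerivAtInfty A T (ι ⁻¹' V))
    (hρ : ρ' = ⊤ ∨ (MA ι A Binf < ⊤ ∧ ENNReal.ofReal (C1const ι Binf) * MA ι A Binf < ρ')) :
    CondSE ι V A Binf ρ' := by
  refine ⟨hρ, fun ε hε => ?_⟩
  obtain ⟨R', hR'⟩ := hA (ε / (‖fr.q‖ + 1)) (by positivity)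
  refine ⟨R', fun z₁ z₂ h₁ h₂ x₁ x₂ _ _ hV₁ hV₂ => ?_⟩
  have hTg : ∀ (z : H0 Binf) (x : Xpm ι Binf), fr.q (T (fr.e z + x)) = fr.BL x := by
    intro z x
    have : T (fr.e z + x) = fr.BL x := hS.1 (by
      rw [hT, fr.ι_BL, map_add, map_add, fr.ι_e, mem_H0.1 z.2, zero_add])
    rw [this, fr.q_coe]
  have hn : ∀ (z : H0 Binf) (x : Xpm ι Binf), ‖z‖ ≤ ‖fr.e z + x‖ := fun z x => by
    have h1 := (norm_P0_le (Binf := Binf) (ι (fr.e z + x))).trans (hS.2.2 _)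
    rwa [fr.P0_add] at h1
  have h3 := hR' (fr.e z₁ + x₁) (by rwa [mem_preimage, map_add, fr.ι_e]) (fr.e z₂ + x₂)
    (by rwa [mem_preimage, map_add, fr.ι_e]) (h₁.trans_le (hn _ _)) (h₂.trans_le (hn _ _))
  rw [fr.norm_remainder_sub, fr.e_eq, fr.e_eq, ← hTg z₁ x₁, ← hTg z₂ x₂]
  have h4 : fr.q (A (fr.e z₁ + x₁)) - fr.q (T (fr.e z₁ + x₁)) -
      (fr.q (A (fr.e z₂ + x₂)) - fr.q (T (fr.e z₂ + x₂))) =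
      fr.q (A (fr.e z₁ + x₁) - A (fr.e z₂ + x₂) - T (fr.e z₁ + x₁ - (fr.e z₂ + x₂))) := by
    simp only [map_sub]; abel
  rw [h4, sub_sub (fr.e z₁ + (x₁ : X))]
  calc _ ≤ ‖fr.q‖ * _ := fr.q.le_opNorm _
    _ ≤ (‖fr.q‖ + 1) * (ε / (‖fr.q‖ + 1) * ‖fr.e z₁ + (x₁ : X) - (fr.e z₂ + x₂)‖) := by
        gcongr; linarith
    _ = _ := by field_simp

theorem CondSE.condE (h : CondSE ι V A Binf ρ') : CondE ι V A Binf ρ' := by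
  obtain ⟨hρ, hSE⟩ := h
  have hC0 : 0 ≤ C1const ι Binf := C1const_nonneg
  obtain ⟨κ, hκ, hρκ⟩ : ∃ κ > 1, ρ' = ⊤ ∨ (MA ι A Binf < ⊤ ∧
      ENNReal.ofReal (κ / (κ - 1) * C1const ι Binf) * MA ι A Binf < ρ') := by
    by_cases htop : ρ' = ⊤
    · exact ⟨2, by norm_num, Or.inl htop⟩
    obtain ⟨hM, hlt⟩ := hρ.resolve_left htop
    set m := (MA ι A Binf).toReal
    have hm0 : 0 ≤ m := ENNReal.toReal_nonneg
    have hm : MA ι A Binf = ENNReal.ofReal m := (ENNReal.ofReal_toReal hM.ne).symm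
    have hr : ρ' = ENNReal.ofReal ρ'.toReal := (ENNReal.ofReal_toReal htop).symm
    have hpos : 0 < ρ'.toReal := ENNReal.toReal_pos (bot_le.trans_lt hlt).ne' htop
    rw [hm, hr, ← ENNReal.ofReal_mul hC0, ENNReal.ofReal_lt_ofReal_iff hpos] at hlt
    set p := C1const ι Binf * m
    have hp : 0 ≤ p := by positivity
    -- With κ = 1 + 1/δ one has κ/(κ - 1) = 1 + δ, and this δ gives (1 + δ)p < ρ'.
    set δ := (ρ'.toReal - p) / (p + 1)
    have hδ : 0 < δ := div_pos (by linarith) (by linarith)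
    refine ⟨1 + 1 / δ, by have : 0 < 1 / δ := by positivity
                          linarith, Or.inr ⟨hM, ?_⟩⟩
    have h1 : (1 + 1 / δ) / (1 + 1 / δ - 1) = 1 + δ := by field_simp; ring
    rw [h1, hm, hr, ← ENNReal.ofReal_mul (by positivity), ENNReal.ofReal_lt_ofReal_iff hpos]
    have h2 : δ * (p + 1) = ρ'.toReal - p := div_mul_cancel₀ _ (by linarith)
    have h3 : (1 + δ) * C1const ι Binf * m = p + δ * p := by simp only [p]; ring
    rw [h3]
    linarith
  obtain ⟨R', hR'⟩ := hSE (1 / (κ * C1const ι Binf + 1)) (by positivity)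
  refine ⟨max R' 0 + 1, by positivity, κ, hκ, hρκ, fun z₁ z₂ h₁ h₂ x₁ x₂ hx₁ hx₂ hV₁ hV₂ => ?_⟩
  have hl : R' < max R' 0 + 1 := lt_of_le_of_lt (le_max_left _ _) (lt_add_one _)
  have h3 := hR' z₁ z₂ (hl.trans_le h₁) (hl.trans_le h₂) x₁ x₂ hx₁ hx₂ hV₁ hV₂
  rw [div_mul_eq_mul_div, one_mul, le_div_iff₀ (by positivity)] at h3
  linarith [norm_nonneg (remainder ι A Binf z₁ x₁ - remainder ι A Binf z₂ x₂)]

end StrictA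

end SplitInfty

namespace SplitInfty

/-! ### Coordinates on the exterior region. -/

section Charts

variable {H : Type*} [NormedAddCommGroup H] [InnerProductSpace ℝ H] [CompleteSpace H]
  {Binf : H →L[ℝ] H} {R : ℝ}

/-- The points whose component in `H⁰` lies outside the ball of radius `R`. -/
def outer (Binf : H →L[ℝ] H) (R : ℝ) : Set H := {w | R < ‖P0 Binf w‖}

theorem isOpen_outer : IsOpen (outer Binf R) :=
  isOpen_lt continuous_const (P0 Binf).continuous.norm

/-- The component of `w` in `H⁰`. -/
noncomputable def prZero (Binf : H →L[ℝ] H) : H →L[ℝ] H0 Binf := (H0 Binf).orthogonalProjectionOnto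

/-- The component of `w` in `H⁺`. -/
noncomputable def prPlus (Binf : H →L[ℝ] H) : H →L[ℝ] Hplus Binf := (Hplus Binf).orthogonalProjectionOnto

/-- The component of `w` in `H⁻`. -/
noncomputable def prMinus (Binf : H →L[ℝ] H) [FiniteDimensional ℝ (Hminus Binf)] : H →L[ℝ] Hminus Binf :=
  (Hminus Binf).orthogonalProjectionOnto

theorem coe_prZero (w : H) : (prZero Binf w : H) = P0 Binf w := rfl

theorem prZero_add (z : H0 Binf) {w : H} (hw : w ∈ Hpm Binf) : prZero Binf (z + w) = z := by
  apply Subtype.ext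
  rw [coe_prZero, P0_add_of_mem_Hpm _ hw, P0_of_mem z.2]

theorem prPlus_add (z : H0 Binf) (u : Hplus Binf) (v : Hminus Binf) :
    prPlus Binf (z + u + v) = u := by
  have h0 : prPlus Binf z = 0 := Submodule.orthogonalProjectionOnto_eq_zero_iff.2
    ((Submodule.mem_orthogonal' _ _).2 fun w hw => inner_H0_Hplus z.2 hw)
  have h1 : prPlus Binf v = 0 := Submodule.orthogonalProjectionOnto_eq_zero_iff.2
    ((Submodule.mem_orthogonal' _ _).2 fun w hw => inner_Hminus_Hplus v.2 hw)
  have h2 : prPlus Binf u = u := Submodule.orthogonalProjectionOnto_mem_subspace_eq_self u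
  rw [map_add, map_add, h0, h1, h2, zero_add, add_zero]

variable [FiniteDimensional ℝ (Hminus Binf)]

theorem prMinus_add (hB : IsSelfAdjoint Binf) (z : H0 Binf) (u : Hplus Binf) (v : Hminus Binf) :
    prMinus Binf (z + u + v) = v := by
  have h0 : prMinus Binf z = 0 := Submodule.orthogonalProjectionOnto_eq_zero_iff.2
    ((Submodule.mem_orthogonal' _ _).2 fun w hw => inner_H0_Hminus hB z.2 hw)
  have h1 : prMinus Binf u = 0 := Submodule.orthogonalProjectionOnto_eq_zero_iff.2
    ((Submodule.mem_orthogonal _ _).2 fun w hw => inner_Hminus_Hplus hw u.2)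
  have h2 : prMinus Binf v = v := Submodule.orthogonalProjectionOnto_mem_subspace_eq_self v
  rw [map_add, map_add, h0, h1, h2, zero_add, zero_add]

theorem add_mem_Hpm (hB : IsSelfAdjoint Binf) (u : Hplus Binf) (v : Hminus Binf) :
    (u + v : H) ∈ Hpm Binf :=
  add_mem (Hplus_le_Hpm u.2) (Hminus_le_Hpm hB v.2)

theorem prZero_add_prPlus_add_prMinus (hB : IsSelfAdjoint Binf) (w : H) :
    (prZero Binf w + prPlus Binf w + prMinus Binf w : H) = w := by
  obtain ⟨u, hu, v, hv, huv⟩ := exists_add_of_mem_Hpm hB (sub_P0_mem (Binf := Binf) w)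
  lift u to Hplus Binf using hu
  lift v to Hminus Binf using hv
  have h : w = (prZero Binf w : H) + u + v := by
    rw [add_assoc, huv, coe_prZero, add_sub_cancel]
  have h1 := prPlus_add (prZero Binf w) u v
  have h2 := prMinus_add hB (prZero Binf w) u v
  rw [← h] at h1 h2
  rw [h1, h2, ← h]

/-- The coordinates `(z, u, v) ↦ z + g z + u + v` on the exterior region, for a map `g` with values
in `H^±`. -/
noncomputable def graphChart (hB : IsSelfAdjoint Binf) {g : H0 Binf → H} (hg : ContinuousOn g (ext0 Binf R))
    (hgm : ∀ z, g z ∈ Hpm Binf) :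
    ext0 Binf R × Hplus Binf × Hminus Binf ≃ₜ outer Binf R where
  toFun p := ⟨(p.1 : H0 Binf) + g p.1 + p.2.1 + p.2.2, by
    have h : P0 Binf ((p.1 : H0 Binf) + g p.1 + p.2.1 + p.2.2) = (p.1 : H0 Binf) := by
      rw [add_assoc, add_assoc, P0_add_of_mem_Hpm _ (add_mem (hgm _) (add_mem_Hpm hB _ _)),
        P0_of_mem (Subtype.mem _)]
    change R < ‖P0 Binf _‖
    rw [h]
    exact p.1.2⟩
  invFun w := (⟨prZero Binf w, w.2⟩, prPlus Binf (w - g (prZero Binf w)),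
    prMinus Binf (w - g (prZero Binf w)))
  left_inv p := by
    obtain ⟨⟨z, hz⟩, u, v⟩ := p
    have h : prZero Binf (z + g z + u + v) = z := by
      rw [add_assoc, add_assoc, prZero_add _ (add_mem (hgm _) (add_mem_Hpm hB _ _))]
    have h1 : (z + g z + u + v - g z : H) = z + u + v := by abel
    simp only [h, h1, prPlus_add, prMinus_add hB]
  right_inv w := by
    apply Subtype.ext
    set g₀ := g (prZero Binf w)
    have h1 := prZero_add_prPlus_add_prMinus hB ((w : H) - g₀)
    have h2 : prZero Binf ((w : H) - g₀) = prZero Binf w := by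
      apply Subtype.ext
      rw [coe_prZero, coe_prZero, map_sub, P0_of_mem_Hpm (hgm _), sub_zero]
    rw [h2] at h1
    change (prZero Binf w : H) + g₀ + prPlus Binf (w - g₀) + prMinus Binf (w - g₀) = w
    rw [add_right_comm (prZero Binf w : H) g₀, add_right_comm _ g₀, h1, sub_add_cancel]
  continuous_toFun := by
    have h : Continuous fun z : ext0 Binf R => g z := continuousOn_iff_continuous_domRestrict.1 hg
    exact ((((continuous_subtype_val.comp continuous_subtype_val).add h).comp
      continuous_fst).add (continuous_subtype_val.comp (continuous_fst.comp continuous_snd))).add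
        (continuous_subtype_val.comp (continuous_snd.comp continuous_snd)) |>.subtype_mk _
  continuous_invFun := by
    have h : Continuous fun w : outer Binf R => g (prZero Binf w) :=
      hg.comp_continuous ((prZero Binf).continuous.comp continuous_subtype_val) fun w => w.2
    refine Continuous.prodMk ?_ (Continuous.prodMk ?_ ?_)
    · exact ((prZero Binf).continuous.comp continuous_subtype_val).subtype_mk _
    · exact (prPlus Binf).continuous.comp (continuous_subtype_val.sub h)
    · exact (prMinus Binf).continuous.comp (continuous_subtype_val.sub h)

/-- A fibre preserving homeomorphism, read in the coordinates `z + u + v` at the source and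
`z + g z + u + v` at the target. -/
theorem exists_fibered_homeomorph (hB : IsSelfAdjoint Binf) {g : H0 Binf → H}
    (hg : ContinuousOn g (ext0 Binf R)) (hgm : ∀ z, g z ∈ Hpm Binf) (hne : (ext0 Binf R).Nonempty)
    (Ψ : ext0 Binf R × Hplus Binf × Hminus Binf ≃ₜ ext0 Binf R × Hplus Binf × Hminus Binf)
    (hΨ : ∀ p, (Ψ p).1 = p.1) : ∃ Φ : OpenPartialHomeomorph H H,
      Φ.source = outer Binf R ∧ Φ.target = outer Binf R ∧
      ∀ p : ext0 Binf R × Hplus Binf × Hminus Binf,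
        Φ ((p.1 : H0 Binf) + p.2.1 + p.2.2) =
          (p.1 : H0 Binf) + g p.1 + (Ψ p).2.1 + (Ψ p).2.2 := by
  set G := graphChart hB hg hgm
  -- The source chart uses the zero section, the target chart the graph of g; conjugating Ψ by them
  -- gives Φ.
  set G₀ := graphChart (R := R) hB (g := fun _ => (0 : H)) continuousOn_const
    fun _ => zero_mem (Hpm Binf)
  set U : TopologicalSpace.Opens H := ⟨outer Binf R, isOpen_outer⟩
  obtain ⟨z₀, hz₀⟩ := hne
  have : Nonempty U := ⟨G (⟨z₀, hz₀⟩, 0, 0)⟩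
  set Θ : U ≃ₜ U := G₀.symm.trans (Ψ.trans G)
  set j := U.openPartialHomeomorphSubtypeCoe this
  set Φ := j.symm.trans (Θ.toOpenPartialHomeomorph.trans j)
  have hval : ∀ w : U, Φ w = Θ w := by
    intro w
    have : j.symm w = w := j.left_inv (x := w) (by simp [j])
    simp only [Φ, OpenPartialHomeomorph.coe_trans, Function.comp_apply, this]
    rfl
  refine ⟨Φ, by simp [Φ, j, U], by simp [Φ, j, U], fun p => ?_⟩
  have h1 : ((p.1 : H0 Binf) + p.2.1 + p.2.2 : H) = (G₀ p : H) := by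
    change _ = ((p.1 : H0 Binf) : H) + 0 + p.2.1 + p.2.2
    rw [add_zero]
  rw [h1]
  refine (hval (G₀ p)).trans ?_
  have h2 : Θ (G₀ p) = G (Ψ p) := by simp [Θ]
  rw [h2, ← hΨ p]
  rfl

end Charts

end SplitInfty

namespace SplitInfty

/-! ### Tubes around H⁰ and the normal form. -/

section Tubes

variable {H : Type*} [NormedAddCommGroup H] [InnerProductSpace ℝ H] [CompleteSpace H]
  {Binf : H →L[ℝ] H} {R : ℝ} [FiniteDimensional ℝ (Hminus Binf)] {δ : ℝ≥0∞}

theorem norm_prPlus_le (w : H) : ‖prPlus Binf w‖ ≤ ‖w‖ :=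
  Submodule.norm_orthogonalProjectionOnto_apply_le _ _

theorem norm_prMinus_le (w : H) : ‖prMinus Binf w‖ ≤ ‖w‖ :=
  Submodule.norm_orthogonalProjectionOnto_apply_le _ _

theorem add_mem_tube {z : H0 Binf} {u : Hplus Binf} {v : Hminus Binf} (hz : z ∈ ext0 Binf R)
    (hu : ‖u‖ₑ < δ) (hv : ‖v‖ₑ < δ) : (z + u + v : H) ∈ tube Binf R δ :=
  ⟨z, z.2, u, u.2, v, v.2, hz, hu, hv, rfl⟩

theorem tube_subset_outer (hB : IsSelfAdjoint Binf) : tube Binf R δ ⊆ outer Binf R := by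
  rintro _ ⟨z, hz, u, hu, v, hv, hzR, -, -, rfl⟩
  have h := prZero_add ⟨z, hz⟩ (add_mem_Hpm hB ⟨u, hu⟩ ⟨v, hv⟩)
  change R < ‖(prZero Binf (z + u + v) : H)‖
  rw [add_assoc, h]
  exact hzR

theorem tube_eq (hB : IsSelfAdjoint Binf) : tube Binf R δ =
    outer Binf R ∩ ({w | ‖prPlus Binf w‖ₑ < δ} ∩ {w | ‖prMinus Binf w‖ₑ < δ}) := by
  refine Subset.antisymm (fun w hw => ⟨tube_subset_outer hB hw, ?_⟩) fun w hw => ?_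
  · obtain ⟨z, hz, u, hu, v, hv, -, hu', hv', rfl⟩ := hw
    have h1 := prPlus_add ⟨z, hz⟩ ⟨u, hu⟩ ⟨v, hv⟩
    have h2 := prMinus_add hB ⟨z, hz⟩ ⟨u, hu⟩ ⟨v, hv⟩
    rw [mem_inter_iff, mem_ofPred_eq, mem_ofPred_eq]
    rw [h1, h2]
    exact ⟨hu', hv'⟩
  · rw [← prZero_add_prPlus_add_prMinus hB w]
    exact add_mem_tube hw.1 hw.2.1 hw.2.2

theorem isOpen_tube (hB : IsSelfAdjoint Binf) : IsOpen (tube Binf R δ) := by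
  rw [tube_eq hB]
  exact isOpen_outer.inter ((isOpen_lt (prPlus Binf).continuous.enorm continuous_const).inter
    (isOpen_lt (prMinus Binf).continuous.enorm continuous_const))

theorem tubeMinus_subset_tube (hδ : 0 < δ) : tubeMinus Binf R δ ⊆ tube Binf R δ := by
  rintro _ ⟨z, hz, v, hv, hzR, hv', rfl⟩
  exact ⟨z, hz, 0, zero_mem _, v, hv, hzR, by simpa using hδ, hv', by rw [add_zero]⟩

end Tubes

variable {H X : Type*} [NormedAddCommGroup H] [InnerProductSpace ℝ H] [CompleteSpace H]
  [NormedAddCommGroup X] [NormedSpace ℝ X] [CompleteSpace X]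

variable {ι : X →L[ℝ] H} {V : Set H} {L : H → ℝ} {A : X → X} {B : X → H →L[ℝ] H}
  {Binf : H →L[ℝ] H} {a R₀ R : ℝ} {ρ : ℝ≥0∞}

/-- A Morse type normal form of `L` near the graph of `h`, defined on the whole exterior region. -/
structure NormalForm (ι : X →L[ℝ] H) (L : H → ℝ) (Binf : H →L[ℝ] H) (R c : ℝ)
    (h : H0 Binf → Xpm ι Binf) (Φ : OpenPartialHomeomorph H H) : Prop where
  pos : 0 < c
  source : Φ.source = outer Binf R
  apply : ∀ z ∈ ext0 Binf R, ∀ (u : Hplus Binf) (v : Hminus Binf),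
    ∃ (s : ℝ) (v' : Hminus Binf), 0 < s ∧ Φ (z + u + v) = z + ι (h z) + s • u + v' ∧
      ‖s • u‖ ≤ c * ‖u‖ ∧ ‖v'‖ ≤ c * (‖u‖ + ‖v‖) ∧
      L (z + ι (h z) + s • u + v') = ‖u‖ ^ 2 - ‖v‖ ^ 2 + L (z + ι (h z))

namespace Reduction

variable {fr : XFrame ι Binf} {K : ℝ} {h : H0 Binf → Xpm ι Binf}
  {T : H0 Binf → Xpm ι Binf ≃L[ℝ] Xpm ι Binf} {h' : H0 Binf → H0 Binf →L[ℝ] Xpm ι Binf}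
  (rd : Reduction A fr ρ K R h T h') (st : Setting ι V L A B Binf a R₀) (hR : R₀ ≤ R)

include rd st hR

theorem exists_normalForm (hne : (ext0 Binf R).Nonempty) :
    ∃ c Φ, NormalForm ι L Binf R c h Φ := by
  have := st.saddle.finite_zero
  have := st.saddle.finite_minus
  have hB : IsSelfAdjoint Binf := st.F3.2.1
  have ha := st.saddle.a_pos
  set g : H0 Binf → H := fun z => ι (h z)
  have hgm : ∀ z, g z ∈ Hpm Binf := fun z => (h z).2
  have hg : ContinuousOn g (ext0 Binf R) :=
    ι.continuous.comp_continuousOn (continuous_subtype_val.comp_continuousOn rd.cont)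
  have hP : ∀ (z : ext0 Binf R) {w : H}, w ∈ Hpm Binf →
      R₀ < ‖P0 Binf ((z : H0 Binf) + g z + w)‖ := by
    intro z w hw
    rw [add_assoc, P0_add_of_mem_Hpm _ (add_mem (hgm z) hw), P0_of_mem (z : H0 Binf).2]
    exact hR.trans_lt z.2
  have hbase : ∀ z : ext0 Binf R, ((z : H0 Binf) + g z : H) = ι (fr.e z + h z) := fun z => by
    rw [map_add, fr.ι_e]
  have hP' : ∀ z : ext0 Binf R, R₀ < ‖P0 Binf (ι (fr.e z + h z))‖ := fun z => by
    simpa [hbase] using hP z (zero_mem _)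
  have hcrit : ∀ (z : ext0 Binf R), ∀ w ∈ Hpm Binf, ⟪ι (A (fr.e z + h z)), w⟫_ℝ = 0 :=
    fun z w hw => rd.critical z.2 hw
  obtain ⟨Ψ, hΨ⟩ := exists_morse_homeomorph
    (fun (z : ext0 Binf R) (u : Hplus Binf) (v : Hminus Binf) => L ((z : H0 Binf) + g z + u + v))
    (by
      refine st.F1.1.comp_continuous ?_ fun p => st.mem_of_P0 ?_
      · have h : Continuous fun z : ext0 Binf R => g z :=
          continuousOn_iff_continuous_domRestrict.1 hg
        exact ((((continuous_subtype_val.comp continuous_subtype_val).add h).comp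
          continuous_fst).add (continuous_subtype_val.comp (continuous_fst.comp
            continuous_snd))).add (continuous_subtype_val.comp (continuous_snd.comp continuous_snd))
      · rw [add_assoc]
        exact hP p.1 (add_mem_Hpm hB _ _))
    (half_pos ha) zero_le_one
    (fun z u v s h0 h1 => by
      have := st.convex_plus (hP z (Hminus_le_Hpm hB v.2)) u.2 h0 h1
      simp only [Submodule.coe_smul, Submodule.coe_zero, add_zero]
      rwa [add_right_comm, add_right_comm _ (u : H)])
    (fun z u => by
      have := st.growth_plus (hP' z) (hcrit z) u.2
      simp only [Submodule.coe_zero, add_zero, hbase]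
      exact this)
    (fun z u p q s h0 h1 => by
      have := st.concave_minus (hP z (add_mem_Hpm hB u q)) (p - q).2 h0 h1
      rw [Submodule.coe_sub] at this
      have e1 : ((z : H0 Binf) + g z + (u + q) + (p - q) : H) = (z : H0 Binf) + g z + u + p := by
        abel
      have e2 : ((z : H0 Binf) + g z + (u + q) + s • ((p : H) - q) : H) =
          (z : H0 Binf) + g z + u + (s • p + (1 - s) • q : Hminus Binf) := by
        rw [Submodule.coe_add, Submodule.coe_smul, Submodule.coe_smul]; module
      rw [e1, e2, ← add_assoc] at this
      exact this)
    (fun z v => by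
      have := st.max_minus (hP' z) (hcrit z) v.2
      simpa only [Submodule.coe_zero, add_zero, hbase] using this)
    (fun z u v => by
      have := st.cross_plus_minus (hP' z) u.2 v.2
      simp only [Submodule.coe_zero, add_zero, hbase, one_mul]
      exact this)
  obtain ⟨Φ, hs, -, hΦ⟩ := exists_fibered_homeomorph hB hg hgm hne Ψ
    fun p => (hΨ p.1 p.2.1 p.2.2).1
  set k := a / 2
  have hk : 0 < k := half_pos ha
  have hsq : ∀ {x y : ℝ}, 0 ≤ x → 0 ≤ y → k * x ^ 2 ≤ y ^ 2 → x ≤ 1 / √k * y := by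
    intro x y hx hy hxy
    have h1 : 0 < √k := Real.sqrt_pos.2 hk
    rw [one_div, ← div_eq_inv_mul, le_div_iff₀ h1]
    refine abs_le_of_sq_le_sq' ?_ hy |>.2
    rw [mul_pow, Real.sq_sqrt hk.le]
    linarith
  have h1 : 0 < 1 / √k := by have := Real.sqrt_pos.2 hk; positivity
  have h2 : 0 ≤ 1 / √k / k := by positivity
  -- The Morse bounds give ‖s u‖ and ‖v' - w‖ at most 1/√k times ‖u‖ and ‖v‖, and ‖w‖ ≤ ‖s u‖/k; c
  -- is the sum of the two constants.
  refine ⟨1 / √k + 1 / √k / k, Φ, by positivity, hs, fun z hz u v => ?_⟩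
  obtain ⟨-, ⟨s, hs0, hsu⟩, hL, hu, w, hw, hwu⟩ := hΨ ⟨z, hz⟩ u v
  have hv := hΦ (⟨z, hz⟩, u, v)
  set q := Ψ (⟨z, hz⟩, u, v)
  rw [hsu] at hu hwu hL hv
  simp only [Submodule.coe_smul, Submodule.coe_zero, add_zero] at hL hv
  have b1 := hsq (norm_nonneg _) (norm_nonneg _) hu
  have b2 := hsq (norm_nonneg _) (norm_nonneg _) hw
  have b3 : ‖w‖ ≤ 1 / √k / k * ‖u‖ := by
    rw [div_mul_eq_mul_div, le_div_iff₀ hk, mul_comm]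
    linarith
  refine ⟨s, q.2.2, hs0, hv, b1.trans ?_, ?_, hL⟩
  · exact mul_le_mul_of_nonneg_right (by linarith) (norm_nonneg _)
  · have b4 : ‖q.2.2‖ ≤ ‖q.2.2 - w‖ + ‖w‖ := by
      simpa using norm_add_le (q.2.2 - w) w
    have b5 := mul_nonneg h1.le (norm_nonneg u)
    have b6 := mul_nonneg h2 (norm_nonneg v)
    linarith

end Reduction

end SplitInfty

namespace SplitInfty

variable {H X : Type*} [NormedAddCommGroup H] [InnerProductSpace ℝ H] [CompleteSpace H]
  [NormedAddCommGroup X] [NormedSpace ℝ X] [CompleteSpace X]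

variable {ι : X →L[ℝ] H} {V : Set H} {L : H → ℝ} {A : X → X} {B : X → H →L[ℝ] H}
  {Binf : H →L[ℝ] H} {a R₀ R c δ r : ℝ} {ρ : ℝ≥0∞}

theorem norm_lt_of_enorm_lt {E : Type*} [SeminormedAddCommGroup E] {x : E} {δ : ℝ}
    (hx : ‖x‖ₑ < ENNReal.ofReal δ) : ‖x‖ < δ := by
  rw [← ofReal_norm] at hx
  exact (ENNReal.ofReal_lt_ofReal_iff_of_nonneg (norm_nonneg x)).1 hx

theorem enorm_add_lt {E : Type*} [SeminormedAddCommGroup E] {x y : E} {r m : ℝ} (hx : ‖x‖ ≤ r)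
    (hy : ‖y‖ ≤ m) (hm : ENNReal.ofReal m < ρ) : ‖x + y‖ₑ < ENNReal.ofReal r + ρ := by
  rw [← ofReal_norm]
  calc ENNReal.ofReal ‖x + y‖ ≤ ENNReal.ofReal (r + m) :=
        ENNReal.ofReal_le_ofReal ((norm_add_le x y).trans (add_le_add hx hy))
    _ ≤ ENNReal.ofReal r + ENNReal.ofReal m := ENNReal.ofReal_add_le
    _ < ENNReal.ofReal r + ρ := ENNReal.add_lt_add_left ENNReal.ofReal_ne_top hm

namespace NormalForm

variable {h : H0 Binf → Xpm ι Binf} {Φ : OpenPartialHomeomorph H H}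
  (nf : NormalForm ι L Binf R c h Φ)

include nf

theorem apply_zero {z : H0 Binf} (hz : z ∈ ext0 Binf R) : Φ z = z + ι (h z) := by
  obtain ⟨s, v', hs, hΦ, -, hv, -⟩ := nf.apply z hz 0 0
  have : v' = 0 := by simpa using hv
  simpa [this] using hΦ

/-- The component in H⁺ is only rescaled, so it stays in X when w is in X; the other components lie
in X in any case. -/
theorem apply_mem_range (hz0 : ∀ u ∈ H0 Binf, u ∈ range ι) (hm : ∀ u ∈ Hminus Binf, u ∈ range ι)
    {w : H} (hw : w ∈ tube Binf R (ENNReal.ofReal δ)) (hwX : w ∈ range ι) : Φ w ∈ range ι := by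
  obtain ⟨z, hz, u, hu, v, hv, hzR, -, -, rfl⟩ := hw
  obtain ⟨s, v', -, hΦ, -⟩ := nf.apply ⟨z, hz⟩ hzR ⟨u, hu⟩ ⟨v, hv⟩
  obtain ⟨x, hx⟩ := hwX
  obtain ⟨xz, rfl⟩ := hz0 z hz
  obtain ⟨xv, rfl⟩ := hm v hv
  obtain ⟨xv', hxv'⟩ := hm v' v'.2
  refine ⟨xz + h ⟨ι xz, hz⟩ + s • (x - xz - xv) + xv', ?_⟩
  refine Eq.trans ?_ hΦ.symm
  simp only [map_add, map_smul, map_sub, hx, hxv']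
  congr 3
  abel

variable [FiniteDimensional ℝ (Hminus Binf)]

/-- The components of h(z) in H⁺ and H⁻ have norm below ρ, and the Morse part contributes at most
c(δ + δ) ≤ r to each. -/
theorem apply_mem_tube (hδ : 0 < δ) (hcδ : c * (δ + δ) ≤ r) (hS : CondS ι) {z : H0 Binf}
    (hz : z ∈ ext0 Binf R) (hh : ‖h z‖ₑ < ρ) {u : Hplus Binf} {v : Hminus Binf}
    (hu : ‖u‖ < δ) (hv : ‖v‖ < δ) (hB : IsSelfAdjoint Binf) :
    Φ (z + u + v) ∈ tube Binf R (ENNReal.ofReal r + ρ) := by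
  obtain ⟨s, v', -, hΦ, hu', hv', -⟩ := nf.apply z hz u v
  have hc := nf.pos
  set g : H := ι (h z)
  have hP : P0 Binf g = 0 := P0_of_mem_Hpm (h z).2
  have hg : (prPlus Binf g + prMinus Binf g : H) = g := by
    have := prZero_add_prPlus_add_prMinus hB g
    rwa [coe_prZero, hP, zero_add] at this
  have hgρ : ENNReal.ofReal ‖g‖ < ρ := by
    refine lt_of_le_of_lt ?_ hh
    rw [← ofReal_norm]
    exact ENNReal.ofReal_le_ofReal (hS.2.2 _)
  have e : Φ (z + u + v) = z + ((s • u + prPlus Binf g : Hplus Binf) : H) +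
      ((v' + prMinus Binf g : Hminus Binf) : H) := by
    rw [hΦ, Submodule.coe_add, Submodule.coe_add, Submodule.coe_smul]
    nth_rewrite 1 [← hg]
    abel
  rw [e]
  refine add_mem_tube hz (enorm_add_lt ?_ (norm_prPlus_le g) hgρ)
    (enorm_add_lt ?_ (norm_prMinus_le g) hgρ)
  · refine hu'.trans (le_trans ?_ hcδ)
    gcongr
    linarith
  · refine hv'.trans (le_trans ?_ hcδ)
    gcongr

/-- D lies in the finite-dimensional H⁰ ⊕ H⁻, where the topologies of H and X agree. The image
points have the form z + h(z) + v' with v' in H⁻, so continuity into X follows from that of h; after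
composition with ι the map is an embedding, hence it is one itself. -/
theorem isEmbedding_lift (hB : IsSelfAdjoint Binf) (fr : XFrame ι Binf) (hι : Function.Injective ι)
    (hfin : FiniteDimensional ℝ (H0 Binf))
    (hz0 : ∀ u ∈ H0 Binf, u ∈ range ι) (hm : ∀ u ∈ Hminus Binf, u ∈ range ι)
    (hh : ContinuousOn h (ext0 Binf R)) {D : Set H}
    (hD : ∀ w ∈ D, ∃ z ∈ ext0 Binf R, ∃ v : Hminus Binf, w = z + v)
    (hemb : IsEmbedding fun w : D => Φ w) :
    IsEmbedding fun w : (ι ⁻¹' D : Set X) => lift ι (Φ (ι (w : X))) := by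
  obtain ⟨eM, heM⟩ := exists_lift_clm hι (Hminus Binf) hm
  obtain ⟨eN, heN⟩ := exists_lift_clm hι (H0 Binf ⊔ Hminus Binf) fun u hu => by
    obtain ⟨y, hy, y', hy', rfl⟩ := Submodule.mem_sup.1 hu
    obtain ⟨x, rfl⟩ := hz0 y hy
    obtain ⟨x', rfl⟩ := hm y' hy'
    exact ⟨x + x', map_add _ _ _⟩
  have hpr : ∀ w ∈ D, prZero Binf w ∈ ext0 Binf R := by
    intro w hw
    obtain ⟨z, hz, v, rfl⟩ := hD w hw
    rwa [prZero_add z (Hminus_le_Hpm hB v.2)]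
  have hΦD : ∀ w ∈ D, Φ w = ι (fr.e (prZero Binf w) + h (prZero Binf w) +
      eM (prMinus Binf (Φ w - ι (h (prZero Binf w))))) := by
    intro w hw
    obtain ⟨z, hz, v, rfl⟩ := hD w hw
    obtain ⟨s, v', -, hΦ, -⟩ := nf.apply z hz 0 v
    simp only [Submodule.coe_zero, add_zero, smul_zero] at hΦ
    have h1 := prMinus_add hB z 0 v'
    rw [Submodule.coe_zero, add_zero] at h1
    rw [prZero_add z (Hminus_le_Hpm hB v.2), hΦ, map_add, map_add, fr.ι_e,
      show (z : H) + ι (h z) + v' - ι (h z) = z + v' by abel, h1, (heM v').2]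
  have hιD : IsEmbedding fun w : (ι ⁻¹' D : Set X) => (⟨ι w, w.2⟩ : D) := by
    have hN : ∀ w : D, (w : H) ∈ H0 Binf ⊔ Hminus Binf := fun w => by
      obtain ⟨z, -, v, hzv⟩ := hD w w.2
      rw [hzv]
      exact Submodule.add_mem_sup z.2 v.2
    refine IsEmbedding.of_comp (g := fun w : D => eN ⟨w, hN w⟩)
      ((ι.continuous.comp continuous_subtype_val).subtype_mk _)
      (eN.continuous.comp (continuous_subtype_val.subtype_mk hN)) ?_
    have h1 : ((fun w : D => eN ⟨w, hN w⟩) ∘ fun w : (ι ⁻¹' D : Set X) => (⟨ι w, w.2⟩ : D)) =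
        Subtype.val := funext fun w => hι (heN _).2
    rw [h1]
    exact IsEmbedding.subtypeVal
  have hcomp : (fun w : (ι ⁻¹' D : Set X) => ι (lift ι (Φ (ι (w : X))))) =
      (fun w : D => Φ w) ∘ fun w : (ι ⁻¹' D : Set X) => (⟨ι w, w.2⟩ : D) :=
    funext fun w => apply_lift ⟨_, (hΦD _ w.2).symm⟩
  refine IsEmbedding.of_comp ?_ ι.continuous ?_
  · have hc : Continuous fun w : (ι ⁻¹' D : Set X) => fr.e (prZero Binf (ι w)) +
        (h (prZero Binf (ι w)) : X) +
        eM (prMinus Binf (Φ (ι w) - ι (h (prZero Binf (ι w))))) := by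
      have h0 : Continuous fun w : (ι ⁻¹' D : Set X) => prZero Binf (ι w) :=
        (prZero Binf).continuous.comp (ι.continuous.comp continuous_subtype_val)
      have h1 : Continuous fun w : (ι ⁻¹' D : Set X) => (h (prZero Binf (ι w)) : X) :=
        continuous_subtype_val.comp (hh.comp_continuous h0 fun w => hpr _ w.2)
      exact ((fr.e.continuous.comp h0).add h1).add (eM.continuous.comp
        ((prMinus Binf).continuous.comp
          ((hemb.continuous.comp hιD.continuous).sub (ι.continuous.comp h1))))
    refine hc.congr fun w => ?_
    exact (lift_eq hι (hΦD _ w.2).symm).symm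
  · change IsEmbedding fun w : (ι ⁻¹' D : Set X) => ι (lift ι (Φ (ι (w : X))))
    rw [hcomp]
    exact hemb.comp hιD

end NormalForm

/-- The conclusions on the homeomorphism in a tube around `H⁰`. -/
theorem NormalForm.exists_restriction {h : H0 Binf → Xpm ι Binf} {Φ₀ : OpenPartialHomeomorph H H}
    (nf : NormalForm ι L Binf R c h Φ₀) {K : ℝ} {fr : XFrame ι Binf}
    {T : H0 Binf → Xpm ι Binf ≃L[ℝ] Xpm ι Binf} {h' : H0 Binf → H0 Binf →L[ℝ] Xpm ι Binf}
    (rd : Reduction A fr ρ K R h T h') (st : Setting ι V L A B Binf a R₀) (hr : 0 < r) :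
    ∃ δ > 0, ∃ W : Set H, ∃ Φ : OpenPartialHomeomorph H H, ∃ φ : H0 Binf → H → H,
      IsOpen W ∧ W ⊆ closure (tube Binf R (ENNReal.ofReal r + ρ)) ∧
      Φ.source = tube Binf R (ENNReal.ofReal δ) ∧ Φ.target = W ∧
      (∀ z ∈ ext0 Binf R, ∀ u ∈ Hplus Binf, ∀ v ∈ Hminus Binf, ‖u‖ < δ → ‖v‖ < δ →
        Φ ((z : H) + u + v) = (z : H) + ι (h z) + φ z (u + v) ∧
        φ z (u + v) ∈ Hpm Binf ∧
        L (Φ ((z : H) + u + v)) = ‖u‖ ^ 2 - ‖v‖ ^ 2 + L ((z : H) + ι (h z))) ∧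
      (∀ w ∈ tube Binf R (ENNReal.ofReal δ), w ∈ range ι → Φ w ∈ range ι) ∧
      (∀ z ∈ ext0 Binf R, Φ (z : H) = (z : H) + ι (h z) ∧
        ∀ u ∈ Hplus Binf, ∀ v ∈ Hminus Binf, ‖u‖ < δ → ‖v‖ < δ →
          (φ z (u + v) ∈ Hminus Binf ↔ u = 0)) ∧
      (tubeMinus Binf R (ENNReal.ofReal δ) ⊆ range ι ∧
        IsEmbedding (fun w : tubeMinus Binf R (ENNReal.ofReal δ) => Φ (w : H)) ∧
        IsEmbedding (fun w : (ι ⁻¹' tubeMinus Binf R (ENNReal.ofReal δ) : Set X) =>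
          lift ι (Φ (ι (w : X))))) := by
  have := st.saddle.finite_zero
  have := st.saddle.finite_minus
  have hB : IsSelfAdjoint Binf := st.F3.2.1
  have hc := nf.pos
  -- Chosen so that c(δ + δ) = r, which keeps the image in the tube of radius r + ρ.
  set δ := r / (2 * c)
  have hδ : 0 < δ := by positivity
  have hcδ : c * (δ + δ) = r := by simp only [δ]; field_simp; norm_num
  have htube : IsOpen (tube Binf R (ENNReal.ofReal δ)) := isOpen_tube hB
  set Φ := Φ₀.restrOpen _ htube
  have hΦ : ∀ w, Φ w = Φ₀ w := fun w => rfl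
  have hsource : Φ.source = tube Binf R (ENNReal.ofReal δ) := by
    rw [Φ₀.restrOpen_source, nf.source]
    exact inter_eq_right.2 (tube_subset_outer hB)
  set φ : H0 Binf → H → H := fun z w => Φ₀ (z + w) - (z + ι (h z))
  have happly : ∀ z ∈ ext0 Binf R, ∀ u ∈ Hplus Binf, ∀ v ∈ Hminus Binf,
      ∃ s > (0 : ℝ), ∃ v' ∈ Hminus Binf, Φ₀ (z + u + v) = z + ι (h z) + φ z (u + v) ∧
        φ z (u + v) = s • u + v' ∧
        L (Φ₀ (z + u + v)) = ‖u‖ ^ 2 - ‖v‖ ^ 2 + L (z + ι (h z)) := by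
    intro z hz u hu v hv
    obtain ⟨s, v', hs, e1, -, -, e2⟩ := nf.apply z hz ⟨u, hu⟩ ⟨v, hv⟩
    refine ⟨s, hs, v', v'.2, by simp only [φ]; rw [← add_assoc]; abel, ?_, ?_⟩
    · simp only [φ]
      rw [← add_assoc, e1, add_assoc _ (s • _) (v' : H), add_sub_cancel_left]
    · rw [e1, e2]
      rfl
  refine ⟨δ, hδ, Φ.target, Φ, φ, Φ.open_target, ?_, hsource, rfl, ?_, ?_, ?_, ?_, ?_⟩
  · intro y hy
    refine subset_closure ?_
    have h1 := Φ.map_target hy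
    rw [← Φ.right_inv hy, hΦ]
    rw [hsource] at h1
    obtain ⟨z, hz, u, hu, v, hv, hzR, hu', hv', h2⟩ := h1
    rw [h2]
    exact nf.apply_mem_tube (u := ⟨u, hu⟩) (v := ⟨v, hv⟩) (z := ⟨z, hz⟩) hδ hcδ.le st.S hzR
      (rd.lt _ hzR) (norm_lt_of_enorm_lt hu') (norm_lt_of_enorm_lt hv') hB
  · intro z hz u hu v hv _ _
    obtain ⟨s, hs, v', hv', e1, e2, e3⟩ := happly z hz u hu v hv
    refine ⟨e1, ?_, e3⟩
    rw [e2]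
    exact add_mem (Hplus_le_Hpm (Submodule.smul_mem _ s hu)) (Hminus_le_Hpm hB hv')
  · exact fun w hw hwX => nf.apply_mem_range st.saddle.zero_range st.saddle.minus_range hw hwX
  · intro z hz
    refine ⟨nf.apply_zero hz, fun u hu v hv _ _ => ?_⟩
    obtain ⟨s, hs, v', hv', -, e2, -⟩ := happly z hz u hu v hv
    rw [e2]
    constructor
    · intro hm
      have h1 : s • u ∈ Hminus Binf := by simpa using sub_mem hm hv'
      have h2 : u ∈ Hminus Binf := by
        simpa [smul_smul, hs.ne'] using Submodule.smul_mem _ s⁻¹ h1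
      exact inner_self_eq_zero.1 (inner_Hminus_Hplus h2 hu)
    · rintro rfl
      simpa using hv'
  · rintro _ ⟨z, hz, v, hv, -, -, rfl⟩
    obtain ⟨x, rfl⟩ := st.saddle.zero_range z hz
    obtain ⟨y, rfl⟩ := st.saddle.minus_range v hv
    exact ⟨x + y, map_add _ _ _⟩
  · have hsub : tubeMinus Binf R (ENNReal.ofReal δ) ⊆ Φ.source := by
      rw [hsource]
      exact tubeMinus_subset_tube (ENNReal.ofReal_pos.2 hδ)
    have hemb : IsEmbedding fun w : tubeMinus Binf R (ENNReal.ofReal δ) => Φ w :=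
      Φ.isOpenEmbedding_restrict.isEmbedding.comp (IsEmbedding.inclusion hsub)
    refine ⟨hemb, nf.isEmbedding_lift hB fr st.S.1 st.saddle.finite_zero st.saddle.zero_range
      st.saddle.minus_range rd.cont ?_ hemb⟩
    rintro _ ⟨z, hz, v, hv, hzR, -, rfl⟩
    exact ⟨⟨z, hz⟩, hzR, ⟨v, hv⟩, rfl⟩

end SplitInfty

/-! ### Assembly of the theorem. -/

open SplitInfty in
theorem theorem1p3 {H X : Type*} [NormedAddCommGroup H] [InnerProductSpace ℝ H] [CompleteSpace H]
    [NormedAddCommGroup X] [NormedSpace ℝ X] [CompleteSpace X]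
    (ι : X →L[ℝ] H) (V : Set H) (L : H → ℝ) (A : X → X) (B : X → H →L[ℝ] H) (Binf : H →L[ℝ] H)
    (hS : CondS ι) (hV : IsOpenNhdInfty V)
    (hF1 : CondF1 V L) (hF2 : CondF2 ι V L A) (hF3 : CondF3 ι V A B Binf)
    (hC1 : CondC1 Binf) (hC2 : CondC2 ι Binf) (hD : CondD ι V B Binf)
    (hν : H0 Binf ≠ ⊥)
    (ρ : ℝ≥0∞) (hE' : CondE' ι V A Binf ρ)
    (r : ℝ) (hr : 0 < r) :
    ∃ R > 0, ∃ δ > 0, ∃ h : H0 Binf → Xpm ι Binf, ∃ W : Set H,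
      ∃ Φ : OpenPartialHomeomorph H H, ∃ φ : H0 Binf → H → H,
      -- everything below takes place inside the domains of `L` and `A`
      (∀ u : H, R < ‖u‖ → u ∈ V) ∧
      -- the map `h`: continuity, range, equation, uniqueness
      ContinuousOn h (ext0 Binf R) ∧
      (∀ z ∈ ext0 Binf R, ‖h z‖ₑ ≤ ρ) ∧
      (∀ z ∈ ext0 Binf R, QX ι Binf (A (graphPt ι Binf h z)) = 0) ∧
      (∀ z ∈ ext0 Binf R, ∀ x : Xpm ι Binf, ‖x‖ₑ ≤ ρ →
        QX ι Binf (A (lift ι (z : H) + x)) = 0 → x = h z) ∧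
      -- the homeomorphism `Φ` from `C_{R,δ}` onto the open set `W`
      IsOpen W ∧ W ⊆ closure (tube Binf R (ENNReal.ofReal r + ρ)) ∧
      Φ.source = tube Binf R (ENNReal.ofReal δ) ∧ Φ.target = W ∧
      (∀ z ∈ ext0 Binf R, ∀ u ∈ Hplus Binf, ∀ v ∈ Hminus Binf, ‖u‖ < δ → ‖v‖ < δ →
        Φ ((z : H) + u + v) = (z : H) + ι (h z) + φ z (u + v) ∧
        φ z (u + v) ∈ Hpm Binf ∧
        L (Φ ((z : H) + u + v)) = ‖u‖ ^ 2 - ‖v‖ ^ 2 + L ((z : H) + ι (h z))) ∧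
      (∀ w ∈ tube Binf R (ENNReal.ofReal δ), w ∈ range ι → Φ w ∈ range ι) ∧
      -- (a)
      (∀ z ∈ ext0 Binf R, Φ (z : H) = (z : H) + ι (h z) ∧
        ∀ u ∈ Hplus Binf, ∀ v ∈ Hminus Binf, ‖u‖ < δ → ‖v‖ < δ →
          (φ z (u + v) ∈ Hminus Binf ↔ u = 0)) ∧
      -- (b)
      (tubeMinus Binf R (ENNReal.ofReal δ) ⊆ range ι ∧
        IsEmbedding (fun w : tubeMinus Binf R (ENNReal.ofReal δ) => Φ (w : H)) ∧
        IsEmbedding (fun w : (ι ⁻¹' tubeMinus Binf R (ENNReal.ofReal δ) : Set X) =>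
          lift ι (Φ (ι (w : X))))) ∧
      -- (i)
      (MA ι A Binf = 0 →
        Tendsto (fun z : H0 Binf => ‖h z‖)
          (comap (fun z : H0 Binf => ‖lift ι (z : H)‖) atTop) (𝓝 0)) ∧
      -- (ii)
      (ContDiffOn ℝ 1 A (ι ⁻¹' V) →
        ContDiffOn ℝ 1 h (ext0 Binf R) ∧
        (∀ z ∈ ext0 Binf R, ∃ T : Xpm ι Binf ≃L[ℝ] Xpm ι Binf,
          (∀ x : Xpm ι Binf,
            (T x : X) = QX ι Binf (fderiv ℝ A (graphPt ι Binf h z) (x : X))) ∧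
          ∀ ζ : H0 Binf, ∃ y : Xpm ι Binf,
            (y : X) = QX ι Binf (fderiv ℝ A (graphPt ι Binf h z) (lift ι (ζ : H))) ∧
            fderiv ℝ h z ζ = - T.symm y) ∧
        ContDiffOn ℝ 2 (reduced ι L Binf h) (ext0 Binf R) ∧
        ∀ z ∈ ext0 Binf R, ∀ ζ : H0 Binf,
          fderiv ℝ (reduced ι L Binf h) z ζ = ⟪ι (A (graphPt ι Binf h z)), (ζ : H)⟫_ℝ) ∧
      -- (iii)
      (ContDiffOn ℝ 2 L V →
        ContDiffOn ℝ 1 (fun z => ι (h z)) (ext0 Binf R) ∧ ContDiffOn ℝ 1 h (ext0 Binf R)) ∧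
      -- (iv)--(vi)
      (CondE ι V A Binf ρ →
        -- (iv)
        ((∃ K, LipschitzOnWith K h (ext0 Binf R)) ∧
          HasStrictFDerivAtInfty (fun z => ι (h z)) 0 (ext0 Binf R) ∧
          (CondSE ι V A Binf ρ → HasStrictFDerivAtInfty h 0 (ext0 Binf R))) ∧
        -- (v)
        (ContDiffOn ℝ 1 (reduced ι L Binf h) (ext0 Binf R) ∧
          ∀ z ∈ ext0 Binf R, ∀ ζ : H0 Binf,
            fderiv ℝ (reduced ι L Binf h) z ζ = ⟪ι (A (graphPt ι Binf h z)), (ζ : H)⟫_ℝ) ∧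
        -- (vi)
        (∀ T : X →L[ℝ] X, (∀ x, ι (T x) = Binf (ι x)) →
          HasStrictFDerivAtInfty A T (ι ⁻¹' V) →
          IsC2minus0On (reduced ι L Binf h) (ext0 Binf R) ∧
          HasStrictFDerivAtInfty (fderiv ℝ (reduced ι L Binf h)) 0 (ext0 Binf R) ∧
          ∀ ρ' : ℝ≥0∞, (ρ' = ⊤ ∨ (MA ι A Binf < ⊤ ∧
            ENNReal.ofReal (C1const ι Binf) * MA ι A Binf < ρ')) →
            CondSE ι V A Binf ρ' ∧ CondE ι V A Binf ρ')) := by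
  obtain ⟨a, R₀, hs⟩ := exists_saddleAtInfty hV hF3 hC2 hD hν
  obtain ⟨fr⟩ := exists_xFrame hS.1 hF3.2.1 hF3.2.2.1 hC2 hs
  have st : Setting ι V L A B Binf a R₀ := ⟨hS, hV.1, hF1, hF2, hF3, hs⟩
  obtain ⟨K, R₂, hred⟩ := st.exists_reduction fr hE'
  obtain ⟨R₃, hR₃⟩ := hs.small 1 one_pos
  -- R must be fixed before it is known whether (E) holds, so its radius is extracted beforehand,
  -- with 0 as default. R₃ serves the Lipschitz bound on dL^∞.
  obtain ⟨R₄, hR₄⟩ : ∃ R₄, CondE ι V A Binf ρ → ∃ κ > 1, ∀ z₁ z₂ : H0 Binf, R₄ ≤ ‖z₁‖ →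
      R₄ ≤ ‖z₂‖ → ∀ x₁ x₂ : Xpm ι Binf,
      ‖x₁‖ₑ < ρ → ‖x₂‖ₑ < ρ → (z₁ : H) + ι x₁ ∈ V → (z₂ : H) + ι x₂ ∈ V →
      κ * C1const ι Binf * ‖remainder ι A Binf z₁ x₁ - remainder ι A Binf z₂ x₂‖ ≤
        ‖lift ι (z₁ : H) + (x₁ : X) - lift ι (z₂ : H) - (x₂ : X)‖ := by
    by_cases hE : CondE ι V A Binf ρ
    · obtain ⟨R₄, -, κ, hκ, -, h⟩ := hE
      exact ⟨R₄, fun _ => ⟨κ, hκ, h⟩⟩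
    · exact ⟨0, fun h => absurd h hE⟩
  set R := max (max R₀ R₂) (max R₃ R₄)
  have hR0 : R₀ ≤ R := (le_max_left _ _).trans (le_max_left _ _)
  have hR2 : R₂ ≤ R := (le_max_right _ _).trans (le_max_left _ _)
  have hR3 : R₃ ≤ R := (le_max_left _ _).trans (le_max_right _ _)
  have hR4 : R₄ ≤ R := (le_max_right _ _).trans (le_max_right _ _)
  obtain ⟨h, T, h', rd⟩ := hred R hR2
  have hne : (ext0 Binf R).Nonempty := by
    have := Submodule.nontrivial_iff_ne_bot.2 hν
    exact NormedSpace.exists_lt_norm ℝ (H0 Binf) R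
  obtain ⟨c, Φ₀, nf⟩ := rd.exists_normalForm st hR0 hne
  obtain ⟨δ, hδ, W, Φ, φ, hW, hWt, hsource, htarget, hform, hX, ha, hb⟩ :=
    nf.exists_restriction rd st hr
  have hgraph : ∀ z, graphPt ι Binf h z = fr.e z + h z := Reduction.graphPt_eq fr h
  have hdL : ∀ z ∈ ext0 Binf R, ∀ ζ : H0 Binf,
      fderiv ℝ (reduced ι L Binf h) z ζ = ⟪ι (A (graphPt ι Binf h z)), (ζ : H)⟫_ℝ := by
    intro z hz ζ
    rw [hgraph]
    exact rd.fderiv_reduced st hR0 hz ζ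
  refine ⟨R, hs.R_pos.trans_le hR0, δ, hδ, h, W, Φ, φ, fun u hu => hs.mem u (hR0.trans_lt hu),
    rd.cont, fun z hz => (rd.lt z hz).le, fun z hz => ?_, fun z hz x hx hx0 => ?_, hW, hWt,
    hsource, htarget, hform, hX, ha, hb, rd.tendsto_zero st hR0, fun hA => ?_, fun _ => ?_,
    fun hE => ⟨⟨?_, rd.strict_ι st hR0, rd.strict_of_condSE st hR0⟩,
      ⟨rd.contDiffOn_reduced st hR0, hdL⟩, fun T' hT' hAT => ?_⟩⟩
  · rw [hgraph, ← fr.coe_q, rd.zero z hz, Submodule.coe_zero]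
  · refine rd.unique z hz x hx (Subtype.ext ?_)
    rw [fr.coe_q, ← fr.e_eq, hx0, Submodule.coe_zero]
  · refine ⟨rd.contDiffOn, fun z hz => ⟨T z, fun x => ?_, fun ζ =>
      ⟨fr.q (fderiv ℝ A (graphPt ι Binf h z) (lift ι (ζ : H))), fr.coe_q _, ?_⟩⟩,
      rd.contDiffOn_two_reduced st hR0 hA, hdL⟩
    · rw [rd.T_apply z hz, fr.coe_q, rd.lineDeriv_eq_fderiv st hR0 hA hz, hgraph]
    · rw [(rd.deriv z hz).fderiv, ← map_neg, ContinuousLinearEquiv.eq_symm_apply,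
        rd.T_deriv z hz, rd.lineDeriv_eq_fderiv st hR0 hA hz, hgraph, fr.e_eq]
  -- For (iii) the C¹ regularity of h already obtained suffices.
  · exact ⟨(ι.comp (Xpm ι Binf).subtypeL).contDiff.comp_contDiffOn rd.contDiffOn, rd.contDiffOn⟩
  · obtain ⟨κ, hκ, h⟩ := hR₄ hE
    exact rd.exists_lipschitzOnWith st hR0 hR4 hκ h
  · refine ⟨rd.isC2minus0On_reduced st hR0 fun x hx => hR₃ x (hR3.trans_lt hx),
      rd.strict_fderiv_reduced st hR0, fun ρ' hρ' => ?_⟩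
    have hSE := condSE_of_strict fr hS hT' hAT hρ'
    exact ⟨hSE, hSE.condE⟩
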